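/- Let $-\infty\le a<b\le\infty$, let $J$ be a constant, invertible, skew-Hermitian complex $n\times n$-matrix, and let $q$ and $w$ be $n\times n$-matrices whose entries are distributions of order $0$ on $(a,b)$ (that is, distributional derivatives $q=Q'$, $w=W'$ of matrix functions $Q,W$ whose entries are complex-valued and locally of bounded variation on $(a,b)$), with $q$ Hermitian and $w$ non-negative. Write $f^\pm$ for the right- and left-hand limits of $f$, $\Delta_q(x)=Q^+(x)-Q^-(x)$, $\Delta_w(x)=W^+(x)-W^-(x)$, and for $x\in(a,b)$, $\lambda\in\mathbb C$ put $$B_\pm(x,\lambda)=J\pm\tfrac12\big(\Delta_q(x)-\lambda\Delta_w(x)\big),\qquad \Lambda_x=\{\lambda\in\mathbb C:\det B_+(x,\lambda)\det B_-(x,\lambda)=0\},$$ $\Xi_0=\{x\in(a,b):\det B_+(x,0)\det B_-(x,0)=0\}$ and $\Lambda_{(s,t)}=\bigcup_{x\in(s,t)}\Lambda_x$. A balanced solution of $Ju'+qu=\lambda wu$ on $(s,t)$ is a function $u:(s,t)\to\mathbb C^n$, locally of bounded variation, with $u=(u^++u^-)/2$ everywhere on $(s,t)$, satisfying the equation in the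 sense of distributions on $(s,t)$ (where $qu$ and $wu$ denote the measures $dQ\,u$ and $dW\,u$). Suppose $s<t$, $[s,t]\subset(a,b)$ and $(s,t)\cap\Xi_0=\emptyset$, and let $u_0\in\mathbb C^n$. Then for every $\lambda\in\mathbb C\setminus\Lambda_{(s,t)}$ the initial value problem $Ju'+qu=\lambda wu$, $u^+(s)=u_0$ has a unique balanced solution $u(\cdot,\lambda)$ on $(s,t)$. Moreover, the limit $u^-(t,\lambda)$ exists for these $\lambda$, and $u(x,\cdot)$, for each $x\in(s,t)$, as well as $u^-(t,\cdot)$ are analytic in $\mathbb C\setminus\Lambda_{(s,t)}$ and meromorphic on $\mathbb C$. The analogous statement holds when the initial condition is posed at $t$: for every $\lambda\in\mathbb C\setminus\Lambda_{(s,t)}$ the problem $Ju'+qu=\lambda wu$, $u^-(t)=u_0$ has a unique balanced solution $u(\cdot,\lambda)$ on $(s,t)$, the limit $u^+(s,\lambda)$ exists, and $u(x,\cdot)$, $x\in(s,t)$, as well as $u^+(s,\cdot)$ are analytic in $\mathbb C\setminus\Lambda_{(s,t)}$ and meromorphic on $\mathbb C$. -/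

import Mathlib

open Set Filter Topology MeasureTheory
open scoped Matrix Distributions ComplexOrder

/-- The open interval `(a, b)` of real numbers, where `-∞ ≤ a` and `b ≤ ∞`. -/
def realIoo (a b : EReal) : Set ℝ := {x | a < (x : EReal) ∧ (x : EReal) < b}

/-- `realIoo a b` as an open set. -/
def realIooOpens (a b : EReal) : TopologicalSpace.Opens ℝ :=
  ⟨realIoo a b, by
    have h : realIoo a b = (fun x : ℝ => (x : EReal)) ⁻¹' Ioo a b := rfl
    rw [h]
    exact isOpen_Ioo.preimage continuous_coe_real_ereal⟩

/-- The value at the test function `φ` of the distributional derivative of `f`, that is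
`-∫ φ' f dx`. -/
noncomputable def distDeriv (f : ℝ → ℂ) (φ : ℝ → ℝ) : ℂ :=
  -∫ x, ((deriv φ x : ℝ) : ℂ) * f x

/-- The function that agrees with `f` on `[s, t]` and is constant to the left of `s` and to the
right of `t`. -/
def clampFun (f : ℝ → ℂ) (s t : ℝ) : ℝ → ℂ := fun x => f (max s (min t x))

theorem boundedVariationOn_clampFun {f : ℝ → ℂ} {I : Set ℝ} {s t : ℝ} (hst : s ≤ t)
    (hf : LocallyBoundedVariationOn f I) (hI : Icc s t ⊆ I) :
    BoundedVariationOn (clampFun f s t) univ := by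
  have hm : Monotone fun x : ℝ => max s (min t x) := fun x y h =>
    max_le_max le_rfl (min_le_min le_rfl h)
  have h1 := hf s t (hI ⟨le_rfl, hst⟩) (hI ⟨hst, le_rfl⟩)
  refine ne_top_of_le_ne_top h1
    (eVariationOn.comp_le_of_monotoneOn f (fun x : ℝ => max s (min t x)) (hm.monotoneOn _) ?_)
  intro x _
  have hx : max s (min t x) ∈ Icc s t := ⟨le_max_left _ _, max_le hst (min_le_left _ _)⟩
  exact ⟨hI hx, hx⟩

open scoped Classical in
/-- A complex measure whose restriction to `(s, t)` is the Lebesgue-Stieltjes measure `df`, for a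
function `f` of bounded variation on `[s, t]`. -/
noncomputable def stieltjes (f : ℝ → ℂ) (s t : ℝ) : VectorMeasure ℝ ℂ :=
  if h : BoundedVariationOn (clampFun f s t) univ then h.vectorMeasure else 0

/-- The value at a test function `φ` with support in `(s, t)` of the product `f' g`, that is
`∫ φ g df`. Here `f` is of bounded variation on `[s, t]`, so that `f'` is the measure `df`, and
`g` is locally of bounded variation on `(s, t)`. -/
noncomputable def mulPairing (f g : ℝ → ℂ) (s t : ℝ) (φ : ℝ → ℝ) : ℂ :=
  (stieltjes f s t).integral (fun x => (φ x : ℂ) * g x) (ContinuousLinearMap.mul ℝ ℂ)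

section System

variable {n : ℕ}

/-- The matrix-valued distribution `F'` on `(a, b)` is Hermitian. -/
def HermitianDeriv (a b : EReal) (F : ℝ → Matrix (Fin n) (Fin n) ℂ) : Prop :=
  ∀ φ : 𝓓(realIooOpens a b, ℝ),
    (Matrix.of fun i j => distDeriv (fun x => F x i j) φ).IsHermitian

/-- The matrix-valued distribution `F'` on `(a, b)` is non-negative. -/
def NonnegDeriv (a b : EReal) (F : ℝ → Matrix (Fin n) (Fin n) ℂ) : Prop :=
  ∀ φ : 𝓓(realIooOpens a b, ℝ), (∀ x, 0 ≤ φ x) →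
    (Matrix.of fun i j => distDeriv (fun x => F x i j) φ).PosSemidef

/-- The jump `F⁺(x) - F⁻(x)`, i.e. the mass at `x` of the measure `F'`. -/
noncomputable def jump (F : ℝ → Matrix (Fin n) (Fin n) ℂ) (x : ℝ) :
    Matrix (Fin n) (Fin n) ℂ :=
  Matrix.of fun i j =>
    Function.rightLim (fun y => F y i j) x - Function.leftLim (fun y => F y i j) x

/-- `B₊(x, z) = J + (Δ_q(x) - z Δ_w(x)) / 2`, where `q = Q'` and `w = W'`. -/
noncomputable def Bplus (J : Matrix (Fin n) (Fin n) ℂ) (Q W : ℝ → Matrix (Fin n) (Fin n) ℂ)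
    (x : ℝ) (z : ℂ) : Matrix (Fin n) (Fin n) ℂ :=
  J + (1 / 2 : ℂ) • (jump Q x - z • jump W x)

/-- `B₋(x, z) = J - (Δ_q(x) - z Δ_w(x)) / 2`, where `q = Q'` and `w = W'`. -/
noncomputable def Bminus (J : Matrix (Fin n) (Fin n) ℂ) (Q W : ℝ → Matrix (Fin n) (Fin n) ℂ)
    (x : ℝ) (z : ℂ) : Matrix (Fin n) (Fin n) ℂ :=
  J - (1 / 2 : ℂ) • (jump Q x - z • jump W x)

/-- The set `Λ_x`. -/
def LambdaAt (J : Matrix (Fin n) (Fin n) ℂ) (Q W : ℝ → Matrix (Fin n) (Fin n) ℂ) (x : ℝ) :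
    Set ℂ :=
  {z | (Bplus J Q W x z).det * (Bminus J Q W x z).det = 0}

/-- The set `Λ_{(s,t)}`, the union of the sets `Λ_x` over `x ∈ (s, t)`. -/
def LambdaIoo (J : Matrix (Fin n) (Fin n) ℂ) (Q W : ℝ → Matrix (Fin n) (Fin n) ℂ) (s t : ℝ) :
    Set ℂ :=
  ⋃ x ∈ Ioo s t, LambdaAt J Q W x

/-- The set `Ξ_z`. -/
def XiSet (a b : EReal) (J : Matrix (Fin n) (Fin n) ℂ) (Q W : ℝ → Matrix (Fin n) (Fin n) ℂ)
    (z : ℂ) : Set ℝ :=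
  {x ∈ realIoo a b | (Bplus J Q W x z).det * (Bminus J Q W x z).det = 0}

/-- The function `u` is a balanced solution of `J u' + q u = z w u` on `(s, t)`, where `q = Q'`
and `w = W'`. Values of `u` outside `(s, t)` are irrelevant. -/
structure IsBalancedSolution (J : Matrix (Fin n) (Fin n) ℂ)
    (Q W : ℝ → Matrix (Fin n) (Fin n) ℂ) (s t : ℝ) (z : ℂ) (u : ℝ → Fin n → ℂ) : Prop where
  /-- `u` is locally of bounded variation on `(s, t)`. -/
  locallyBV : ∀ i, LocallyBoundedVariationOn (fun x => u x i) (Ioo s t)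
  /-- `u` is the average of its one-sided limits. -/
  balanced : ∀ x ∈ Ioo s t, ∀ i,
    u x i = (Function.rightLim (fun y => u y i) x + Function.leftLim (fun y => u y i) x) / 2
  /-- The equation holds in the sense of distributions on `(s, t)`. -/
  equation : ∀ φ : 𝓓((⟨Ioo s t, isOpen_Ioo⟩ : TopologicalSpace.Opens ℝ), ℝ), ∀ i,
    ∑ j, J i j * distDeriv (fun x => u x j) φ
        + ∑ j, mulPairing (fun x => Q x i j) (fun x => u x j) s t φ
      = z * ∑ j, mulPairing (fun x => W x i j) (fun x => u x j) s t φ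

end System

open scoped ENNReal NNReal

/-- A transitive asymmetric relation with measurable graph. -/
structure MeasurableStrictOrder {X : Type*} [MeasurableSpace X] (r : X → X → Prop) : Prop where
  trans : ∀ ⦃x y z⦄, r x y → r y z → r x z
  asymm : ∀ ⦃x y⦄, r x y → ¬ r y x
  measurableSet : MeasurableSet {p : X × X | r p.1 p.2}

/-! ### Iterated integrals over chains and Grönwall's inequality -/

section Volterra

variable {X : Type*} [MeasurableSpace X] {r : X → X → Prop}

theorem MeasurableStrictOrder.measurableSet_left (hr : MeasurableStrictOrder r) (x : X) :
    MeasurableSet {y | r y x} :=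
  (measurable_id.prodMk measurable_const) hr.measurableSet

theorem MeasurableStrictOrder.measurableSet_right (hr : MeasurableStrictOrder r) (x : X) :
    MeasurableSet {y | r x y} :=
  (measurable_const.prodMk measurable_id) hr.measurableSet

theorem MeasurableStrictOrder.measurable_lintegral (hr : MeasurableStrictOrder r) {ν : Measure X}
    [SFinite ν] {f : X → ℝ≥0∞} (hf : Measurable f) :
    Measurable fun x => ∫⁻ y in {y | r y x}, f y ∂ν := by
  have h : (fun x => ∫⁻ y in {y | r y x}, f y ∂ν) = fun x =>
      ∫⁻ y, ({p : X × X | r p.1 p.2}.indicator (fun p => f p.1)) (y, x) ∂ν := by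
    ext x
    rw [← lintegral_indicator (hr.measurableSet_left x)]
    rfl
  rw [h]
  exact ((hf.comp measurable_fst).indicator hr.measurableSet).lintegral_prod_left'

theorem MeasurableStrictOrder.stronglyMeasurable_integral (hr : MeasurableStrictOrder r)
    {ν : Measure X} [SFinite ν] {E : Type*} [NormedAddCommGroup E] [NormedSpace ℝ E]
    {f : X → E} (hf : StronglyMeasurable f) :
    StronglyMeasurable fun x => ∫ y in {y | r y x}, f y ∂ν := by
  have h : (fun x => ∫ y in {y | r y x}, f y ∂ν) = fun x =>
      ∫ y, ({p : X × X | r p.1 p.2}.indicator (fun p => f p.1)) (y, x) ∂ν := by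
    ext x
    rw [← integral_indicator (hr.measurableSet_left x)]
    rfl
  rw [h]
  exact ((hf.comp_measurable measurable_fst).indicator hr.measurableSet).integral_prod_left'

/-- The measure of the chains of length `k` below a point, as an iterated integral. -/
noncomputable def chainIntegral (ν : Measure X) (r : X → X → Prop) : ℕ → X → ℝ≥0∞
  | 0, _ => 1
  | k + 1, x => ∫⁻ y in {y | r y x}, chainIntegral ν r k y ∂ν

theorem measurable_chainIntegral (hr : MeasurableStrictOrder r) (ν : Measure X) [SFinite ν] :
    ∀ k, Measurable (chainIntegral ν r k)
  | 0 => measurable_const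
  | k + 1 => hr.measurable_lintegral (measurable_chainIntegral hr ν k)

theorem chainIntegral_one (ν : Measure X) (x : X) :
    chainIntegral ν r 1 x = ν {y | r y x} := by
  simp [chainIntegral]

/-- For y below x, the points below x include the disjoint sets of points below y and of points
strictly between y and x. Inserting this into ∫ ν(S) c_k(y), the first set is handled by the
induction hypothesis, and the second gives exactly c_{k+2}(x) by Tonelli. Points equal or
incomparable to y are dropped, which is why atoms cost nothing. -/
theorem succ_mul_chainIntegral_le (hr : MeasurableStrictOrder r) (ν : Measure X) [SFinite ν]
    (k : ℕ) (x : X) :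
    (k + 1) * chainIntegral ν r (k + 1) x ≤ chainIntegral ν r 1 x * chainIntegral ν r k x := by
  induction k generalizing x with
  | zero => simp [chainIntegral]
  | succ k ih =>
    set S := {y | r y x}
    have hS : MeasurableSet S := hr.measurableSet_left x
    have hk := measurable_chainIntegral hr ν k
    have h1 : chainIntegral ν r 1 x * chainIntegral ν r (k + 1) x
        = ∫⁻ y in S, ν S * chainIntegral ν r k y ∂ν := by
      rw [lintegral_const_mul _ hk, chainIntegral_one]
      rfl
    have h2 : ∀ y ∈ S, chainIntegral ν r 1 y * chainIntegral ν r k y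
        + ν.restrict S {y' | r y y'} * chainIntegral ν r k y ≤ ν S * chainIntegral ν r k y := by
      intro y hy
      rw [← add_mul]
      gcongr
      rw [chainIntegral_one, Measure.restrict_apply (hr.measurableSet_right y),
        ← measure_union _ ((hr.measurableSet_right y).inter hS)]
      · refine measure_mono ?_
        rintro z (hz | hz)
        · exact hr.trans hz hy
        · exact hz.2
      · rw [Set.disjoint_left]
        intro z hz hz'
        exact hr.asymm hz hz'.1
    have h3 : ∫⁻ y in S, ν.restrict S {y' | r y y'} * chainIntegral ν r k y ∂ν
        = chainIntegral ν r (k + 2) x := by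
      have h4 : ∀ y, ν.restrict S {y' | r y y'} * chainIntegral ν r k y
          = ∫⁻ y' in S, {p : X × X | r p.1 p.2}.indicator
            (fun p => chainIntegral ν r k p.1) (y, y') ∂ν := by
        intro y
        rw [mul_comm, ← setLIntegral_const, ← lintegral_indicator (hr.measurableSet_right y)]
        rfl
      simp_rw [h4]
      rw [lintegral_lintegral_swap]
      · refine setLIntegral_congr_fun hS fun y' hy' => ?_
        have : chainIntegral ν r (k + 1) y' = ∫⁻ y in {y | r y y'}, chainIntegral ν r k y ∂ν := rfl
        change _ = chainIntegral ν r (k + 1) y'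
        rw [this, ← lintegral_indicator (hr.measurableSet_left y'), ← lintegral_indicator hS]
        refine lintegral_congr fun y => ?_
        by_cases h : r y y'
        · simp [h, S, hr.trans h hy', Set.indicator]
        · simp [h, Set.indicator]
      · exact ((hk.comp measurable_fst).indicator hr.measurableSet).aemeasurable
    calc ((k + 1 : ℕ) + 1 : ℝ≥0∞) * chainIntegral ν r (k + 1 + 1) x
        = (k + 1) * chainIntegral ν r (k + 2) x + chainIntegral ν r (k + 2) x := by
          push_cast; ring
      _ = ∫⁻ y in S, (k + 1) * chainIntegral ν r (k + 1) y ∂ν + chainIntegral ν r (k + 2) x := by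
          rw [lintegral_const_mul _ (measurable_chainIntegral hr ν (k + 1))]
          rfl
      _ ≤ ∫⁻ y in S, chainIntegral ν r 1 y * chainIntegral ν r k y ∂ν
          + chainIntegral ν r (k + 2) x := by
          exact add_le_add (lintegral_mono fun y => ih y) le_rfl
      _ = ∫⁻ y in S, (chainIntegral ν r 1 y * chainIntegral ν r k y
            + ν.restrict S {y' | r y y'} * chainIntegral ν r k y) ∂ν := by
          rw [lintegral_add_left (f := fun y => chainIntegral ν r 1 y * chainIntegral ν r k y)
            ((measurable_chainIntegral hr ν 1).mul hk), h3]
      _ ≤ ∫⁻ y in S, ν S * chainIntegral ν r k y ∂ν := setLIntegral_mono' hS h2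
      _ = _ := h1.symm

theorem factorial_mul_chainIntegral_le (hr : MeasurableStrictOrder r) (ν : Measure X) [SFinite ν]
    (k : ℕ) (x : X) : (k.factorial : ℝ≥0∞) * chainIntegral ν r k x ≤ ν univ ^ k := by
  induction k with
  | zero => simp [chainIntegral]
  | succ k ih =>
    calc ((k + 1).factorial : ℝ≥0∞) * chainIntegral ν r (k + 1) x
        = k.factorial * ((k + 1) * chainIntegral ν r (k + 1) x) := by
          rw [Nat.factorial_succ]; push_cast; ring
      _ ≤ k.factorial * (chainIntegral ν r 1 x * chainIntegral ν r k x) := by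
          exact mul_le_mul' le_rfl (succ_mul_chainIntegral_le hr ν k x)
      _ = (k.factorial * chainIntegral ν r k x) * chainIntegral ν r 1 x := by ring
      _ ≤ ν univ ^ k * ν univ := by
          gcongr
          rw [chainIntegral_one]
          exact measure_mono (subset_univ _)
      _ = ν univ ^ (k + 1) := (pow_succ _ _).symm

theorem chainIntegral_le (hr : MeasurableStrictOrder r) (ν : Measure X) [IsFiniteMeasure ν]
    (k : ℕ) (x : X) :
    chainIntegral ν r k x ≤ ENNReal.ofReal (ν.real univ ^ k / k.factorial) := by
  rw [ENNReal.ofReal_div_of_pos (by positivity), ENNReal.ofReal_pow measureReal_nonneg,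
    ofReal_measureReal, ENNReal.ofReal_natCast,
    ENNReal.le_div_iff_mul_le (Or.inl (by positivity)) (Or.inl (by simp)), mul_comm]
  exact factorial_mul_chainIntegral_le hr ν k x

theorem sum_chainIntegral_le (hr : MeasurableStrictOrder r) (ν : Measure X) [IsFiniteMeasure ν]
    (k : ℕ) (x : X) :
    ∑ j ∈ Finset.range k, chainIntegral ν r j x ≤ ENNReal.ofReal (Real.exp (ν.real univ)) := by
  calc ∑ j ∈ Finset.range k, chainIntegral ν r j x
      ≤ ∑ j ∈ Finset.range k, ENNReal.ofReal (ν.real univ ^ j / j.factorial) :=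
        Finset.sum_le_sum fun j _ => chainIntegral_le hr ν j x
    _ = ENNReal.ofReal (∑ j ∈ Finset.range k, ν.real univ ^ j / j.factorial) := by
        rw [ENNReal.ofReal_sum_of_nonneg]
        intro j _
        positivity
    _ ≤ _ := ENNReal.ofReal_le_ofReal (Real.sum_le_exp_of_nonneg measureReal_nonneg k)

/-- Grönwall's inequality on a set that is closed downwards. -/
theorem gronwall_lintegral (hr : MeasurableStrictOrder r) (ν : Measure X) [IsFiniteMeasure ν]
    {T : Set X} (hT : ∀ x ∈ T, ∀ y, r y x → y ∈ T) {f : X → ℝ≥0∞} {C M : ℝ≥0∞} (hM : M ≠ ∞)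
    (hfM : ∀ x ∈ T, f x ≤ M) (hf : ∀ x ∈ T, f x ≤ C + ∫⁻ y in {y | r y x}, f y ∂ν)
    {x : X} (hx : x ∈ T) : f x ≤ C * ENNReal.ofReal (Real.exp (ν.real univ)) := by
  -- Insert the hypothesis into itself k times; the remainder M c_k tends to 0. Only the measurable
  -- majorants are integrated, so `f` need not be measurable.
  have key : ∀ k, ∀ x ∈ T, f x ≤ C * ∑ j ∈ Finset.range k, chainIntegral ν r j x
      + M * chainIntegral ν r k x := by
    intro k
    induction k with
    | zero => intro x hx; simpa [chainIntegral] using hfM x hx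
    | succ k ih =>
      intro x hx
      have hmeas := measurable_chainIntegral hr ν
      calc f x ≤ C + ∫⁻ y in {y | r y x}, f y ∂ν := hf x hx
        _ ≤ C + ∫⁻ y in {y | r y x}, (C * ∑ j ∈ Finset.range k, chainIntegral ν r j y
              + M * chainIntegral ν r k y) ∂ν := by
            gcongr 1
            exact setLIntegral_mono' (hr.measurableSet_left x) fun y hy => ih y (hT x hx y hy)
        _ = C + (C * ∑ j ∈ Finset.range k, chainIntegral ν r (j + 1) x
              + M * chainIntegral ν r (k + 1) x) := by
            rw [lintegral_add_right _ ((hmeas k).const_mul M), lintegral_const_mul _ (hmeas k),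
              lintegral_const_mul _ (Finset.measurable_sum _ fun j _ => hmeas j),
              lintegral_finsetSum _ fun j _ => hmeas j]
            rfl
        _ = _ := by
            rw [Finset.sum_range_succ' _ k, mul_add, ← add_assoc]
            simp only [chainIntegral, mul_one]
            rw [add_comm C]
  have hlim : Tendsto (fun k : ℕ => C * ENNReal.ofReal (Real.exp (ν.real univ))
      + M * ENNReal.ofReal (ν.real univ ^ k / k.factorial)) atTop
      (𝓝 (C * ENNReal.ofReal (Real.exp (ν.real univ)) + M * 0)) := by
    refine tendsto_const_nhds.add (ENNReal.Tendsto.const_mul ?_ (Or.inr hM))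
    rw [← ENNReal.ofReal_zero]
    exact ENNReal.tendsto_ofReal (FloorSemiring.tendsto_pow_div_factorial_atTop _)
  rw [mul_zero, add_zero] at hlim
  refine ge_of_tendsto' hlim fun k => (key k x hx).trans ?_
  gcongr
  · exact sum_chainIntegral_le hr ν k x
  · exact chainIntegral_le hr ν k x

/-- The factor in Grönwall's inequality for a measure with `k` additional atoms of mass `c`. -/
noncomputable def gronwallFactor (e c : ℝ≥0∞) : ℕ → ℝ≥0∞
  | 0 => e
  | k + 1 => (1 + c * gronwallFactor e c k) * gronwallFactor e c k

open scoped Classical in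
/-- Grönwall's inequality in the presence of finitely many additional atoms. -/
theorem gronwall_lintegral_add_sum (hr : MeasurableStrictOrder r) (ν : Measure X)
    [IsFiniteMeasure ν] {f : X → ℝ≥0∞} {c M : ℝ≥0∞} (hM : M ≠ ∞) (F : Finset X) {T : Set X}
    (hT : ∀ x ∈ T, ∀ y, r y x → y ∈ T) {C : ℝ≥0∞} (hfM : ∀ x ∈ T, f x ≤ M)
    (hf : ∀ x ∈ T, f x ≤ C + ∫⁻ y in {y | r y x}, f y ∂ν + ∑ i ∈ F, if r i x then c * f i else 0)
    {x : X} (hx : x ∈ T) :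
    f x ≤ C * gronwallFactor (ENNReal.ofReal (Real.exp (ν.real univ))) c F.card := by
  induction F using Finset.induction_on generalizing T C x with
  | empty =>
    refine gronwall_lintegral hr ν hT hM hfM (fun x hx => ?_) hx
    simpa using hf x hx
  | insert a F ha ih =>
    set P := gronwallFactor (ENNReal.ofReal (Real.exp (ν.real univ))) c F.card with hP
    rw [Finset.card_insert_of_notMem ha]
    change f x ≤ C * ((1 + c * P) * P)
    have h0 : ∀ x ∈ T, f x ≤ (C + if r a x then c * f a else 0) + ∫⁻ y in {y | r y x}, f y ∂ν
        + ∑ i ∈ F, if r i x then c * f i else 0 := by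
      intro x hx
      refine (hf x hx).trans (le_of_eq ?_)
      rw [Finset.sum_insert ha]
      ring
    by_cases haT : a ∈ T
    · have h1 : f a ≤ C * P := by
        -- The points not above `a` form a downward closed set which contains `a` and on which the
        -- atom at `a` has no effect. This bounds `f a`; afterwards the atom only enlarges the
        -- constant from C to C + c (C P).
        refine ih (T := {x | x ∈ T ∧ ¬ r a x}) ?_ (fun x hx => hfM x hx.1) ?_
          ⟨haT, fun h => hr.asymm h h⟩
        · exact fun x hx y hy => ⟨hT x hx.1 y hy, fun h => hx.2 (hr.trans h hy)⟩
        · intro x hx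
          simpa [hx.2] using h0 x hx.1
      have h2 : f x ≤ (C + c * (C * P)) * P := by
        refine ih hT hfM (fun x hx => (h0 x hx).trans ?_) hx
        gcongr
        split_ifs
        · gcongr
        · exact zero_le
      exact h2.trans (le_of_eq (by ring))
    · have h1 : f x ≤ C * P := by
        refine ih hT hfM (fun x hx => (h0 x hx).trans ?_) hx
        rw [if_neg fun h => haT (hT x hx a h), add_zero]
      refine h1.trans ?_
      gcongr
      calc P = 1 * P := (one_mul P).symm
        _ ≤ (1 + c * P) * P := by gcongr; exact le_self_add

/-- The exponent depends only on the number of atoms. Polynomial growth in `c` is what later rules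
out essential singularities. -/
theorem exists_gronwallFactor_le_pow (k : ℕ) :
    ∃ a : ℕ, ∀ e c : ℝ≥0∞, 1 ≤ e → 1 ≤ c → gronwallFactor e c k ≤ (2 * c * e) ^ a := by
  induction k with
  | zero =>
    refine ⟨1, fun e c he hc => ?_⟩
    calc e = 1 * 1 * e := by ring
      _ ≤ (2 * c * e) := by gcongr; exact one_le_two
      _ = _ := (pow_one _).symm
  | succ k ih =>
    obtain ⟨a, ha⟩ := ih
    refine ⟨1 + a + a, fun e c he hc => ?_⟩
    have h1 := ha e c he hc
    have h2 : 1 ≤ 2 * c * e := by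
      calc (1 : ℝ≥0∞) = 1 * 1 * 1 := by ring
        _ ≤ 2 * c * e := by gcongr; exact one_le_two
    have h3 : 1 + c * gronwallFactor e c k ≤ (2 * c * e) ^ (1 + a) := by
      calc 1 + c * gronwallFactor e c k ≤ c * (2 * c * e) ^ a + c * (2 * c * e) ^ a := by
            gcongr
            exact one_le_mul hc (one_le_pow₀ h2)
        _ = 2 * c * 1 * (2 * c * e) ^ a := by ring
        _ ≤ 2 * c * e * (2 * c * e) ^ a := by gcongr
        _ = _ := by rw [pow_add, pow_one]
    calc gronwallFactor e c (k + 1) = (1 + c * gronwallFactor e c k) * gronwallFactor e c k := rfl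
      _ ≤ (2 * c * e) ^ (1 + a) * (2 * c * e) ^ a := mul_le_mul' h3 h1
      _ = _ := (pow_add _ _ _).symm

end Volterra

/-! ### Holomorphic families of linear Volterra equations: existence -/

section Volterra

theorem MeasureTheory.AEStronglyMeasurable.clm_apply' {X E F : Type*} [MeasurableSpace X]
    [NormedAddCommGroup E] [NormedSpace ℂ E] [NormedAddCommGroup F] [NormedSpace ℂ F]
    {μ : Measure X} {K : X → E →L[ℂ] F} {v : X → E} (hK : AEStronglyMeasurable K μ)
    (hv : AEStronglyMeasurable v μ) : AEStronglyMeasurable (fun y => K y (v y)) μ :=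
  isBoundedBilinearMap_apply.continuous.comp_aestronglyMeasurable (hK.prodMk hv)

variable {X : Type*} [MeasurableSpace X] {r : X → X → Prop}
  {E : Type*} [NormedAddCommGroup E] [NormedSpace ℂ E]

/-- A dominated integral of holomorphic functions is holomorphic. -/
theorem differentiableOn_integral_of_dominated {μ : Measure X} {U : Set ℂ} (hU : IsOpen U)
    {F : ℂ → X → E} {g : X → ℝ} (hFm : ∀ z ∈ U, AEStronglyMeasurable (F z) μ)
    (hg : Integrable g μ) (hFg : ∀ z ∈ U, ∀ y, ‖F z y‖ ≤ g y)
    (hFd : ∀ y, DifferentiableOn ℂ (fun z => F z y) U) :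
    DifferentiableOn ℂ (fun z => ∫ y, F z y ∂μ) U := by
  intro z₀ hz₀
  obtain ⟨ρ, hρ, hball⟩ := Metric.isOpen_iff.1 hU z₀ hz₀
  have hat : ∀ z ∈ U, ∀ y, HasDerivAt (fun z => F z y) (deriv (fun z => F z y) z) z := fun z hz y =>
    ((hFd y).differentiableAt (hU.mem_nhds hz)).hasDerivAt
  have hmeas : AEStronglyMeasurable (fun y => deriv (fun z => F z y) z₀) μ := by
    -- The derivative is measurable as the pointwise limit of difference quotients along this
    -- sequence, which stays in the ball of radius ρ.
    have hmem : ∀ n : ℕ, z₀ + ((ρ / 2 / (n + 1) : ℝ) : ℂ) ∈ U := by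
      intro n
      apply hball
      rw [Metric.mem_ball, dist_eq_norm, add_sub_cancel_left, Complex.norm_real, Real.norm_eq_abs,
        abs_of_pos (by positivity)]
      calc ρ / 2 / (n + 1) ≤ ρ / 2 / 1 := by gcongr; linarith [n.cast_nonneg (α := ℝ)]
        _ < ρ := by linarith
    refine aestronglyMeasurable_of_tendsto_ae atTop
      (f := fun (n : ℕ) y => slope (fun z => F z y) z₀ (z₀ + ((ρ / 2 / (n + 1) : ℝ) : ℂ))) ?_ ?_
    · intro n
      exact ((hFm _ (hmem n)).sub (hFm _ hz₀)).const_smul _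
    · refine Eventually.of_forall fun y => ?_
      refine (hasDerivAt_iff_tendsto_slope.1 (hat z₀ hz₀ y)).comp ?_
      refine tendsto_nhdsWithin_iff.2 ⟨?_, Eventually.of_forall fun n => ?_⟩
      · have h1 : Tendsto (fun n : ℕ => ρ / 2 / ((n : ℝ) + 1)) atTop (𝓝 0) :=
          tendsto_const_nhds.div_atTop
            (tendsto_atTop_add_const_right _ _ tendsto_natCast_atTop_atTop)
        have h2 := (Complex.continuous_ofReal.tendsto 0).comp h1
        simpa using (tendsto_const_nhds (x := z₀)).add h2
      · have : ((ρ / 2 / ((n : ℝ) + 1) : ℝ) : ℂ) ≠ 0 :=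
          Complex.ofReal_ne_zero.2 (by positivity)
        simpa only [mem_compl_iff, mem_singleton_iff, add_eq_left] using this
  have key := hasDerivAt_integral_of_dominated_loc_of_deriv_le (𝕜 := ℂ) (μ := μ) (F := F)
    (F' := fun z y => deriv (fun z => F z y) z) (x₀ := z₀) (bound := fun y => g y / (ρ / 2))
    (Metric.ball_mem_nhds z₀ (half_pos hρ))
    (Filter.mem_of_superset (hU.mem_nhds hz₀) hFm)
    (hg.mono' (hFm z₀ hz₀) (Eventually.of_forall (hFg z₀ hz₀))) hmeas
    (Eventually.of_forall fun y z hz => ?_) (hg.div_const _)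
    (Eventually.of_forall fun y z hz =>
      hat z (hball (Metric.ball_subset_ball (by linarith) hz)) y)
  · exact key.2.differentiableAt.differentiableWithinAt
  · have hsub : Metric.closedBall z (ρ / 2) ⊆ U := by
      intro w hw
      apply hball
      rw [Metric.mem_ball] at hz ⊢
      rw [Metric.mem_closedBall] at hw
      linarith [dist_triangle w z z₀]
    -- Cauchy's estimate on the circle of radius ρ/2 turns the bound `g` on the functions into the
    -- bound g/(ρ/2) on their derivatives.
    refine Complex.norm_deriv_le_of_forall_mem_sphere_norm_le (half_pos hρ) ?_ ?_
    · exact ((hFd y).mono hsub).diffContOnCl_ball subset_rfl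
    · exact fun w hw => hFg w (hsub (Metric.sphere_subset_closedBall hw)) y

/-- Existence and holomorphic dependence on the parameter for linear Volterra equations. -/
theorem exists_volterra_solution [CompleteSpace E] (hr : MeasurableStrictOrder r) (μ : Measure X)
    [IsFiniteMeasure μ] {U : Set ℂ} (hU : IsOpen U) {K : ℂ → X → E →L[ℂ] E}
    (hKm : ∀ z ∈ U, AEStronglyMeasurable (K z) μ) {k : X → ℝ} (hk : Integrable k μ)
    (hKk : ∀ z ∈ U, ∀ y, ‖K z y‖ ≤ k y) (hKd : ∀ y, DifferentiableOn ℂ (fun z => K z y) U)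
    (u₀ : E) :
    ∃ v : X → ℂ → E,
      (∀ z ∈ U, StronglyMeasurable fun x => v x z) ∧
      (∃ M : ℝ, ∀ z ∈ U, ∀ x, ‖v x z‖ ≤ M) ∧
      (∀ z ∈ U, ∀ x, v x z = u₀ + ∫ y in {y | r y x}, K z y (v y z) ∂μ) ∧
      ∀ x, DifferentiableOn ℂ (v x) U := by
  rcases U.eq_empty_or_nonempty with rfl | ⟨z₁, hz₁⟩
  · exact ⟨fun _ _ => 0, by simp, by simp, by simp, by simp⟩
  have hk0 : ∀ y, 0 ≤ k y := fun y => (norm_nonneg _).trans (hKk z₁ hz₁ y)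
  let ν := μ.withDensity fun y => ENNReal.ofReal (k y)
  have hkm : AEMeasurable (fun y => ENNReal.ofReal (k y)) μ :=
    hk.aestronglyMeasurable.aemeasurable.ennreal_ofReal
  have : IsFiniteMeasure ν := isFiniteMeasure_withDensity_ofReal hk.2
  -- The terms of the Neumann series. With ν = k μ, the j-th term is at most ‖u₀‖ times the j-th
  -- chain integral, hence at most ‖u₀‖ ν(univ)^j / j!, uniformly in x and z.
  let w : ℕ → X → ℂ → E := fun j => Nat.rec (fun _ _ => u₀)
    (fun _ w x z => ∫ y in {y | r y x}, K z y (w y z) ∂μ) j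
  have w0 : ∀ x z, w 0 x z = u₀ := fun _ _ => rfl
  have wsucc : ∀ j x z, w (j + 1) x z = ∫ y in {y | r y x}, K z y (w j y z) ∂μ :=
    fun _ _ _ => rfl
  have wm : ∀ z ∈ U, ∀ j, StronglyMeasurable fun x => w j x z := by
    intro z hz j
    induction j with
    | zero => exact stronglyMeasurable_const
    | succ j ih =>
      have h1 : AEStronglyMeasurable (fun y => K z y (w j y z)) μ :=
        AEStronglyMeasurable.clm_apply' (hKm z hz) ih.aestronglyMeasurable
      have h2 := hr.stronglyMeasurable_integral (ν := μ) h1.stronglyMeasurable_mk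
      convert h2 using 2 with x
      rw [wsucc]
      exact integral_congr_ae (ae_restrict_of_ae h1.ae_eq_mk)
  have wb : ∀ z ∈ U, ∀ j x, ‖w j x z‖ₑ ≤ ‖u₀‖ₑ * chainIntegral ν r j x := by
    intro z hz j
    induction j with
    | zero => intro x; simp [w0, chainIntegral]
    | succ j ih =>
      intro x
      have hS := hr.measurableSet_left x
      calc ‖w (j + 1) x z‖ₑ ≤ ∫⁻ y in {y | r y x}, ‖K z y (w j y z)‖ₑ ∂μ := by
            rw [wsucc]; exact enorm_integral_le_lintegral_enorm _
        _ ≤ ∫⁻ y in {y | r y x}, ENNReal.ofReal (k y) * (‖u₀‖ₑ * chainIntegral ν r j y) ∂μ := by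
            refine lintegral_mono fun y => ?_
            refine ((K z y).le_opENorm _).trans (mul_le_mul' ?_ (ih y))
            rw [← ofReal_norm]
            exact ENNReal.ofReal_le_ofReal (hKk z hz y)
        _ = ∫⁻ y in {y | r y x}, ‖u₀‖ₑ * chainIntegral ν r j y ∂ν := by
            rw [restrict_withDensity hS,
              lintegral_withDensity_eq_lintegral_mul₀ hkm.restrict
                ((measurable_chainIntegral hr ν j).const_mul _).aemeasurable]
            rfl
        _ = _ := by
            rw [lintegral_const_mul _ (measurable_chainIntegral hr ν j)]; rfl
  set a : ℕ → ℝ := fun j => ‖u₀‖ * (ν.real univ ^ j / j.factorial) with ha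
  have wb' : ∀ z ∈ U, ∀ j x, ‖w j x z‖ ≤ a j := by
    intro z hz j x
    have h := (wb z hz j x).trans (mul_le_mul' le_rfl (chainIntegral_le hr ν j x))
    rw [← ofReal_norm, ← ofReal_norm, ← ENNReal.ofReal_mul (norm_nonneg _)] at h
    exact (ENNReal.ofReal_le_ofReal_iff (by positivity)).1 h
  have hasum : Summable a := (Real.summable_pow_div_factorial _).mul_left _
  have wd : ∀ j x, DifferentiableOn ℂ (w j x) U := by
    intro j
    induction j with
    | zero => exact fun x => differentiableOn_const _
    | succ j ih =>
      intro x
      refine differentiableOn_integral_of_dominated (g := fun y => k y * a j) hU ?_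
        (hk.mul_const _).integrableOn ?_ ?_
      · exact fun z hz => (AEStronglyMeasurable.clm_apply' (hKm z hz) (wm z hz j).aestronglyMeasurable).restrict
      · intro z hz y
        refine ((K z y).le_opNorm _).trans ?_
        exact mul_le_mul (hKk z hz y) (wb' z hz j y) (norm_nonneg _) (hk0 y)
      · exact fun y => (hKd y).clm_apply (ih y)
  have wsum : ∀ z ∈ U, ∀ x, Summable fun j => w j x z := fun z hz x =>
    Summable.of_norm_bounded hasum fun j => wb' z hz j x
  refine ⟨fun x z => ∑' j, w j x z, ?_, ⟨∑' j, a j, ?_⟩, ?_, ?_⟩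
  · intro z hz
    refine stronglyMeasurable_of_tendsto atTop
      (f := fun (N : ℕ) x => ∑ j ∈ Finset.range N, w j x z) ?_ ?_
    · intro N
      exact Finset.stronglyMeasurable_fun_sum _ fun j _ => wm z hz j
    · exact tendsto_pi_nhds.2 fun x => (wsum z hz x).hasSum.tendsto_sum_nat
  · intro z hz x
    exact tsum_of_norm_bounded hasum.hasSum fun j => wb' z hz j x
  · intro z hz x
    have h1 : HasSum (fun j => w (j + 1) x z) (∫ y in {y | r y x}, K z y (∑' j, w j y z) ∂μ) := by
      simp_rw [wsucc]
      refine hasSum_integral_of_dominated_convergence (fun j y => k y * a j) ?_ ?_ ?_ ?_ ?_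
      · exact fun j => (AEStronglyMeasurable.clm_apply' (hKm z hz) (wm z hz j).aestronglyMeasurable).restrict
      · intro j
        refine Eventually.of_forall fun y => ((K z y).le_opNorm _).trans ?_
        exact mul_le_mul (hKk z hz y) (wb' z hz j y) (norm_nonneg _) (hk0 y)
      · exact Eventually.of_forall fun y => hasum.mul_left _
      · simp_rw [tsum_mul_left]
        exact (hk.mul_const _).integrableOn
      · exact Eventually.of_forall fun y => (K z y).hasSum (wsum z hz y).hasSum
    change ∑' j, w j x z = u₀ + ∫ y in {y | r y x}, K z y (∑' j, w j y z) ∂μ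
    rw [(wsum z hz x).tsum_eq_zero_add, h1.tsum_eq, w0]
  · intro x
    exact Complex.differentiableOn_tsum_of_summable_norm hasum (fun j => wd j x) hU
      fun j z hz => wb' z hz j x

end Volterra

/-! ### Linear Volterra equations: uniqueness and growth -/

section Volterra

variable {X : Type*} [MeasurableSpace X] {r : X → X → Prop}
  {E : Type*} [NormedAddCommGroup E] [NormedSpace ℂ E]

/-- Bounded solutions of a linear Volterra equation are unique. -/
theorem eqOn_of_volterra (hr : MeasurableStrictOrder r) (μ : Measure X)
    {K : X → E →L[ℂ] E} (hK : Integrable K μ) {T : Set X}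
    (hT : ∀ x ∈ T, ∀ᵐ y ∂μ, r y x → y ∈ T) {u₀ : E} {v w : X → E} {M : ℝ}
    (hv : ∀ x ∈ T, ‖v x‖ ≤ M) (hw : ∀ x ∈ T, ‖w x‖ ≤ M)
    (hvi : ∀ x ∈ T, IntegrableOn (fun y => K y (v y)) {y | r y x} μ)
    (hwi : ∀ x ∈ T, IntegrableOn (fun y => K y (w y)) {y | r y x} μ)
    (hve : ∀ x ∈ T, v x = u₀ + ∫ y in {y | r y x}, K y (v y) ∂μ)
    (hwe : ∀ x ∈ T, w x = u₀ + ∫ y in {y | r y x}, K y (w y) ∂μ) : EqOn v w T := by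
  let ν := μ.withDensity fun y => ‖K y‖ₑ
  have : IsFiniteMeasure ν := ⟨by
    rw [withDensity_apply _ MeasurableSet.univ, setLIntegral_univ]; exact hK.2⟩
  intro x hx
  -- Grönwall with C = 0 for the difference. Extending it by zero off `T` allows the whole space as
  -- domain, since `T` is closed downwards only up to null sets.
  have h := gronwall_lintegral hr ν (T := univ) (fun _ _ _ _ => mem_univ _)
    (f := T.indicator fun x => ‖v x - w x‖ₑ) (C := 0)
    (M := ENNReal.ofReal (M + M)) ENNReal.ofReal_ne_top (fun x _ => ?_) (fun x _ => ?_)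
    (mem_univ x)
  · rw [zero_mul, nonpos_iff_eq_zero, indicator_of_mem hx, enorm_eq_zero, sub_eq_zero] at h
    exact h
  · by_cases hx : x ∈ T
    · rw [indicator_of_mem hx, ← ofReal_norm]
      exact ENNReal.ofReal_le_ofReal ((norm_sub_le _ _).trans (add_le_add (hv x hx) (hw x hx)))
    · simp [hx]
  · by_cases hx : x ∈ T
    · rw [zero_add, restrict_withDensity (hr.measurableSet_left x),
        lintegral_withDensity_eq_lintegral_mul_non_measurable₀ _
          hK.aestronglyMeasurable.enorm.restrict (Eventually.of_forall fun y => enorm_lt_top)]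
      rw [indicator_of_mem hx, hve x hx, hwe x hx, add_sub_add_left_eq_sub,
        ← integral_sub (hvi x hx) (hwi x hx)]
      refine (enorm_integral_le_lintegral_enorm _).trans (lintegral_mono_ae ?_)
      refine (ae_restrict_iff' (hr.measurableSet_left x)).2 ?_
      filter_upwards [hT x hx] with y hy hyx
      rw [← map_sub, Pi.mul_apply, indicator_of_mem (hy hyx)]
      exact (K y).le_opENorm _
    · simp [hx]

open scoped Classical in
/-- A bound for solutions of linear Volterra equations that is polynomial in the size of the
kernel at a given finite set of atoms. -/
theorem norm_le_of_volterra [MeasurableSingletonClass X] (hr : MeasurableStrictOrder r)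
    (μ : Measure X) [IsFiniteMeasure μ]
    {k : X → ℝ} (hk : Integrable k μ) (F : Finset X) :
    ∃ (a : ℕ) (e : ℝ), ∀ (K : X → E →L[ℂ] E) (c : ℝ), 1 ≤ c → (∀ y ∉ F, ‖K y‖ ≤ k y) →
      (∀ y ∈ F, μ.real {y} * ‖K y‖ ≤ c) → ∀ (u₀ : E) (v : X → E), (∃ M, ∀ x, ‖v x‖ ≤ M) →
      (∀ x, v x = u₀ + ∫ y in {y | r y x}, K y (v y) ∂μ) → ∀ x, ‖v x‖ ≤ ‖u₀‖ * (c * e) ^ a := by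
  let ν := μ.withDensity fun y => ENNReal.ofReal (k y)
  have hkm : AEMeasurable (fun y => ENNReal.ofReal (k y)) μ :=
    hk.aestronglyMeasurable.aemeasurable.ennreal_ofReal
  have : IsFiniteMeasure ν := isFiniteMeasure_withDensity_ofReal hk.2
  obtain ⟨a, ha⟩ := exists_gronwallFactor_le_pow F.card
  refine ⟨a, 2 * Real.exp (ν.real univ), ?_⟩
  rintro K c hc hKk hKF u₀ v ⟨M, hM⟩ hv x
  have hS := hr.measurableSet_left
  have h := gronwall_lintegral_add_sum hr ν (f := fun x => ‖v x‖ₑ) (c := ENNReal.ofReal c)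
    (M := ENNReal.ofReal M) ENNReal.ofReal_ne_top F (T := univ) (C := ‖u₀‖ₑ)
    (fun _ _ _ _ => mem_univ _) (fun x _ => ?_) (fun x _ => ?_) (mem_univ x)
  · have h1 := h.trans (mul_le_mul' le_rfl (ha _ _ ?_ ?_))
    · rw [← ofReal_norm, ← ofReal_norm, ← ENNReal.ofReal_ofNat, ← ENNReal.ofReal_mul (by simp),
        ← ENNReal.ofReal_mul (by positivity), ← ENNReal.ofReal_pow (by positivity),
        ← ENNReal.ofReal_mul (by positivity), ENNReal.ofReal_le_ofReal_iff (by positivity)] at h1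
      refine h1.trans (le_of_eq ?_)
      congr 2
      ring
    · rw [ENNReal.one_le_ofReal]
      exact Real.one_le_exp measureReal_nonneg
    · rwa [ENNReal.one_le_ofReal]
  · rw [← ofReal_norm]
    exact ENNReal.ofReal_le_ofReal (hM x)
  · rw [restrict_withDensity (hS x),
      lintegral_withDensity_eq_lintegral_mul_non_measurable₀ _
        hkm.restrict (Eventually.of_forall fun y => ENNReal.ofReal_lt_top)]
    calc ‖v x‖ₑ ≤ ‖u₀‖ₑ + ∫⁻ y in {y | r y x}, ‖K y (v y)‖ₑ ∂μ := by
          rw [hv x]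
          exact (enorm_add_le _ _).trans (add_le_add le_rfl (enorm_integral_le_lintegral_enorm _))
      -- Off `F` the kernel is absorbed into the density `k`; on `F` it is charged to separate point
      -- masses, each of weight at most `c`.
      _ ≤ ‖u₀‖ₑ + ∫⁻ y in {y | r y x}, (ENNReal.ofReal (k y) * ‖v y‖ₑ
            + ∑ i ∈ F, ({i} : Set X).indicator (fun _ => ‖K i‖ₑ * ‖v i‖ₑ) y) ∂μ := by
          gcongr with y
          by_cases hy : y ∈ F
          · refine ((K y).le_opENorm _).trans (le_add_left ?_)
            refine le_trans (le_of_eq ?_) (Finset.single_le_sum (fun _ _ => zero_le) hy)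
            simp
          · refine ((K y).le_opENorm _).trans (le_add_right (mul_le_mul' ?_ le_rfl))
            rw [← ofReal_norm]
            exact ENNReal.ofReal_le_ofReal (hKk y hy)
      _ = ‖u₀‖ₑ + ∫⁻ y in {y | r y x}, ENNReal.ofReal (k y) * ‖v y‖ₑ ∂μ
            + ∑ i ∈ F, ‖K i‖ₑ * ‖v i‖ₑ * μ.restrict {y | r y x} {i} := by
          have hm : ∀ i ∈ F, Measurable (({i} : Set X).indicator fun _ => ‖K i‖ₑ * ‖v i‖ₑ) :=
            fun i _ => measurable_const.indicator (measurableSet_singleton i)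
          rw [lintegral_add_right _ (Finset.measurable_fun_sum _ hm), lintegral_finsetSum _ hm,
            add_assoc]
          simp_rw [lintegral_indicator_const (measurableSet_singleton _)]
      _ ≤ _ := by
          refine add_le_add le_rfl (Finset.sum_le_sum fun i hi => ?_)
          rw [Measure.restrict_apply (measurableSet_singleton i)]
          split_ifs with h
          · have h2 : μ {i} * ‖K i‖ₑ ≤ ENNReal.ofReal c := by
              rw [← ofReal_measureReal, ← ofReal_norm, ← ENNReal.ofReal_mul measureReal_nonneg]
              exact ENNReal.ofReal_le_ofReal (hKF i hi)
            calc ‖K i‖ₑ * ‖v i‖ₑ * μ ({i} ∩ {y | r y x}) ≤ ‖K i‖ₑ * ‖v i‖ₑ * μ {i} := by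
                  gcongr
                  exact inter_subset_left
              _ = μ {i} * ‖K i‖ₑ * ‖v i‖ₑ := by ring
              _ ≤ _ := by gcongr
          · have : ({i} : Set X) ∩ {y | r y x} = ∅ := by
              ext y
              simp only [mem_inter_iff, mem_singleton_iff, mem_empty_iff_false, iff_false]
              rintro ⟨rfl, h'⟩
              exact h h'
            simp [this]

end Volterra

/-- A holomorphic function on a punctured neighbourhood with polynomial growth is meromorphic. -/
theorem meromorphicAt_of_norm_mul_pow_le {E : Type*} [NormedAddCommGroup E] [NormedSpace ℂ E]
    [CompleteSpace E] {f : ℂ → E} {z₀ : ℂ} (hd : ∀ᶠ z in 𝓝[≠] z₀, DifferentiableAt ℂ f z)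
    {N : ℕ} {D : ℝ} (hg : ∀ᶠ z in 𝓝[≠] z₀, ‖f z‖ * ‖z - z₀‖ ^ N ≤ D) : MeromorphicAt f z₀ := by
  set h : ℂ → E := fun z => (z - z₀) ^ N • f z with hh
  obtain ⟨s, hs, hsub⟩ := mem_nhdsWithin_iff_exists_mem_nhds_inter.1 (hd.and hg)
  -- Riemann's removable singularity theorem for the bounded function (z - z₀)^N f.
  have hdiff := Complex.differentiableOn_update_limUnder_of_bddAbove (f := h) hs ?_ ?_
  · have h1 := (hdiff.analyticAt hs).meromorphicAt
    have h2 : MeromorphicAt h z₀ := by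
      refine h1.congr ?_
      filter_upwards [self_mem_nhdsWithin] with z hz
      exact Function.update_of_ne hz _ _
    have h3 : MeromorphicAt (fun z => ((z - z₀) ^ N)⁻¹ • h z) z₀ :=
      (((MeromorphicAt.id z₀).sub (MeromorphicAt.const z₀ z₀)).pow N).inv.smul h2
    refine h3.congr ?_
    filter_upwards [self_mem_nhdsWithin] with z hz
    have : (z - z₀) ^ N ≠ 0 := pow_ne_zero _ (sub_ne_zero.2 hz)
    simp [hh, smul_smul, this]
  · intro z hz
    have : DifferentiableAt ℂ f z := (hsub hz).1
    exact DifferentiableAt.differentiableWithinAt (by fun_prop)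
  · refine ⟨D, ?_⟩
    rintro _ ⟨z, hz, rfl⟩
    have : ‖f z‖ * ‖z - z₀‖ ^ N ≤ D := (hsub hz).2
    simpa [hh, norm_smul, mul_comm] using this

/-! ### Systems with measure coefficients and their one-sided Volterra equations -/

/-- The data of a first order system `J u' + (A - z B) u = 0` whose coefficients are densities with
respect to a finite measure. -/
structure MeasureSystem (E : Type*) [NormedAddCommGroup E] [NormedSpace ℂ E] where
  /-- The reference measure. -/
  μ : Measure ℝ
  finite : IsFiniteMeasure μ
  /-- The leading coefficient. -/
  J : (E →L[ℂ] E)ˣ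
  /-- The density of the potential. -/
  A : ℝ → E →L[ℂ] E
  /-- The density of the weight. -/
  B : ℝ → E →L[ℂ] E
  integrable_A : Integrable A μ
  integrable_B : Integrable B μ

namespace MeasureSystem

variable {E : Type*} [NormedAddCommGroup E] [NormedSpace ℂ E] (P : MeasureSystem E)

instance : IsFiniteMeasure P.μ := P.finite

/-- The density `A - z B`. -/
def G (z : ℂ) (x : ℝ) : E →L[ℂ] E := P.A x - z • P.B x

/-- The operators `B₊` (for `σ = 1`) and `B₋` (for `σ = -1`). -/
noncomputable def side (σ z : ℂ) (x : ℝ) : E →L[ℂ] E :=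
  P.J + (σ / 2 * (P.μ.real {x} : ℂ)) • P.G z x

/-- The kernel of the Volterra equation for one of the one-sided limits of a solution. -/
noncomputable def kernel (σ z : ℂ) (x : ℝ) : E →L[ℂ] E :=
  -(σ • ((P.J⁻¹ : (E →L[ℂ] E)ˣ) * P.G z x * Ring.inverse (P.side σ z x) * P.J))

/-- A common bound for the coefficients. -/
noncomputable def weight (x : ℝ) : ℝ := ‖P.A x‖ + ‖P.B x‖

theorem weight_nonneg (x : ℝ) : 0 ≤ P.weight x := by unfold weight; positivity

theorem integrable_weight : Integrable P.weight P.μ := P.integrable_A.norm.add P.integrable_B.norm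

theorem integrable_G (z : ℂ) : Integrable (P.G z) P.μ :=
  P.integrable_A.sub (P.integrable_B.smul z)

theorem norm_G_le (z : ℂ) (x : ℝ) : ‖P.G z x‖ ≤ (1 + ‖z‖) * P.weight x := by
  have h1 := norm_sub_le (P.A x) (z • P.B x)
  rw [norm_smul] at h1
  unfold G weight
  nlinarith [norm_nonneg (P.A x), norm_nonneg (P.B x), norm_nonneg z,
    mul_nonneg (norm_nonneg z) (norm_nonneg (P.A x))]

/-- A Chebyshev bound: `k` such atoms would contribute at least k ε to the finite integral of the
weight. -/
theorem finite_le_atom {ε : ℝ} (hε : 0 < ε) : {x | ε ≤ P.μ.real {x} * P.weight x}.Finite := by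
  by_contra hinf
  obtain ⟨k, hk⟩ := exists_nat_gt ((∫ x, P.weight x ∂P.μ) / ε)
  obtain ⟨F, hF, hcard⟩ := Set.Infinite.exists_subset_card_eq hinf k
  have h1 : ∫ x in (F : Set ℝ), P.weight x ∂P.μ = ∑ x ∈ F, P.μ.real {x} • P.weight x :=
    setIntegral_finset _ P.integrable_weight.integrableOn
  have h2 : ∫ x in (F : Set ℝ), P.weight x ∂P.μ ≤ ∫ x, P.weight x ∂P.μ :=
    setIntegral_le_integral P.integrable_weight (Eventually.of_forall P.weight_nonneg)
  have h3 : (k : ℝ) * ε ≤ ∑ x ∈ F, P.μ.real {x} • P.weight x := by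
    rw [← hcard, ← nsmul_eq_mul]
    exact Finset.card_nsmul_le_sum _ _ _ fun x hx => hF hx
  rw [div_lt_iff₀ hε] at hk
  linarith

/-- The operator at x differs from J by at most a multiple of the mass of the weight at x. Outside
the finitely many heavy atoms it therefore lies in a ball around J on which inverses exist and are
bounded. The exceptional set depends on R, not on z. -/
theorem exists_finset_norm_inverse_side_le [CompleteSpace E] (σ : ℂ) (R : ℝ) :
    ∃ (F : Finset ℝ) (C : ℝ), ∀ x ∉ F, ∀ z : ℂ, ‖z‖ ≤ R →
      IsUnit (P.side σ z x) ∧ ‖Ring.inverse (P.side σ z x)‖ ≤ C := by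
  rcases lt_or_ge R 0 with hR | hR
  · exact ⟨∅, 0, fun x _ z hz => absurd (hz.trans_lt hR) (norm_nonneg z).not_gt⟩
  have hnhds : ∀ᶠ y in 𝓝 (P.J : E →L[ℂ] E), IsUnit y ∧
      ‖Ring.inverse y‖ ≤ ‖Ring.inverse (P.J : E →L[ℂ] E)‖ + 1 := by
    refine Filter.Eventually.and (Units.isOpen.mem_nhds P.J.isUnit) ?_
    exact (NormedRing.inverse_continuousAt P.J).norm.eventually (Iic_mem_nhds (lt_add_one _))
  obtain ⟨δ, hδ, hball⟩ := Metric.eventually_nhds_iff.1 hnhds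
  have hε : 0 < δ / ((‖σ‖ + 1) * (1 + R)) := by positivity
  refine ⟨(P.finite_le_atom hε).toFinset, ‖Ring.inverse (P.J : E →L[ℂ] E)‖ + 1, ?_⟩
  intro x hx z hz
  apply hball
  rw [Set.Finite.mem_toFinset, mem_ofPred_eq, not_le, lt_div_iff₀ (by positivity)] at hx
  rw [side, dist_eq_norm, add_sub_cancel_left, norm_smul, norm_mul, norm_div, Complex.norm_real,
    Real.norm_of_nonneg measureReal_nonneg, Complex.norm_ofNat]
  have hw := P.weight_nonneg x
  have hm : 0 ≤ P.μ.real {x} := measureReal_nonneg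
  calc ‖σ‖ / 2 * P.μ.real {x} * ‖P.G z x‖
      ≤ (‖σ‖ + 1) * P.μ.real {x} * ((1 + R) * P.weight x) := by
        gcongr
        · linarith [norm_nonneg σ]
        · exact (P.norm_G_le z x).trans (by gcongr)
    _ = P.μ.real {x} * P.weight x * ((‖σ‖ + 1) * (1 + R)) := by ring
    _ < δ := hx

theorem differentiable_side (σ : ℂ) (x : ℝ) : Differentiable ℂ fun z => P.side σ z x := by
  unfold side G
  fun_prop

theorem differentiable_G (x : ℝ) : Differentiable ℂ fun z => P.G z x := by
  unfold G
  fun_prop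

theorem differentiableAt_inverse_side [CompleteSpace E] {σ z : ℂ} {x : ℝ}
    (h : IsUnit (P.side σ z x)) :
    DifferentiableAt ℂ (fun z => Ring.inverse (P.side σ z x)) z := by
  obtain ⟨a, ha⟩ := h
  have h1 : DifferentiableAt ℂ (Ring.inverse : (E →L[ℂ] E) → _) (P.side σ z x) := by
    rw [← ha]
    exact differentiableAt_inverse (𝕜 := ℂ) a.isUnit
  exact h1.comp z (P.differentiable_side σ x z)

theorem differentiableAt_kernel [CompleteSpace E] {σ z : ℂ} {x : ℝ}
    (h : IsUnit (P.side σ z x)) : DifferentiableAt ℂ (fun z => P.kernel σ z x) z := by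
  have h1 := P.differentiableAt_inverse_side h
  have h2 := (P.differentiable_G x) z
  unfold kernel
  fun_prop

theorem norm_kernel_le (σ z : ℂ) (x : ℝ) :
    ‖P.kernel σ z x‖ ≤ ‖σ‖ * ‖((P.J⁻¹ : (E →L[ℂ] E)ˣ) : E →L[ℂ] E)‖ * ‖(P.J : E →L[ℂ] E)‖
      * ((1 + ‖z‖) * P.weight x) * ‖Ring.inverse (P.side σ z x)‖ := by
  rw [kernel, norm_neg, norm_smul]
  calc ‖σ‖ * ‖(P.J⁻¹ : (E →L[ℂ] E)ˣ) * P.G z x * Ring.inverse (P.side σ z x) * P.J‖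
      ≤ ‖σ‖ * (‖((P.J⁻¹ : (E →L[ℂ] E)ˣ) : E →L[ℂ] E)‖ * ‖P.G z x‖
          * ‖Ring.inverse (P.side σ z x)‖ * ‖(P.J : E →L[ℂ] E)‖) := by
        gcongr
        refine (norm_mul_le _ _).trans ?_
        gcongr
        refine (norm_mul_le _ _).trans ?_
        gcongr
        exact norm_mul_le _ _
    _ ≤ ‖σ‖ * (‖((P.J⁻¹ : (E →L[ℂ] E)ˣ) : E →L[ℂ] E)‖ * ((1 + ‖z‖) * P.weight x)
          * ‖Ring.inverse (P.side σ z x)‖ * ‖(P.J : E →L[ℂ] E)‖) := by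
        gcongr
        exact P.norm_G_le z x
    _ = _ := by ring

theorem countable_atoms : {x | P.μ {x} ≠ 0}.Countable := by
  have := Measure.countable_meas_pos_of_disjoint_iUnion (μ := P.μ) (As := fun x : ℝ => {x})
    (fun x => measurableSet_singleton x) fun x y hxy => by
      simpa [Function.onFun] using hxy
  simpa [pos_iff_ne_zero] using this

/-- Away from the countably many atoms of μ the operator is the constant J. -/
theorem stronglyMeasurable_inverse_side [FiniteDimensional ℂ E] (σ z : ℂ) :
    StronglyMeasurable fun x => Ring.inverse (P.side σ z x) := by
  have : ProperSpace (E →L[ℂ] E) := FiniteDimensional.proper ℂ _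
  refine (Measurable.measurable_of_countable_ne (f := fun _ => Ring.inverse (P.J : E →L[ℂ] E))
    measurable_const (P.countable_atoms.mono fun x hx => ?_)).stronglyMeasurable
  rw [mem_ofPred_eq] at hx ⊢
  contrapose! hx
  simp [side, measureReal_def, hx]

theorem aestronglyMeasurable_kernel [FiniteDimensional ℂ E] (σ z : ℂ) :
    AEStronglyMeasurable (P.kernel σ z) P.μ :=
  ((((aestronglyMeasurable_const.mul (P.integrable_G z).aestronglyMeasurable).mul
    (P.stronglyMeasurable_inverse_side σ z).aestronglyMeasurable).mul
      aestronglyMeasurable_const).const_smul σ).neg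

/-- Near a parameter for which all `side` operators are invertible, this invertibility is uniform. -/
theorem exists_isOpen_norm_inverse_side_le [CompleteSpace E] {σ z₀ : ℂ}
    (h : ∀ x, IsUnit (P.side σ z₀ x)) :
    ∃ U : Set ℂ, IsOpen U ∧ z₀ ∈ U ∧ (∀ z ∈ U, ‖z‖ ≤ ‖z₀‖ + 1) ∧
      ∃ C : ℝ, ∀ z ∈ U, ∀ x, IsUnit (P.side σ z x) ∧ ‖Ring.inverse (P.side σ z x)‖ ≤ C := by
  obtain ⟨F, C, hFC⟩ := P.exists_finset_norm_inverse_side_le σ (‖z₀‖ + 1)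
  have h1 : ∀ᶠ z in 𝓝 z₀, ‖z‖ ≤ ‖z₀‖ + 1 :=
    continuous_norm.continuousAt.eventually (Iic_mem_nhds (lt_add_one _))
  set D : ℝ := ∑ x ∈ F, (‖Ring.inverse (P.side σ z₀ x)‖ + 1) with hD
  -- The uniform bound fails to apply only on a finite set, where continuity in z suffices.
  have h2 : ∀ᶠ z in 𝓝 z₀, ∀ x ∈ F, IsUnit (P.side σ z x) ∧
      ‖Ring.inverse (P.side σ z x)‖ ≤ D := by
    rw [Finset.eventually_all]
    intro x hx
    refine ((P.differentiable_side σ x).continuous.continuousAt.eventually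
      (Units.isOpen.mem_nhds (h x))).and ?_
    refine (P.differentiableAt_inverse_side (h x)).continuousAt.norm.eventually (Iic_mem_nhds ?_)
    refine (lt_add_one _).trans_le ?_
    exact Finset.single_le_sum (f := fun x => ‖Ring.inverse (P.side σ z₀ x)‖ + 1)
      (fun x _ => by positivity) hx
  obtain ⟨U, hU, hUo, hz₀⟩ := eventually_nhds_iff.1 (h1.and h2)
  refine ⟨U, hUo, hz₀, fun z hz => (hU z hz).1, max C D, fun z hz x => ?_⟩
  by_cases hx : x ∈ F
  · exact ⟨((hU z hz).2 x hx).1, ((hU z hz).2 x hx).2.trans (le_max_right _ _)⟩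
  · have := hFC x hx z (hU z hz).1
    exact ⟨this.1, this.2.trans (le_max_left _ _)⟩

/-- The function `z ↦ (side σ z x)⁻¹` exists near every point, except perhaps at the point itself,
and grows at most like a power. -/
def HasPolarInverse (σ : ℂ) (x : ℝ) : Prop :=
  ∀ z₀ : ℂ, (∀ᶠ z in 𝓝[≠] z₀, IsUnit (P.side σ z x)) ∧
    ∃ (N : ℕ) (D : ℝ), ∀ᶠ z in 𝓝[≠] z₀, ‖Ring.inverse (P.side σ z x)‖ * ‖z - z₀‖ ^ N ≤ D

/-- Near z₀ only finitely many x can degenerate, so the punctured neighbourhoods can be intersected.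
One exponent serves all x, namely the sum of the finitely many individual ones, because ‖z - z₀‖ ≤
1. -/
theorem eventually_norm_inverse_side_le [CompleteSpace E] {σ : ℂ}
    (h : ∀ x, P.HasPolarInverse σ x) (z₀ : ℂ) :
    (∀ᶠ z in 𝓝[≠] z₀, ∀ x, IsUnit (P.side σ z x)) ∧
    ∃ (F : Finset ℝ) (C : ℝ) (N : ℕ) (D : ℝ), 0 ≤ C ∧ ∀ᶠ z in 𝓝[≠] z₀,
      (∀ x ∉ F, ‖Ring.inverse (P.side σ z x)‖ ≤ C) ∧
      ∀ x, ‖Ring.inverse (P.side σ z x)‖ * ‖z - z₀‖ ^ N ≤ D := by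
  obtain ⟨F, C, hFC⟩ := P.exists_finset_norm_inverse_side_le σ (‖z₀‖ + 1)
  have h1 : ∀ᶠ z in 𝓝[≠] z₀, ‖z‖ ≤ ‖z₀‖ + 1 :=
    (continuous_norm.continuousAt.eventually (Iic_mem_nhds (lt_add_one _))).filter_mono
      nhdsWithin_le_nhds
  have h2 : ∀ᶠ z in 𝓝[≠] z₀, ‖z - z₀‖ ≤ 1 := by
    refine Eventually.filter_mono nhdsWithin_le_nhds ?_
    filter_upwards [Metric.closedBall_mem_nhds z₀ one_pos] with z hz
    simpa [dist_eq_norm] using hz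
  choose hunit N D hND using fun x => h x z₀
  have h3 : ∀ᶠ z in 𝓝[≠] z₀, ∀ x ∈ F, IsUnit (P.side σ z x) ∧
      ‖Ring.inverse (P.side σ z x)‖ * ‖z - z₀‖ ^ N x ≤ D x := by
    rw [Finset.eventually_all]
    exact fun x _ => (hunit x).and (hND x)
  refine ⟨?_, F, max C 0, ∑ x ∈ F, N x, max (max C 0) (∑ x ∈ F, |D x|), le_max_right _ _, ?_⟩
  · filter_upwards [h1, h3] with z hz1 hz3 x
    by_cases hx : x ∈ F
    · exact (hz3 x hx).1
    · exact (hFC x hx z hz1).1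
  · filter_upwards [h1, h2, h3] with z hz1 hz2 hz3
    have h4 : ∀ x ∉ F, ‖Ring.inverse (P.side σ z x)‖ ≤ max C 0 := fun x hx =>
      (hFC x hx z hz1).2.trans (le_max_left _ _)
    refine ⟨h4, fun x => ?_⟩
    by_cases hx : x ∈ F
    · calc ‖Ring.inverse (P.side σ z x)‖ * ‖z - z₀‖ ^ ∑ x ∈ F, N x
          ≤ ‖Ring.inverse (P.side σ z x)‖ * ‖z - z₀‖ ^ N x := by
            gcongr ‖Ring.inverse (P.side σ z x)‖ * ?_
            exact pow_le_pow_of_le_one (norm_nonneg _) hz2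
              (Finset.single_le_sum (fun _ _ => Nat.zero_le _) hx)
        _ ≤ |D x| := (hz3 x hx).2.trans (le_abs_self _)
        _ ≤ ∑ x ∈ F, |D x| := Finset.single_le_sum (f := fun x => |D x|)
            (fun _ _ => abs_nonneg _) hx
        _ ≤ _ := le_max_right _ _
    · calc ‖Ring.inverse (P.side σ z x)‖ * ‖z - z₀‖ ^ ∑ x ∈ F, N x
          ≤ max C 0 * 1 := by
            gcongr
            · exact h4 x hx
            · exact pow_le_one₀ (norm_nonneg _) hz2
        _ ≤ _ := by rw [mul_one]; exact le_max_left _ _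

variable {r : ℝ → ℝ → Prop}

/-- A bounded solution of the Volterra equation. -/
structure IsVolterraSolution (r : ℝ → ℝ → Prop) (σ z : ℂ) (u₀ : E) (v : ℝ → E) : Prop where
  stronglyMeasurable : StronglyMeasurable v
  bounded : ∃ M : ℝ, ∀ x, ‖v x‖ ≤ M
  equation : ∀ x, v x = u₀ + ∫ y in {y | r y x}, P.kernel σ z y (v y) ∂P.μ

theorem exists_kernel_bound [CompleteSpace E] {σ z₀ : ℂ} (h : ∀ x, IsUnit (P.side σ z₀ x)) :
    ∃ U : Set ℂ, IsOpen U ∧ z₀ ∈ U ∧ (∀ z ∈ U, ∀ x, IsUnit (P.side σ z x)) ∧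
      ∃ C : ℝ, ∀ z ∈ U, ∀ x, ‖P.kernel σ z x‖ ≤ C * P.weight x := by
  obtain ⟨U, hUo, hz₀, hUb, C, hC⟩ := P.exists_isOpen_norm_inverse_side_le h
  refine ⟨U, hUo, hz₀, fun z hz x => (hC z hz x).1,
    ‖σ‖ * ‖((P.J⁻¹ : (E →L[ℂ] E)ˣ) : E →L[ℂ] E)‖ * ‖(P.J : E →L[ℂ] E)‖ * (1 + (‖z₀‖ + 1)) * C, ?_⟩
  intro z hz x
  have hw := P.weight_nonneg x
  have hC0 : 0 ≤ C := (norm_nonneg _).trans (hC z hz x).2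
  calc ‖P.kernel σ z x‖ ≤ _ := P.norm_kernel_le σ z x
    _ ≤ ‖σ‖ * ‖((P.J⁻¹ : (E →L[ℂ] E)ˣ) : E →L[ℂ] E)‖ * ‖(P.J : E →L[ℂ] E)‖
          * ((1 + (‖z₀‖ + 1)) * P.weight x) * C := by
        gcongr
        · exact hUb z hz
        · exact (hC z hz x).2
    _ = _ := by ring

theorem integrable_kernel [FiniteDimensional ℂ E] {σ z : ℂ} (h : ∀ x, IsUnit (P.side σ z x)) :
    Integrable (P.kernel σ z) P.μ := by
  have : CompleteSpace E := FiniteDimensional.complete ℂ E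
  obtain ⟨U, -, hz, -, C, hC⟩ := P.exists_kernel_bound h
  exact (P.integrable_weight.const_mul C).mono' (P.aestronglyMeasurable_kernel σ z)
    (Eventually.of_forall (hC z hz))

theorem exists_isVolterraSolution [FiniteDimensional ℂ E] (hr : MeasurableStrictOrder r)
    {σ z₀ : ℂ} (h : ∀ x, IsUnit (P.side σ z₀ x)) (u₀ : E) :
    ∃ U : Set ℂ, IsOpen U ∧ z₀ ∈ U ∧ (∀ z ∈ U, ∀ x, IsUnit (P.side σ z x)) ∧
      ∃ v : ℝ → ℂ → E, (∀ z ∈ U, P.IsVolterraSolution r σ z u₀ fun x => v x z) ∧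
        ∀ x, DifferentiableOn ℂ (v x) U := by
  have : CompleteSpace E := FiniteDimensional.complete ℂ E
  obtain ⟨U, hUo, hz₀, hU, C, hC⟩ := P.exists_kernel_bound h
  obtain ⟨v, hvm, ⟨M, hvM⟩, hve, hvd⟩ := exists_volterra_solution hr P.μ hUo
    (K := P.kernel σ) (fun z _ => P.aestronglyMeasurable_kernel σ z)
    (P.integrable_weight.const_mul C) hC
    (fun y z hz => (P.differentiableAt_kernel (hU z hz y)).differentiableWithinAt) u₀
  exact ⟨U, hUo, hz₀, hU, v, fun z hz => ⟨hvm z hz, ⟨M, hvM z hz⟩, hve z hz⟩, hvd⟩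

theorem IsVolterraSolution.integrable [FiniteDimensional ℂ E] {P : MeasureSystem E} {σ z : ℂ}
    {u₀ : E} {v : ℝ → E} (hv : P.IsVolterraSolution r σ z u₀ v)
    (h : ∀ x, IsUnit (P.side σ z x)) : Integrable (fun y => P.kernel σ z y (v y)) P.μ := by
  obtain ⟨M, hM⟩ := hv.bounded
  refine ((P.integrable_kernel h).norm.mul_const M).mono'
    ((P.aestronglyMeasurable_kernel σ z).clm_apply' hv.stronglyMeasurable.aestronglyMeasurable)
    (Eventually.of_forall fun y => ?_)
  refine ((P.kernel σ z y).le_opNorm _).trans ?_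
  gcongr
  exact hM y

theorem IsVolterraSolution.unique [FiniteDimensional ℂ E] {P : MeasureSystem E}
    (hr : MeasurableStrictOrder r) {σ z : ℂ} {u₀ : E} {v w : ℝ → E}
    (hv : P.IsVolterraSolution r σ z u₀ v) (hw : P.IsVolterraSolution r σ z u₀ w)
    (h : ∀ x, IsUnit (P.side σ z x)) : v = w := by
  obtain ⟨M, hM⟩ := hv.bounded
  obtain ⟨M', hM'⟩ := hw.bounded
  refine eqOn_univ _ _ |>.1 (eqOn_of_volterra hr P.μ (P.integrable_kernel h)
    (fun _ _ => Eventually.of_forall fun _ _ => mem_univ _) (M := max M M') (fun x _ => (hM x).trans (le_max_left _ _))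
    (fun x _ => (hM' x).trans (le_max_right _ _)) (fun _ _ => (hv.integrable h).integrableOn)
    (fun _ _ => (hw.integrable h).integrableOn) (fun x _ => hv.equation x)
    (fun x _ => hw.equation x))

/-- Solutions of the Volterra equation are holomorphic in the spectral parameter. -/
theorem differentiableAt_volterraSolution [FiniteDimensional ℂ E] (hr : MeasurableStrictOrder r)
    {σ : ℂ} {T : Set ℂ} (hTo : IsOpen T) (hT : ∀ z ∈ T, ∀ x, IsUnit (P.side σ z x)) {u₀ : E}
    {v : ℝ → ℂ → E} (hv : ∀ z ∈ T, P.IsVolterraSolution r σ z u₀ fun x => v x z) (x : ℝ)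
    {z : ℂ} (hz : z ∈ T) : DifferentiableAt ℂ (v x) z := by
  -- Holomorphy is known for the family built near z; by uniqueness the given family agrees with it
  -- there.
  obtain ⟨U, hUo, hzU, hU, w, hw, hwd⟩ := P.exists_isVolterraSolution hr (hT z hz) u₀
  refine ((hwd x).differentiableAt (hUo.mem_nhds hzU)).congr_of_eventuallyEq ?_
  filter_upwards [hUo.mem_nhds hzU, hTo.mem_nhds hz] with z' hz' hz''
  exact congrFun ((hv z' hz'').unique hr (hw z' hz') (hU z' hz')) x

/-- Solutions of the Volterra equation grow at most like a power near every point. -/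
theorem exists_norm_volterraSolution_le [FiniteDimensional ℂ E] (hr : MeasurableStrictOrder r)
    {σ : ℂ} (hpol : ∀ x, P.HasPolarInverse σ x) {T : Set ℂ} {u₀ : E} {v : ℝ → ℂ → E}
    (hv : ∀ z ∈ T, P.IsVolterraSolution r σ z u₀ fun x => v x z) {z₀ : ℂ}
    (hT : ∀ᶠ z in 𝓝[≠] z₀, z ∈ T) :
    ∃ (N : ℕ) (D : ℝ), ∀ᶠ z in 𝓝[≠] z₀, ∀ x, ‖v x z‖ * ‖z - z₀‖ ^ N ≤ D := by
  have : CompleteSpace E := FiniteDimensional.complete ℂ E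
  obtain ⟨-, F, C, N, D, hC, hev⟩ := P.eventually_norm_inverse_side_le hpol z₀
  set κ : ℝ := ‖σ‖ * ‖((P.J⁻¹ : (E →L[ℂ] E)ˣ) : E →L[ℂ] E)‖ * ‖(P.J : E →L[ℂ] E)‖
    * (1 + (‖z₀‖ + 1)) with hκ
  have hκ0 : 0 ≤ κ := by positivity
  obtain ⟨a, e, hae⟩ := norm_le_of_volterra (E := E) hr P.μ
    (k := fun x => κ * C * P.weight x) (P.integrable_weight.const_mul _) F
  set W : ℝ := ∑ x ∈ F, P.μ.real {x} * P.weight x with hW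
  have hW1 : ∀ x ∈ F, P.μ.real {x} * P.weight x ≤ W := fun x hx =>
    Finset.single_le_sum (f := fun x => P.μ.real {x} * P.weight x)
      (fun x _ => mul_nonneg measureReal_nonneg (P.weight_nonneg x)) hx
  have hW0 : 0 ≤ W := Finset.sum_nonneg fun x _ =>
    mul_nonneg measureReal_nonneg (P.weight_nonneg x)
  refine ⟨N * a, ‖u₀‖ * ((W * κ * |D| + 1) * e) ^ a, ?_⟩
  have h1 : ∀ᶠ z in 𝓝[≠] z₀, ‖z‖ ≤ ‖z₀‖ + 1 :=
    (continuous_norm.continuousAt.eventually (Iic_mem_nhds (lt_add_one _))).filter_mono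
      nhdsWithin_le_nhds
  have h2 : ∀ᶠ z in 𝓝[≠] z₀, ‖z - z₀‖ ≤ 1 := by
    refine Eventually.filter_mono nhdsWithin_le_nhds ?_
    filter_upwards [Metric.closedBall_mem_nhds z₀ one_pos] with z hz
    simpa [dist_eq_norm] using hz
  filter_upwards [h1, h2, hT, hev, self_mem_nhdsWithin] with z hz1 hz2 hzT hzev hzne x
  have hd : 0 < ‖z - z₀‖ ^ N := pow_pos (norm_pos_iff.2 (sub_ne_zero.2 hzne)) _
  have hd1 : ‖z - z₀‖ ^ N ≤ 1 := pow_le_one₀ (norm_nonneg _) hz2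
  have hker : ∀ y, ‖P.kernel σ z y‖
      ≤ κ * P.weight y * ‖Ring.inverse (P.side σ z y)‖ := by
    intro y
    have hw := P.weight_nonneg y
    refine (P.norm_kernel_le σ z y).trans ?_
    calc _ ≤ ‖σ‖ * ‖((P.J⁻¹ : (E →L[ℂ] E)ˣ) : E →L[ℂ] E)‖ * ‖(P.J : E →L[ℂ] E)‖
          * ((1 + (‖z₀‖ + 1)) * P.weight y) * ‖Ring.inverse (P.side σ z y)‖ := by gcongr
      _ = _ := by rw [hκ]; ring
  -- Bounds mass times kernel at the exceptional atoms. The summand 1, together with ‖z - z₀‖ ≤ 1,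
  -- gives c ≥ 1. Growth of order c^a becomes a singularity of order at most N a.
  set c : ℝ := (W * κ * |D| + 1) / ‖z - z₀‖ ^ N with hc
  have hnum : 1 ≤ W * κ * |D| + 1 := by
    have : 0 ≤ W * κ * |D| := by positivity
    linarith
  have hle := hae (P.kernel σ z) c ?_ ?_ ?_ u₀ (fun x => v x z) (hv z hzT).bounded
    (hv z hzT).equation x
  · calc ‖v x z‖ * ‖z - z₀‖ ^ (N * a) ≤ ‖u₀‖ * (c * e) ^ a * ‖z - z₀‖ ^ (N * a) := by gcongr
      _ = ‖u₀‖ * ((c * ‖z - z₀‖ ^ N) * e) ^ a := by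
          rw [pow_mul, mul_assoc, ← mul_pow]; congr 2; ring
      _ = _ := by rw [hc, div_mul_cancel₀ _ hd.ne']
  · rw [hc, le_div_iff₀ hd]
    linarith
  · intro y hy
    refine (hker y).trans ?_
    have hw := P.weight_nonneg y
    calc κ * P.weight y * ‖Ring.inverse (P.side σ z y)‖ ≤ κ * P.weight y * C := by
          gcongr
          exact hzev.1 y hy
      _ = _ := by ring
  · intro y hy
    have hw := P.weight_nonneg y
    have hm : 0 ≤ P.μ.real {y} := measureReal_nonneg
    have hD : ‖Ring.inverse (P.side σ z y)‖ ≤ |D| / ‖z - z₀‖ ^ N := by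
      rw [le_div_iff₀ hd]
      exact (hzev.2 y).trans (le_abs_self D)
    calc P.μ.real {y} * ‖P.kernel σ z y‖
        ≤ P.μ.real {y} * (κ * P.weight y * (|D| / ‖z - z₀‖ ^ N)) := by
          gcongr
          exact (hker y).trans (by gcongr)
      _ = (P.μ.real {y} * P.weight y) * (κ * |D|) / ‖z - z₀‖ ^ N := by ring
      _ ≤ W * (κ * |D|) / ‖z - z₀‖ ^ N := by gcongr; exact hW1 y hy
      _ ≤ c := by rw [hc]; gcongr; linarith

end MeasureSystem

/-! ### Complex measures with densities -/

section Density

variable {X : Type*} [MeasurableSpace X]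

/-- The density of a complex measure with respect to a dominating measure. -/
theorem withDensityᵥ_complex_rnDeriv_eq (c : ComplexMeasure X) (μ : Measure X) [SigmaFinite μ]
    (hre : (ComplexMeasure.re c).totalVariation ≪ μ)
    (him : (ComplexMeasure.im c).totalVariation ≪ μ) :
    μ.withDensityᵥ (c.rnDeriv μ) = c := by
  have hac : ∀ s : SignedMeasure X, s.totalVariation ≪ μ →
      μ.withDensityᵥ (s.rnDeriv μ) = s := by
    intro s hs
    refine SignedMeasure.withDensityᵥ_rnDeriv_eq s μ ?_
    rw [SignedMeasure.absolutelyContinuous_ennreal_iff]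
    -- Turning μ into an `ℝ≥0∞`-valued vector measure and back returns μ.
    convert hs
    exact VectorMeasure.equivMeasure.right_inv μ
  ext i hi
  rw [withDensityᵥ_apply (c.integrable_rnDeriv μ) hi]
  apply Complex.ext
  · rw [← RCLike.re_eq_complex_re, ← integral_re (c.integrable_rnDeriv μ).integrableOn]
    have h := congrArg (fun m => m i) (hac _ hre)
    simp only [withDensityᵥ_apply (SignedMeasure.integrable_rnDeriv _ _) hi] at h
    exact h
  · rw [← RCLike.im_eq_complex_im, ← integral_im (c.integrable_rnDeriv μ).integrableOn]
    have h := congrArg (fun m => m i) (hac _ him)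
    simp only [withDensityᵥ_apply (SignedMeasure.integrable_rnDeriv _ _) hi] at h
    exact h

/-- The sum of the total variations of all real and imaginary parts dominates every measure of the
family. -/
theorem exists_common_density {ι : Type*} [Fintype ι] (c : ι → ComplexMeasure X) :
    ∃ (μ : Measure X) (f : ι → X → ℂ), IsFiniteMeasure μ ∧
      ∀ i, Integrable (f i) μ ∧ μ.withDensityᵥ (f i) = c i := by
  let ν : ι → Measure X := fun i => (ComplexMeasure.re (c i)).totalVariation
    + (ComplexMeasure.im (c i)).totalVariation
  have hν : ∀ i, IsFiniteMeasure (ν i) := fun i => by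
    unfold ν SignedMeasure.totalVariation
    infer_instance
  have hle : ∀ i, ν i ≤ ∑ i, ν i := fun i =>
    Finset.single_le_sum (f := ν) (fun _ _ => Measure.zero_le _) (Finset.mem_univ i)
  refine ⟨∑ i, ν i, fun i => (c i).rnDeriv (∑ i, ν i), inferInstance, fun i =>
    ⟨(c i).integrable_rnDeriv _, withDensityᵥ_complex_rnDeriv_eq _ _ ?_ ?_⟩⟩
  · exact Measure.absolutelyContinuous_of_le ((Measure.le_add_right le_rfl).trans (hle i))
  · exact Measure.absolutelyContinuous_of_le ((Measure.le_add_left le_rfl).trans (hle i))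

variable {μ : Measure X} {f : X → ℂ}

/-- Polar decomposition f = |f| (f/|f|); where f vanishes both integrands vanish. In the form on the
right the factor of g is bounded, so that the integral is continuous in g in the L¹ norm of |f| μ.
-/
theorem integral_mul_eq_integral_withDensity (hf : Integrable f μ) (g : X → ℂ) :
    ∫ x, g x * f x ∂μ = ∫ x, g x * ((‖f x‖ : ℂ)⁻¹ * f x) ∂μ.withDensity fun x => ‖f x‖ₑ := by
  rw [integral_withDensity_eq_integral_toReal_smul₀ hf.aestronglyMeasurable.enorm
    (Eventually.of_forall fun x => enorm_lt_top)]
  refine integral_congr_ae (Eventually.of_forall fun x => ?_)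
  by_cases hx : f x = 0
  · simp [hx]
  · have : (‖f x‖ : ℂ) ≠ 0 := by simpa using hx
    simp only [toReal_enorm, Complex.real_smul]
    rw [mul_left_comm, mul_inv_cancel_left₀ this]

/-- Integration against a complex measure with a density. -/
theorem integral_withDensityᵥ_mul (hf : Integrable f μ) {g : X → ℂ}
    (hg : Integrable g (μ.withDensity fun x => ‖f x‖ₑ)) :
    (μ.withDensityᵥ f).integral g (ContinuousLinearMap.mul ℝ ℂ) = ∫ x, g x * f x ∂μ := by
  have hV := Measure.variation_withDensityᵥ hf
  set V := μ.withDensity fun x => ‖f x‖ₑ with hVdef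
  have : IsFiniteMeasure V := ⟨by
    rw [withDensity_apply _ MeasurableSet.univ, setLIntegral_univ]; exact hf.2⟩
  have : IsFiniteMeasure (μ.withDensityᵥ f).variation := by rw [hV]; infer_instance
  have hφm : AEStronglyMeasurable (fun x => ((‖f x‖ : ℂ)⁻¹ * f x)) V := by
    refine AEStronglyMeasurable.mono_ac (withDensity_absolutelyContinuous _ _) ?_
    exact (Complex.continuous_ofReal.comp_aestronglyMeasurable
      hf.aestronglyMeasurable.norm).inv₀.mul hf.aestronglyMeasurable
  have hφ : ∀ x, ‖((‖f x‖ : ℂ)⁻¹ * f x)‖ ≤ 1 := fun x => by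
    simpa using inv_mul_le_one
  have hint : ∀ h : X → ℂ, Integrable h V → Integrable (fun x => h x * ((‖f x‖ : ℂ)⁻¹ * f x)) V :=
    fun h hh => hh.mul_bdd (c := 1) hφm (Eventually.of_forall hφ)
  rw [integral_mul_eq_integral_withDensity hf, ← hVdef]
  -- Both sides are additive and continuous on L¹(V), where V is the variation of the vector
  -- measure, so indicators suffice.
  refine Integrable.induction (fun g => (μ.withDensityᵥ f).integral g
    (ContinuousLinearMap.mul ℝ ℂ) = ∫ x, g x * ((‖f x‖ : ℂ)⁻¹ * f x) ∂V) ?_ ?_ ?_ ?_ hg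
  · intro c s hs _
    rw [VectorMeasure.integral_indicator hs]
    rw [VectorMeasure.setIntegral_const, ← integral_mul_eq_integral_withDensity hf,
      withDensityᵥ_apply hf hs]
    simp only [ContinuousLinearMap.mul_apply']
    rw [← integral_const_mul, ← integral_indicator hs]
    congr with x
    by_cases hx : x ∈ s <;> simp [hx]
  · intro g h _ hg hh hge hhe
    rw [VectorMeasure.integral_add (by rwa [VectorMeasure.Integrable, hV])
      (by rwa [VectorMeasure.Integrable, hV]), hge, hhe, ← integral_add (hint g hg) (hint h hh)]
    simp [add_mul]
  · have h1 : Continuous fun h : X →₁[V] ℂ =>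
        (μ.withDensityᵥ f).integral h (ContinuousLinearMap.mul ℝ ℂ) := by
      rw [← hV]
      exact VectorMeasure.continuous_integral
    have h2 : LipschitzWith 1 fun h : X →₁[V] ℂ => ∫ x, h x * ((‖f x‖ : ℂ)⁻¹ * f x) ∂V := by
      refine LipschitzWith.of_dist_le_mul fun g h => ?_
      have hgi := L1.integrable_coeFn g
      have hhi := L1.integrable_coeFn h
      rw [NNReal.coe_one, one_mul, dist_eq_norm, dist_eq_norm, L1.norm_eq_integral_norm,
        ← integral_sub (hint _ hgi) (hint _ hhi)]
      refine norm_integral_le_of_norm_le (L1.integrable_coeFn (g - h)).norm ?_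
      filter_upwards [Lp.coeFn_sub g h] with x hx
      rw [hx, ← sub_mul, norm_mul]
      exact mul_le_of_le_one_right (norm_nonneg _) (hφ x)
    exact isClosed_eq h1 h2.continuous
  · intro g h hgh _ hg
    rw [← VectorMeasure.integral_congr_ae (f := g) (by rwa [hV]), hg]
    refine integral_congr_ae ?_
    filter_upwards [hgh] with x hx
    rw [hx]

end Density

/-- Clamping changes nothing near an interior point, so the atom is the jump of f itself. -/
theorem stieltjes_singleton {f : ℝ → ℂ} {s t x : ℝ} (hst : s ≤ t)
    (hf : LocallyBoundedVariationOn f (Icc s t)) (hx : x ∈ Ioo s t) :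
    stieltjes f s t {x} = Function.rightLim f x - Function.leftLim f x := by
  have hbv := boundedVariationOn_clampFun hst hf subset_rfl
  rw [stieltjes, dif_pos hbv, hbv.vectorMeasure_singleton]
  have heq : clampFun f s t =ᶠ[𝓝 x] f := by
    filter_upwards [Ioo_mem_nhds hx.1 hx.2] with y hy
    simp [clampFun, min_eq_right hy.2.le, max_eq_right hy.1.le]
  have h1 : Tendsto f (𝓝[>] x) (𝓝 (Function.rightLim (clampFun f s t) x)) :=
    (hbv.tendsto_rightLim x).congr' (heq.filter_mono nhdsWithin_le_nhds)
  have h2 : Tendsto f (𝓝[<] x) (𝓝 (Function.leftLim (clampFun f s t) x)) :=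
    (hbv.tendsto_leftLim x).congr' (heq.filter_mono nhdsWithin_le_nhds)
  rw [rightLim_eq_of_tendsto h1,
    leftLim_eq_of_tendsto h2]

open scoped ContDiff

/-! ### From test functions to increments -/

section Test

variable {E : Type*} [NormedAddCommGroup E] [NormedSpace ℝ E]

theorem deriv_smoothTransition_of_neg {x : ℝ} (hx : x < 0) : deriv Real.smoothTransition x = 0 := by
  have : Real.smoothTransition =ᶠ[𝓝 x] fun _ => 0 := by
    filter_upwards [Iio_mem_nhds hx] with y hy
    exact Real.smoothTransition.zero_of_nonpos (le_of_lt hy)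
  rw [this.deriv_eq, deriv_const]

theorem deriv_smoothTransition_of_one_lt {x : ℝ} (hx : 1 < x) :
    deriv Real.smoothTransition x = 0 := by
  have : Real.smoothTransition =ᶠ[𝓝 x] fun _ => 1 := by
    filter_upwards [Ioi_mem_nhds hx] with y hy
    exact Real.smoothTransition.one_of_one_le (le_of_lt hy)
  rw [this.deriv_eq, deriv_const]

theorem continuous_deriv_smoothTransition : Continuous (deriv Real.smoothTransition) :=
  (Real.smoothTransition.contDiff (n := 1)).continuous_deriv le_rfl

theorem differentiable_smoothTransition : Differentiable ℝ Real.smoothTransition :=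
  (Real.smoothTransition.contDiff (n := 1)).differentiable one_ne_zero

theorem integrable_deriv_smoothTransition : Integrable (deriv Real.smoothTransition) := by
  refine continuous_deriv_smoothTransition.integrable_of_hasCompactSupport ?_
  refine HasCompactSupport.intro (isCompact_Icc (a := (0 : ℝ)) (b := 1)) fun x hx => ?_
  rcases lt_or_ge x 0 with h | h
  · exact deriv_smoothTransition_of_neg h
  · exact deriv_smoothTransition_of_one_lt (not_le.1 fun h' => hx ⟨h, h'⟩)

theorem integral_deriv_smoothTransition : ∫ x, deriv Real.smoothTransition x = 1 := by
  rw [integral_of_hasDerivAt_of_tendsto (f := Real.smoothTransition) (m := 0) (n := 1)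
    (fun x => (differentiable_smoothTransition x).hasDerivAt) integrable_deriv_smoothTransition]
  · simp
  · refine tendsto_const_nhds.congr' ?_
    filter_upwards [eventually_le_atBot 0] with x hx
    exact (Real.smoothTransition.zero_of_nonpos hx).symm
  · refine tendsto_const_nhds.congr' ?_
    filter_upwards [eventually_ge_atTop 1] with x hx
    exact (Real.smoothTransition.one_of_one_le hx).symm

/-- The rescaled derivatives of the smooth transition function form a one-sided approximate
identity. -/
theorem tendsto_integral_deriv_smoothTransition [CompleteSpace E] {F : ℝ → E} {l : E} {M δ : ℝ}
    (hδ : 0 < δ) (hFm : AEStronglyMeasurable F) (hFM : ∀ x, ‖F x‖ ≤ M)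
    (hF : Tendsto F (𝓝[>] 0) (𝓝 l)) :
    Tendsto (fun k : ℕ => ∫ x, ((k + 1 : ℝ) * deriv Real.smoothTransition ((k + 1 : ℝ) * x)
      * Real.smoothTransition ((k + 1 : ℝ) * (δ - x))) • F x) atTop (𝓝 l) := by
  -- Substitute y = (k + 1) x. The cutoff factor then equals 1 for large k at each fixed y, and F is
  -- evaluated at points tending to 0.
  have h1 : ∀ k : ℕ, ∫ x, ((k + 1 : ℝ) * deriv Real.smoothTransition ((k + 1 : ℝ) * x)
      * Real.smoothTransition ((k + 1 : ℝ) * (δ - x))) • F x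
      = ∫ y, (deriv Real.smoothTransition y
        * Real.smoothTransition ((k + 1 : ℝ) * δ - y)) • F ((k + 1 : ℝ)⁻¹ * y) := by
    intro k
    have hk : (0 : ℝ) < k + 1 := by positivity
    have h := Measure.integral_comp_mul_left (fun y => (deriv Real.smoothTransition y
        * Real.smoothTransition ((k + 1 : ℝ) * δ - y)) • F ((k + 1 : ℝ)⁻¹ * y)) (k + 1 : ℝ)
    rw [abs_of_pos (inv_pos.2 hk), eq_inv_smul_iff₀ hk.ne', ← integral_smul] at h
    rw [← h]
    refine integral_congr_ae (Eventually.of_forall fun x => ?_)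
    simp only [smul_smul, inv_mul_cancel_left₀ hk.ne']
    congr 1
    ring_nf
  simp_rw [h1]
  have h2 : ∫ y, deriv Real.smoothTransition y • l = l := by
    rw [integral_smul_const, integral_deriv_smoothTransition, one_smul]
  conv => rw [← h2]
  refine tendsto_integral_of_dominated_convergence
    (fun y => ‖deriv Real.smoothTransition y‖ * M) ?_ ?_ ?_ ?_
  · intro k
    have hk : (0 : ℝ) < (k + 1 : ℝ)⁻¹ := by positivity
    refine AEStronglyMeasurable.smul ?_ ?_
    · exact (continuous_deriv_smoothTransition.mul (Real.smoothTransition.continuous.comp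
        (by fun_prop))).aestronglyMeasurable
    · exact hFm.comp_quasiMeasurePreserving
        (Measure.quasiMeasurePreserving_smul volume hk.ne')
  · exact integrable_deriv_smoothTransition.norm.mul_const M
  · intro k
    refine Eventually.of_forall fun y => ?_
    rw [norm_smul, norm_mul]
    have hs : ‖Real.smoothTransition ((k + 1 : ℝ) * δ - y)‖ ≤ 1 := by
      rw [Real.norm_of_nonneg (Real.smoothTransition.nonneg _)]
      exact Real.smoothTransition.le_one _
    exact mul_le_mul (mul_le_of_le_one_right (norm_nonneg _) hs) (hFM _) (norm_nonneg _)
      (norm_nonneg _)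
  -- For y < 0 the derivative vanishes, so only the limit of F from the right enters; y = 0 is a
  -- null set.
  · have hne : ∀ᵐ y : ℝ, y ≠ 0 := Measure.ae_ne volume 0
    filter_upwards [hne] with y hy
    rcases lt_or_gt_of_ne hy with hy | hy
    · simp [deriv_smoothTransition_of_neg hy]
    · have hK : Tendsto (fun k : ℕ => (k + 1 : ℝ)) atTop atTop :=
        tendsto_atTop_add_const_right _ _ tendsto_natCast_atTop_atTop
      refine Tendsto.smul ?_ (hF.comp ?_)
      · refine tendsto_const_nhds.congr' ?_
        filter_upwards [hK.eventually_ge_atTop ((1 + y) / δ)] with k hk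
        rw [Real.smoothTransition.one_of_one_le, mul_one]
        rw [div_le_iff₀ hδ] at hk
        linarith
      · refine tendsto_nhdsWithin_iff.2 ⟨?_, Eventually.of_forall fun k => ?_⟩
        · simpa using (tendsto_inv_atTop_zero.comp hK).mul_const y
        · exact mul_pos (by positivity) hy

/-- If the derivative of `h` is `-g dμ` in the sense of distributions, then the increment of `h`
over an interval is the integral of `-g`. -/
theorem sub_eq_setIntegral_of_test [CompleteSpace E] {μ : Measure ℝ} {h g : ℝ → E} {c d M : ℝ}
    (hcd : c < d) (hM : ∀ x ∈ Icc c d, ‖h x‖ ≤ M)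
    (hm : AEStronglyMeasurable h (volume.restrict (Icc c d))) {hR hL : E}
    (hhR : Tendsto h (𝓝[>] c) (𝓝 hR)) (hhL : Tendsto h (𝓝[<] d) (𝓝 hL))
    (hg : IntegrableOn g (Icc c d) μ)
    (htest : ∀ φ : ℝ → ℝ, ContDiff ℝ ∞ φ → tsupport φ ⊆ Icc c d →
      ∫ x, deriv φ x • h x = ∫ x, φ x • g x ∂μ) :
    hR - hL = ∫ x in Ioo c d, g x ∂μ := by
  set σ := Real.smoothTransition with hσ
  -- Truncation makes the bound and the measurability global, without changing the limits from
  -- inside at c and d.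
  set h' : ℝ → E := (Icc c d).indicator h with hh'
  have hM0 : 0 ≤ M := (norm_nonneg _).trans (hM c ⟨le_rfl, hcd.le⟩)
  have h'm : AEStronglyMeasurable h' := (aestronglyMeasurable_indicator_iff measurableSet_Icc).2 hm
  have h'M : ∀ x, ‖h' x‖ ≤ M := fun x => by
    by_cases hx : x ∈ Icc c d
    · simpa [hh', hx] using hM x hx
    · simpa [hh', hx] using hM0
  have h'R : Tendsto (fun x => h' (c + x)) (𝓝[>] 0) (𝓝 hR) := by
    have h1 : Tendsto (fun x => c + x) (𝓝[>] 0) (𝓝[>] c) := by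
      refine tendsto_nhdsWithin_iff.2 ⟨?_, ?_⟩
      · exact ((continuous_const.add continuous_id).tendsto' 0 c (by simp)).mono_left
          nhdsWithin_le_nhds
      · filter_upwards [self_mem_nhdsWithin] with x hx
        simpa using hx
    refine Tendsto.comp (g := h') (hhR.congr' ?_) h1
    filter_upwards [Ioo_mem_nhdsGT hcd] with x hx
    simp [hh', hx.1.le, hx.2.le]
  have h'L : Tendsto (fun x => h' (d - x)) (𝓝[>] 0) (𝓝 hL) := by
    have h1 : Tendsto (fun x => d - x) (𝓝[>] 0) (𝓝[<] d) := by
      refine tendsto_nhdsWithin_iff.2 ⟨?_, ?_⟩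
      · exact ((continuous_const.sub continuous_id).tendsto' 0 d (by simp)).mono_left
          nhdsWithin_le_nhds
      · filter_upwards [self_mem_nhdsWithin] with x hx
        simpa using hx
    refine Tendsto.comp (g := h') (hhL.congr' ?_) h1
    filter_upwards [Ioo_mem_nhdsLT hcd] with x hx
    simp [hh', hx.1.le, hx.2.le]
  -- Smooth approximations of the indicator of the open interval (c,d). The derivative is a unit
  -- bump to the right of c minus one to the left of d, each cut off at the opposite end, so the
  -- left side tends to hR - hL. Vanishing at c and d excludes the endpoint atoms on the right side.
  let φ : ℕ → ℝ → ℝ := fun k x => σ ((k + 1 : ℝ) * (x - c)) * σ ((k + 1 : ℝ) * (d - x))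
  have hφsupp : ∀ k, tsupport (φ k) ⊆ Icc c d := by
    intro k
    refine closure_minimal (fun x hx => ?_) isClosed_Icc
    by_contra hx'
    refine hx ?_
    have hk : (0 : ℝ) < k + 1 := by positivity
    rcases lt_or_ge x c with h | h
    · change σ _ * σ _ = 0
      rw [hσ, Real.smoothTransition.zero_of_nonpos (mul_nonpos_of_nonneg_of_nonpos hk.le
        (by linarith)), zero_mul]
    · have h2 : d < x := not_le.1 fun h' => hx' ⟨h, h'⟩
      change σ _ * σ _ = 0
      rw [hσ, Real.smoothTransition.zero_of_nonpos (x := (k + 1 : ℝ) * (d - x))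
        (mul_nonpos_of_nonneg_of_nonpos hk.le (by linarith)), mul_zero]
  have hφdiff : ∀ k, ContDiff ℝ ∞ (φ k) := by
    intro k
    have h1 : ContDiff ℝ ∞ σ := Real.smoothTransition.contDiff
    exact (h1.comp (by fun_prop)).mul (h1.comp (by fun_prop))
  have hφderiv : ∀ k x, deriv (φ k) x
      = (k + 1 : ℝ) * deriv σ ((k + 1 : ℝ) * (x - c)) * σ ((k + 1 : ℝ) * (d - x))
        - (k + 1 : ℝ) * deriv σ ((k + 1 : ℝ) * (d - x)) * σ ((k + 1 : ℝ) * (x - c)) := by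
    intro k x
    have hd := fun y => (differentiable_smoothTransition y).hasDerivAt
    have h1 : HasDerivAt (fun x => (k + 1 : ℝ) * (x - c)) (k + 1 : ℝ) x := by
      simpa using ((hasDerivAt_id x).sub_const c).const_mul (k + 1 : ℝ)
    have h2 : HasDerivAt (fun x => (k + 1 : ℝ) * (d - x)) (-(k + 1 : ℝ)) x := by
      simpa using ((hasDerivAt_id x).const_sub d).const_mul (k + 1 : ℝ)
    have h3 := ((hd _).comp x h1).mul ((hd _).comp x h2)
    refine h3.deriv.trans ?_
    simp only [Function.comp_apply, hσ]
    ring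
  -- the left-hand side
  have hlhs : Tendsto (fun k => ∫ x, deriv (φ k) x • h x) atTop (𝓝 (hR - hL)) := by
    have e1 := tendsto_integral_deriv_smoothTransition (sub_pos.2 hcd)
      (h'm.comp_quasiMeasurePreserving (measurePreserving_add_left volume c).quasiMeasurePreserving)
      (fun x => h'M (c + x)) h'R
    have e2 := tendsto_integral_deriv_smoothTransition (sub_pos.2 hcd)
      (h'm.comp_quasiMeasurePreserving (Measure.measurePreserving_sub_left volume d).quasiMeasurePreserving)
      (fun x => h'M (d - x)) h'L
    refine (e1.sub e2).congr fun k => ?_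
    have hk : (0 : ℝ) < k + 1 := by positivity
    have i1 := integral_add_left_eq_self (μ := volume) (fun x => ((k + 1 : ℝ)
      * deriv σ ((k + 1 : ℝ) * (x - c)) * σ ((k + 1 : ℝ) * (d - x))) • h' x) c
    have i2 := integral_sub_left_eq_self (fun x => ((k + 1 : ℝ)
      * deriv σ ((k + 1 : ℝ) * (d - x)) * σ ((k + 1 : ℝ) * (x - c))) • h' x) volume d
    have hdσ := continuous_deriv_smoothTransition
    have hcσ : Continuous σ := Real.smoothTransition.continuous
    have hint : ∀ p : ℝ → ℝ, Continuous p → Integrable fun x => p x • h' x := by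
      intro p hp
      have hpi : IntegrableOn (fun x => ‖p x‖ * M) (Icc c d) :=
        (Continuous.continuousOn (by fun_prop)).integrableOn_compact isCompact_Icc
      refine (hpi.integrable_indicator measurableSet_Icc).mono'
        (hp.aestronglyMeasurable.smul h'm) (Eventually.of_forall fun x => ?_)
      by_cases hx : x ∈ Icc c d
      · rw [indicator_of_mem hx, norm_smul]
        exact mul_le_mul_of_nonneg_left (h'M x) (norm_nonneg _)
      · simp [hh', hx]
    have hsplit : ∫ x, deriv (φ k) x • h x = (∫ x, ((k + 1 : ℝ)
        * deriv σ ((k + 1 : ℝ) * (x - c)) * σ ((k + 1 : ℝ) * (d - x))) • h' x)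
        - ∫ x, ((k + 1 : ℝ)
        * deriv σ ((k + 1 : ℝ) * (d - x)) * σ ((k + 1 : ℝ) * (x - c))) • h' x := by
      rw [← integral_sub (hint _ (by fun_prop)) (hint _ (by fun_prop))]
      refine integral_congr_ae (Eventually.of_forall fun x => ?_)
      simp only
      rw [← sub_smul, ← hφderiv]
      by_cases hx : x ∈ Icc c d
      · simp [hh', hx]
      · have hx' : x ∉ tsupport (deriv (φ k)) := fun hx' =>
          hx (hφsupp k (tsupport_deriv_subset hx'))
        rw [image_eq_zero_of_notMem_tsupport hx', zero_smul, zero_smul]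
    rw [hsplit, ← i1, ← i2]
    congr 1
    · refine integral_congr_ae (Eventually.of_forall fun x => ?_)
      simp only [add_sub_cancel_left, hσ, sub_sub, Function.comp_apply]
    · refine integral_congr_ae (Eventually.of_forall fun x => ?_)
      simp only [sub_sub_cancel, hσ, Function.comp_apply]
      rw [sub_right_comm]
  have hrhs : Tendsto (fun k => ∫ x, φ k x • g x ∂μ) atTop (𝓝 (∫ x in Ioo c d, g x ∂μ)) := by
    have hgi : Integrable ((Icc c d).indicator g) μ := hg.integrable_indicator measurableSet_Icc
    have hφ0 : ∀ k x, x ∉ Ioo c d → φ k x = 0 := by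
      intro k x hx
      have hk : (0 : ℝ) < k + 1 := by positivity
      rcases le_or_gt x c with h | h
      · change σ _ * σ _ = 0
        rw [hσ, Real.smoothTransition.zero_of_nonpos (mul_nonpos_of_nonneg_of_nonpos hk.le
          (by linarith)), zero_mul]
      · have h2 : d ≤ x := not_lt.1 fun h' => hx ⟨h, h'⟩
        change σ _ * σ _ = 0
        rw [hσ, Real.smoothTransition.zero_of_nonpos (x := (k + 1 : ℝ) * (d - x))
          (mul_nonpos_of_nonneg_of_nonpos hk.le (by linarith)), mul_zero]
    have hφg : ∀ k, (fun x => φ k x • g x) = fun x => φ k x • (Icc c d).indicator g x := by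
      intro k
      ext x
      by_cases hx : x ∈ Icc c d
      · simp [hx]
      · rw [hφ0 k x fun h => hx (Ioo_subset_Icc_self h), zero_smul, zero_smul]
    rw [← integral_indicator measurableSet_Ioo]
    simp_rw [hφg]
    refine tendsto_integral_of_dominated_convergence (fun x => ‖(Icc c d).indicator g x‖) ?_
      hgi.norm ?_ ?_
    · exact fun k => (hφdiff k).continuous.aestronglyMeasurable.smul hgi.aestronglyMeasurable
    · intro k
      refine Eventually.of_forall fun x => ?_
      rw [norm_smul]
      refine mul_le_of_le_one_left (norm_nonneg _) ?_
      rw [Real.norm_of_nonneg (mul_nonneg (Real.smoothTransition.nonneg _)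
        (Real.smoothTransition.nonneg _))]
      exact mul_le_one₀ (Real.smoothTransition.le_one _) (Real.smoothTransition.nonneg _)
        (Real.smoothTransition.le_one _)
    · refine Eventually.of_forall fun x => ?_
      by_cases hx : x ∈ Ioo c d
      · have hK : Tendsto (fun k : ℕ => (k + 1 : ℝ)) atTop atTop :=
          tendsto_atTop_add_const_right _ _ tendsto_natCast_atTop_atTop
        refine tendsto_const_nhds.congr' ?_
        filter_upwards [hK.eventually_ge_atTop (1 / (x - c)),
          hK.eventually_ge_atTop (1 / (d - x))] with k hk1 hk2
        rw [div_le_iff₀ (by linarith [hx.1])] at hk1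
        rw [div_le_iff₀ (by linarith [hx.2])] at hk2
        simp [φ, hσ, Real.smoothTransition.one_of_one_le hk1,
          Real.smoothTransition.one_of_one_le hk2, hx, Ioo_subset_Icc_self hx]
      · simp [hφ0 _ x hx, hx]
  refine tendsto_nhds_unique hlhs (hrhs.congr fun k => ?_)
  exact (htest (φ k) (hφdiff k) (hφsupp k)).symm

end Test

/-! ### Primitives of measures -/

section Primitive

variable {E : Type*} [NormedAddCommGroup E] [NormedSpace ℝ E]

/-- Dominated convergence: the indicators of the sets are eventually constant at almost every point.
-/
theorem tendsto_setIntegral_of_eventually_mem_iff {ι : Type*} {l : Filter ι}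
    [l.IsCountablyGenerated] {μ : Measure ℝ} {g : ℝ → E} {V S₀ : Set ℝ} {S : ι → Set ℝ}
    (hV : MeasurableSet V) (hg : IntegrableOn g V μ) (hS : ∀ i, MeasurableSet (S i))
    (hSV : ∀ i, S i ⊆ V) (hS₀ : MeasurableSet S₀)
    (h : ∀ᵐ y ∂μ, ∀ᶠ i in l, (y ∈ S i ↔ y ∈ S₀)) :
    Tendsto (fun i => ∫ y in S i, g y ∂μ) l (𝓝 (∫ y in S₀, g y ∂μ)) := by
  simp_rw [← integral_indicator (hS _), ← integral_indicator hS₀]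
  refine tendsto_integral_filter_of_dominated_convergence (fun y => ‖V.indicator g y‖) ?_ ?_
    (hg.integrable_indicator hV).norm ?_
  · exact Eventually.of_forall fun i =>
      ((hg.mono_set (hSV i)).integrable_indicator (hS i)).aestronglyMeasurable
  · refine Eventually.of_forall fun i => Eventually.of_forall fun y => ?_
    by_cases hy : y ∈ S i
    · simp [hy, hSV i hy]
    · simp [hy]
  · filter_upwards [h] with y hy
    refine tendsto_const_nhds.congr' ?_
    filter_upwards [hy] with i hi
    by_cases hy0 : y ∈ S₀
    · rw [indicator_of_mem hy0, indicator_of_mem (hi.2 hy0)]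
    · rw [indicator_of_notMem hy0, indicator_of_notMem fun h => hy0 (hi.1 h)]

section Limits

variable {μ : Measure ℝ} {g : ℝ → E}
-- This and the next three: the primitives over `Iio x` and over `Iic x` have the same one-sided
-- limits, the `Iio` value from the left and the `Iic` value from the right. Hence their mean is
-- balanced.
theorem tendsto_setIntegral_Iio_left (hg : Integrable g μ) (a : ℝ) :
    Tendsto (fun x => ∫ y in Iio x, g y ∂μ) (𝓝[<] a) (𝓝 (∫ y in Iio a, g y ∂μ)) := by
  refine tendsto_setIntegral_of_eventually_mem_iff MeasurableSet.univ hg.integrableOn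
    (fun _ => measurableSet_Iio) (fun _ => subset_univ _) measurableSet_Iio
    (Eventually.of_forall fun y => ?_)
  rcases lt_or_ge y a with h | h
  · filter_upwards [Ioo_mem_nhdsLT h] with x hx
    simp [hx.1, h]
  · filter_upwards [self_mem_nhdsWithin] with x hx
    have : x < a := hx
    simp only [mem_Iio]
    constructor <;> intro h' <;> linarith

theorem tendsto_setIntegral_Iic_left (hg : Integrable g μ) (a : ℝ) :
    Tendsto (fun x => ∫ y in Iic x, g y ∂μ) (𝓝[<] a) (𝓝 (∫ y in Iio a, g y ∂μ)) := by
  refine tendsto_setIntegral_of_eventually_mem_iff MeasurableSet.univ hg.integrableOn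
    (fun _ => measurableSet_Iic) (fun _ => subset_univ _) measurableSet_Iio
    (Eventually.of_forall fun y => ?_)
  rcases lt_or_ge y a with h | h
  · filter_upwards [Ioo_mem_nhdsLT h] with x hx
    simp [hx.1.le, h]
  · filter_upwards [self_mem_nhdsWithin] with x hx
    have : x < a := hx
    simp only [mem_Iio, mem_Iic]
    constructor <;> intro h' <;> linarith

theorem tendsto_setIntegral_Iio_right (hg : Integrable g μ) (a : ℝ) :
    Tendsto (fun x => ∫ y in Iio x, g y ∂μ) (𝓝[>] a) (𝓝 (∫ y in Iic a, g y ∂μ)) := by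
  refine tendsto_setIntegral_of_eventually_mem_iff MeasurableSet.univ hg.integrableOn
    (fun _ => measurableSet_Iio) (fun _ => subset_univ _) measurableSet_Iic
    (Eventually.of_forall fun y => ?_)
  rcases lt_or_ge a y with h | h
  · filter_upwards [Ioo_mem_nhdsGT h] with x hx
    simp only [mem_Iio, mem_Iic]
    constructor <;> intro h' <;> linarith [hx.1, hx.2]
  · filter_upwards [self_mem_nhdsWithin] with x hx
    have : a < x := hx
    simp only [mem_Iio, mem_Iic]
    constructor <;> intro h' <;> linarith

theorem tendsto_setIntegral_Iic_right (hg : Integrable g μ) (a : ℝ) :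
    Tendsto (fun x => ∫ y in Iic x, g y ∂μ) (𝓝[>] a) (𝓝 (∫ y in Iic a, g y ∂μ)) := by
  refine tendsto_setIntegral_of_eventually_mem_iff MeasurableSet.univ hg.integrableOn
    (fun _ => measurableSet_Iic) (fun _ => subset_univ _) measurableSet_Iic
    (Eventually.of_forall fun y => ?_)
  rcases lt_or_ge a y with h | h
  · filter_upwards [Ioo_mem_nhdsGT h] with x hx
    simp only [mem_Iic]
    constructor <;> intro h' <;> linarith [hx.1, hx.2]
  · filter_upwards [self_mem_nhdsWithin] with x hx
    have : a < x := hx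
    simp only [mem_Iic]
    constructor <;> intro h' <;> linarith

theorem setIntegral_Iic_eq_add [CompleteSpace E] (hg : Integrable g μ) (a : ℝ) :
    ∫ y in Iic a, g y ∂μ = ∫ y in Iio a, g y ∂μ + μ.real {a} • g a := by
  rw [← Iio_union_right, setIntegral_union (by simp) (measurableSet_singleton a)
    hg.integrableOn hg.integrableOn, integral_singleton]

end Limits

/-- Fubini on {y < x}: integrating φ' over x > y gives -φ(y). -/
theorem integral_deriv_smul_setIntegral_Iio [CompleteSpace E] {μ : Measure ℝ} [IsFiniteMeasure μ]
    {g : ℝ → E} (hg : Integrable g μ) {φ : ℝ → ℝ} (hφ : ContDiff ℝ 1 φ)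
    (hc : HasCompactSupport φ) :
    Integrable (fun x => deriv φ x • ∫ y in Iio x, g y ∂μ) ∧
      ∫ x, deriv φ x • ∫ y in Iio x, g y ∂μ = -∫ y, φ y • g y ∂μ := by
  have hφi : Integrable (deriv φ) :=
    (hφ.continuous_deriv le_rfl).integrable_of_hasCompactSupport hc.deriv
  have hS : MeasurableSet {p : ℝ × ℝ | p.2 < p.1} :=
    measurableSet_lt measurable_snd measurable_fst
  set F : ℝ × ℝ → E := {p : ℝ × ℝ | p.2 < p.1}.indicator fun p => deriv φ p.1 • g p.2 with hF
  have hFi : Integrable F (volume.prod μ) := (hφi.smul_prod hg).indicator hS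
  have h1 : ∀ x, ∫ y, F (x, y) ∂μ = deriv φ x • ∫ y in Iio x, g y ∂μ := by
    intro x
    rw [← integral_smul, ← integral_indicator measurableSet_Iio]
    rfl
  have h2 : ∀ y, ∫ x, F (x, y) = -(φ y • g y) := by
    intro y
    have : ∫ x, F (x, y) = ∫ x in Ioi y, deriv φ x • g y := by
      rw [← integral_indicator measurableSet_Ioi]
      rfl
    rw [this, integral_smul_const, hc.integral_Ioi_deriv_eq hφ, neg_smul]
  have h3 := hFi.integral_prod_left
  simp_rw [h1] at h3
  refine ⟨h3, ?_⟩
  simp_rw [← h1]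
  rw [integral_integral_swap (f := fun x y => F (x, y)) hFi]
  simp_rw [h2]
  exact integral_neg _

/-- The two primitives differ only at the countably many atoms, a Lebesgue null set. -/
theorem integral_deriv_smul_setIntegral_Iic [CompleteSpace E] {μ : Measure ℝ} [IsFiniteMeasure μ]
    {g : ℝ → E} (hg : Integrable g μ) {φ : ℝ → ℝ} (hφ : ContDiff ℝ 1 φ)
    (hc : HasCompactSupport φ) :
    Integrable (fun x => deriv φ x • ∫ y in Iic x, g y ∂μ) ∧
      ∫ x, deriv φ x • ∫ y in Iic x, g y ∂μ = -∫ y, φ y • g y ∂μ := by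
  obtain ⟨h1, h2⟩ := integral_deriv_smul_setIntegral_Iio hg hφ hc
  have hcount : {x | 0 < μ {x}}.Countable :=
    Measure.countable_meas_pos_of_disjoint_iUnion (μ := μ) (As := fun x : ℝ => {x})
      (fun x => measurableSet_singleton x) fun x y hxy => by simpa [Function.onFun] using hxy
  have hae : (fun x => deriv φ x • ∫ y in Iio x, g y ∂μ)
      =ᵐ[volume] fun x => deriv φ x • ∫ y in Iic x, g y ∂μ := by
    filter_upwards [hcount.ae_notMem volume] with x hx
    have hx' : μ {x} = 0 := by simpa using hx
    rw [setIntegral_Iic_eq_add hg, measureReal_def, hx']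
    simp
  exact ⟨h1.congr hae, by rw [← integral_congr_ae hae, h2]⟩

theorem integral_deriv_smul_const [CompleteSpace E] {φ : ℝ → ℝ} (hφ : ContDiff ℝ 1 φ)
    (hc : HasCompactSupport φ) (e : E) :
    Integrable (fun x => deriv φ x • e) ∧ ∫ x, deriv φ x • e = 0 := by
  have hφi : Integrable (deriv φ) :=
    (hφ.continuous_deriv le_rfl).integrable_of_hasCompactSupport hc.deriv
  refine ⟨hφi.smul_const e, ?_⟩
  rw [integral_smul_const, integral_of_hasDerivAt_of_tendsto (f := φ) (m := 0) (n := 0)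
    (fun x => (hφ.differentiable one_ne_zero x).hasDerivAt) hφi]
  · simp
  · exact hc.is_zero_at_infty.mono_left atBot_le_cocompact
  · exact hc.is_zero_at_infty.mono_left atTop_le_cocompact

theorem locallyBoundedVariationOn_of_dist_le {F : Type*} [PseudoMetricSpace F] {f : ℝ → F}
    {N : ℝ → ℝ} (h : ∀ x y, x ≤ y → dist (f y) (f x) ≤ N y - N x) (s : Set ℝ) :
    LocallyBoundedVariationOn f s := by
  have hN : Monotone N := fun x y hxy => by linarith [h x y hxy, dist_nonneg (x := f y) (y := f x)]
  intro a b ha hb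
  refine ne_top_of_le_ne_top ((hN.monotoneOn s).locallyBoundedVariationOn a b ha hb) ?_
  refine iSup_mono fun p => Finset.sum_le_sum fun i _ => ?_
  have := h _ _ (p.2.2.1 i.le_succ)
  rw [edist_dist, edist_dist, Real.dist_eq]
  exact ENNReal.ofReal_le_ofReal (this.trans (le_abs_self _))

end Primitive

/-- Functions that are locally of bounded variation on an interval are measurable there. -/
theorem aestronglyMeasurable_of_locallyBoundedVariationOn {f : ℝ → ℂ} {S : Set ℝ}
    (hS : MeasurableSet S) (hf : LocallyBoundedVariationOn f S) (ν : Measure ℝ) :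
    AEStronglyMeasurable f (ν.restrict S) := by
  have hreal : ∀ p : ℝ → ℝ, LocallyBoundedVariationOn p S → AEMeasurable p (ν.restrict S) := by
    intro p hp
    obtain ⟨p₁, p₂, h₁, h₂, rfl⟩ := hp.exists_monotoneOn_sub_monotoneOn
    exact (aemeasurable_restrict_of_monotoneOn hS h₁).sub
      (aemeasurable_restrict_of_monotoneOn hS h₂)
  have hre := hreal _ (Complex.reCLM.lipschitz.comp_locallyBoundedVariationOn hf)
  have him := hreal _ (Complex.imCLM.lipschitz.comp_locallyBoundedVariationOn hf)
  exact (aemeasurable_of_re_im (𝕜 := ℂ) hre him).aestronglyMeasurable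

theorem exists_norm_le_of_locallyBoundedVariationOn {f : ℝ → ℂ} {S : Set ℝ}
    (hf : LocallyBoundedVariationOn f S) {c d : ℝ} (hc : c ∈ S) (hd : d ∈ S)
    (hS : Icc c d ⊆ S) : ∃ M, ∀ x ∈ Icc c d, ‖f x‖ ≤ M := by
  refine ⟨‖f c‖ + (eVariationOn f (S ∩ Icc c d)).toReal, fun x hx => ?_⟩
  have h := BoundedVariationOn.dist_le (hf c d hc hd) (x := x) (y := c) ⟨hS hx, hx⟩
    ⟨hc, le_rfl, hx.1.trans hx.2⟩
  rw [dist_eq_norm] at h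
  linarith [norm_le_norm_add_norm_sub' (f x) (f c)]

/-- Clamping to a compact neighbourhood [c,d] of x makes the variation finite on the whole line
without changing the limits at x. -/
theorem exists_tendsto_of_locallyBoundedVariationOn {f : ℝ → ℂ} {s t x : ℝ}
    (hf : LocallyBoundedVariationOn f (Ioo s t)) (hx : x ∈ Ioo s t) :
    Tendsto f (𝓝[<] x) (𝓝 (Function.leftLim f x)) ∧
      Tendsto f (𝓝[>] x) (𝓝 (Function.rightLim f x)) := by
  obtain ⟨c, hc⟩ := exists_between hx.1
  obtain ⟨d, hd⟩ := exists_between hx.2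
  have hsub : Icc c d ⊆ Ioo s t := fun y hy => ⟨hc.1.trans_le hy.1, hy.2.trans_lt hd.2⟩
  have hbv := boundedVariationOn_clampFun (hc.2.trans hd.1).le hf hsub
  have heq : clampFun f c d =ᶠ[𝓝 x] f := by
    filter_upwards [Ioo_mem_nhds hc.2 hd.1] with y hy
    simp [clampFun, min_eq_right hy.2.le, max_eq_right hy.1.le]
  have h1 : Tendsto f (𝓝[>] x) (𝓝 (Function.rightLim (clampFun f c d) x)) :=
    (hbv.tendsto_rightLim x).congr' (heq.filter_mono nhdsWithin_le_nhds)
  have h2 : Tendsto f (𝓝[<] x) (𝓝 (Function.leftLim (clampFun f c d) x)) :=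
    (hbv.tendsto_leftLim x).congr' (heq.filter_mono nhdsWithin_le_nhds)
  rw [rightLim_eq_of_tendsto h1, leftLim_eq_of_tendsto h2]
  exact ⟨h2, h1⟩

theorem measurableStrictOrder_lt : MeasurableStrictOrder fun x y : ℝ => x < y :=
  ⟨fun _ _ _ => lt_trans, fun _ _ h => h.not_gt, measurableSet_lt measurable_fst measurable_snd⟩

theorem measurableStrictOrder_gt : MeasurableStrictOrder fun x y : ℝ => y < x :=
  ⟨fun _ _ _ h h' => lt_trans h' h, fun _ _ h => h.not_gt,
    measurableSet_lt measurable_snd measurable_fst⟩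

/-! ### Distributional solutions satisfy the Volterra equations -/

namespace MeasureSystem

variable {E : Type*} [NormedAddCommGroup E] [NormedSpace ℂ E] (P : MeasureSystem E)

/-- A balanced distributional solution `u` on `(s, t)` with one-sided limits `uL` and `uR`. -/
structure IsWeakSolution (s t : ℝ) (z : ℂ) (u uL uR : ℝ → E) : Prop where
  aestronglyMeasurable : ∀ ν : Measure ℝ, AEStronglyMeasurable u (ν.restrict (Ioo s t))
  bounded : ∀ c d, s < c → d < t → ∃ M : ℝ, ∀ x ∈ Icc c d, ‖u x‖ ≤ M
  left : ∀ x ∈ Ioo s t, Tendsto u (𝓝[<] x) (𝓝 (uL x))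
  right : ∀ x ∈ Ioo s t, Tendsto u (𝓝[>] x) (𝓝 (uR x))
  balanced : ∀ x ∈ Ioo s t, u x = (1 / 2 : ℂ) • (uR x + uL x)
  equation : ∀ φ : ℝ → ℝ, ContDiff ℝ ∞ φ → HasCompactSupport φ → tsupport φ ⊆ Ioo s t →
    ∫ x, deriv φ x • (P.J : E →L[ℂ] E) (u x) = ∫ x, φ x • P.G z x (u x) ∂P.μ

namespace IsWeakSolution

variable {P} {s t : ℝ} {z : ℂ} {u uL uR : ℝ → E}

theorem integrableOn_G (h : P.IsWeakSolution s t z u uL uR) {S : Set ℝ} (hS : MeasurableSet S)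
    (hSs : S ⊆ Ioo s t) {M : ℝ} (hM : ∀ x ∈ S, ‖u x‖ ≤ M) :
    IntegrableOn (fun x => P.G z x (u x)) S P.μ := by
  refine Integrable.mono' ((P.integrable_G z).norm.mul_const M).integrableOn
    ((P.integrable_G z).aestronglyMeasurable.restrict.clm_apply'
      ((h.aestronglyMeasurable P.μ).mono_measure (Measure.restrict_mono hSs le_rfl))) ?_
  refine (ae_restrict_iff' hS).2 (Eventually.of_forall fun x hx => ?_)
  exact ((P.G z x).le_opNorm _).trans (mul_le_mul_of_nonneg_left (hM x hx) (norm_nonneg _))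

theorem J_apply (h : P.IsWeakSolution s t z u uL uR) {x : ℝ} (hx : x ∈ Ioo s t) :
    (P.J : E →L[ℂ] E) (u x)
      = (1 / 2 : ℂ) • ((P.J : E →L[ℂ] E) (uR x) + (P.J : E →L[ℂ] E) (uL x)) := by
  conv_lhs => rw [h.balanced x hx]
  rw [map_smul, map_add]

variable [CompleteSpace E]

theorem sub_eq_setIntegral (h : P.IsWeakSolution s t z u uL uR) {c d : ℝ} (hc : s < c)
    (hcd : c < d) (hd : d < t) :
    (P.J : E →L[ℂ] E) (uR c) - (P.J : E →L[ℂ] E) (uL d)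
      = ∫ x in Ioo c d, P.G z x (u x) ∂P.μ := by
  obtain ⟨M, hM⟩ := h.bounded c d hc hd
  have hsub : Icc c d ⊆ Ioo s t := fun y hy => ⟨hc.trans_le hy.1, hy.2.trans_lt hd⟩
  refine sub_eq_setIntegral_of_test (h := fun x => (P.J : E →L[ℂ] E) (u x))
    (M := ‖(P.J : E →L[ℂ] E)‖ * M) hcd ?_ ?_ ?_ ?_ ?_ ?_
  · intro x hx
    exact ((P.J : E →L[ℂ] E).le_opNorm _).trans
      (mul_le_mul_of_nonneg_left (hM x hx) (norm_nonneg _))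
  · exact (P.J : E →L[ℂ] E).continuous.comp_aestronglyMeasurable
      ((h.aestronglyMeasurable volume).mono_measure (Measure.restrict_mono hsub le_rfl))
  · exact ((P.J : E →L[ℂ] E).continuous.tendsto _).comp (h.right c ⟨hc, hcd.trans hd⟩)
  · exact ((P.J : E →L[ℂ] E).continuous.tendsto _).comp (h.left d ⟨hc.trans hcd, hd⟩)
  · exact h.integrableOn_G measurableSet_Icc hsub hM
  · exact fun φ hφ hφs => h.equation φ hφ
      (HasCompactSupport.of_support_subset_isCompact isCompact_Icc
        ((subset_tsupport φ).trans hφs)) (hφs.trans hsub)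

/-- Split (c,d) into (c,x), {x} and (x,d). Subtracting the increments over the two outer pieces from
the increment over (c,d) leaves the atom at x. -/
theorem jump_eq (h : P.IsWeakSolution s t z u uL uR) {x : ℝ} (hx : x ∈ Ioo s t) :
    (P.J : E →L[ℂ] E) (uR x) - (P.J : E →L[ℂ] E) (uL x)
      = -((P.μ.real {x} : ℂ) • P.G z x (u x)) := by
  obtain ⟨c, hc⟩ := exists_between hx.1
  obtain ⟨d, hd⟩ := exists_between hx.2
  obtain ⟨M, hM⟩ := h.bounded c d hc.1 hd.2
  have hsub : Icc c d ⊆ Ioo s t := fun y hy => ⟨hc.1.trans_le hy.1, hy.2.trans_lt hd.2⟩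
  have hi : IntegrableOn (fun x => P.G z x (u x)) (Icc c d) P.μ :=
    h.integrableOn_G measurableSet_Icc hsub hM
  have e1 := h.sub_eq_setIntegral hc.1 hc.2 hx.2
  have e2 := h.sub_eq_setIntegral hx.1 hd.1 hd.2
  have e3 := h.sub_eq_setIntegral hc.1 (hc.2.trans hd.1) hd.2
  have h1 : Ioo c d = Ioo c x ∪ ({x} ∪ Ioo x d) := by
    rw [singleton_union, Ioo_insert_left hd.1, Ioo_union_Ico_eq_Ioo hc.2 hd.1.le]
  have hcx : Ioo c x ⊆ Icc c d := fun y hy => ⟨hy.1.le, hy.2.le.trans hd.1.le⟩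
  have hxd : Ioo x d ⊆ Icc c d := fun y hy => ⟨hc.2.le.trans hy.1.le, hy.2.le⟩
  have hxx : {x} ⊆ Icc c d := singleton_subset_iff.2 ⟨hc.2.le, hd.1.le⟩
  rw [h1, setIntegral_union _ ((measurableSet_singleton x).union measurableSet_Ioo)
    (hi.mono_set hcx) (hi.mono_set (union_subset hxx hxd)),
    setIntegral_union (by simp) measurableSet_Ioo (hi.mono_set hxx) (hi.mono_set hxd),
    integral_singleton, ← e1, ← e2] at e3
  · have h2 : P.μ.real {x} • P.G z x (u x) = (P.μ.real {x} : ℂ) • P.G z x (u x) :=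
      (Complex.coe_smul _ _).symm
    rw [← h2, eq_neg_iff_add_eq_zero]
    have h3 := sub_eq_zero.2 e3
    rw [← neg_eq_zero, ← h3]
    abel
  · rw [Set.disjoint_left]
    rintro y hy (rfl | hy')
    · exact lt_irrefl _ hy.2
    · exact lt_asymm hy.2 hy'.1

/-- J u is the mean of J u⁺ and J u⁻, and adding half of μ{x} G u = J u⁻ - J u⁺ leaves J u⁻. With
the opposite sign, J u⁺ remains. -/
theorem side_one_apply (h : P.IsWeakSolution s t z u uL uR) {x : ℝ} (hx : x ∈ Ioo s t) :
    P.side 1 z x (u x) = (P.J : E →L[ℂ] E) (uL x) := by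
  have h1 := h.jump_eq hx
  have h2 : (P.μ.real {x} : ℂ) • P.G z x (u x)
      = (P.J : E →L[ℂ] E) (uL x) - (P.J : E →L[ℂ] E) (uR x) := by
    rw [← neg_eq_iff_eq_neg] at h1
    rw [← h1, neg_sub]
  rw [side, add_apply, smul_apply, mul_smul, h2, h.J_apply hx]
  module

theorem side_neg_one_apply (h : P.IsWeakSolution s t z u uL uR) {x : ℝ} (hx : x ∈ Ioo s t) :
    P.side (-1) z x (u x) = (P.J : E →L[ℂ] E) (uR x) := by
  have h1 := h.jump_eq hx
  have h2 : (P.μ.real {x} : ℂ) • P.G z x (u x)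
      = (P.J : E →L[ℂ] E) (uL x) - (P.J : E →L[ℂ] E) (uR x) := by
    rw [← neg_eq_iff_eq_neg] at h1
    rw [← h1, neg_sub]
  rw [side, add_apply, smul_apply, mul_smul, h2, h.J_apply hx]
  module

end IsWeakSolution

theorem inverse_side_apply {σ z : ℂ} {x : ℝ} (h : IsUnit (P.side σ z x)) {e f : E}
    (hef : P.side σ z x e = f) : Ring.inverse (P.side σ z x) f = e := by
  rw [← hef]
  exact congrArg (fun L : E →L[ℂ] E => L e) (Ring.inverse_mul_cancel _ h)

theorem side_apply_inverse {σ z : ℂ} {x : ℝ} (h : IsUnit (P.side σ z x)) (e : E) :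
    P.side σ z x (Ring.inverse (P.side σ z x) e) = e :=
  congrArg (fun L : E →L[ℂ] E => L e) (Ring.mul_inverse_cancel _ h)

theorem J_inv_apply (e : E) :
    ((P.J⁻¹ : (E →L[ℂ] E)ˣ) : E →L[ℂ] E) ((P.J : E →L[ℂ] E) e) = e :=
  congrArg (fun L : E →L[ℂ] E => L e) P.J.inv_mul

theorem J_apply_inv (e : E) :
    (P.J : E →L[ℂ] E) (((P.J⁻¹ : (E →L[ℂ] E)ˣ) : E →L[ℂ] E) e) = e :=
  congrArg (fun L : E →L[ℂ] E => L e) P.J.mul_inv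

theorem kernel_apply (σ z : ℂ) (x : ℝ) (e : E) :
    P.kernel σ z x e = -(σ • ((P.J⁻¹ : (E →L[ℂ] E)ˣ) : E →L[ℂ] E)
      (P.G z x (Ring.inverse (P.side σ z x) ((P.J : E →L[ℂ] E) e)))) := rfl

namespace IsWeakSolution

variable {P} {s t : ℝ} {z : ℂ} {u uL uR : ℝ → E} [FiniteDimensional ℂ E]

/-- The left limits of a solution satisfy a Volterra equation. -/
theorem left_eq_volterraSolution (h : P.IsWeakSolution s t z u uL uR)
    (hμ : P.μ (Ioo s t)ᶜ = 0) (hunit : ∀ x, IsUnit (P.side 1 z x)) {u₀ : E}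
    (hu₀ : Tendsto u (𝓝[>] s) (𝓝 u₀)) {v : ℝ → E}
    (hv : P.IsVolterraSolution (fun x y => x < y) 1 z u₀ v) : EqOn uL v (Ioo s t) := by
  have : CompleteSpace E := FiniteDimensional.complete ℂ E
  intro d hd
  have hae : ∀ᵐ y ∂P.μ, y ∈ Ioo s t := by
    rw [ae_iff]; exact hμ
  -- A solution is only locally bounded on (s,t); the limit at s supplies the bound up to that end.
  obtain ⟨M, hM⟩ : ∃ M, ∀ x ∈ Ioc s d, ‖u x‖ ≤ M := by
    have h1 : ∀ᶠ x in 𝓝[>] s, ‖u x‖ ≤ ‖u₀‖ + 1 :=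
      hu₀.norm.eventually (Iic_mem_nhds (lt_add_one _))
    obtain ⟨e, he, hes⟩ := (mem_nhdsGT_iff_exists_Ioo_subset).1 h1
    obtain ⟨c, hc⟩ := exists_between (show s < e from he)
    obtain ⟨M, hM⟩ := h.bounded c d hc.1 hd.2
    refine ⟨max (‖u₀‖ + 1) M, fun x hx => ?_⟩
    rcases lt_or_ge x c with hxc | hxc
    · exact (show ‖u x‖ ≤ ‖u₀‖ + 1 from hes ⟨hx.1, hxc.trans hc.2⟩).trans (le_max_left _ _)
    · exact (hM x ⟨hxc, hx.2⟩).trans (le_max_right _ _)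
  have hsub : Ioc s d ⊆ Ioo s t := fun y hy => ⟨hy.1, hy.2.trans_lt hd.2⟩
  -- The factor B₊⁻¹ J of the kernel converts the left limit back into u itself.
  have hu : ∀ y ∈ Ioo s t, P.kernel 1 z y (uL y)
      = -((P.J⁻¹ : (E →L[ℂ] E)ˣ) : E →L[ℂ] E) (P.G z y (u y)) := by
    intro y hy
    rw [kernel_apply, P.inverse_side_apply (hunit y) (h.side_one_apply hy), one_smul]
  have hG : ∀ x ∈ Ioc s d, IntegrableOn (fun y => P.G z y (u y)) (Iio x) P.μ := by
    intro x hx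
    have h1 := h.integrableOn_G measurableSet_Ioc hsub hM
    refine (h1.mono_set (Ioo_subset_Ioc_self.trans (Ioc_subset_Ioc_right hx.2))
      : IntegrableOn _ (Ioo s x) P.μ).congr_set_ae ?_
    filter_upwards [hae] with y hy
    exact propext ⟨fun h' => ⟨hy.1, h'⟩, fun h' => h'.2⟩
  have hright : Tendsto uR (𝓝[>] s) (𝓝 u₀) := by
    rw [Metric.tendsto_nhds] at hu₀ ⊢
    intro ε hε
    obtain ⟨e, he, hes⟩ := mem_nhdsGT_iff_exists_Ioo_subset.1 (hu₀ (ε / 2) (half_pos hε))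
    filter_upwards [Ioo_mem_nhdsGT (lt_min he (hd.1.trans hd.2))] with x hx
    have hxe := hx.2.trans_le (min_le_left _ _)
    refine lt_of_le_of_lt ?_ (half_lt_self hε)
    refine le_of_tendsto ((h.right x ⟨hx.1, hx.2.trans_le (min_le_right _ _)⟩).dist
      tendsto_const_nhds) ?_
    filter_upwards [Ioo_mem_nhdsGT hxe] with y hy
    exact (hes ⟨hx.1.trans hy.1, hy.2⟩ : dist (u y) u₀ < ε / 2).le
  -- Let c decrease to s in the increment formula on (c,x). As μ has no mass outside (s,t), the
  -- integral over (s,x) may be written over `Iio x`.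
  have heq : ∀ x ∈ Ioc s d, (P.J : E →L[ℂ] E) u₀ - (P.J : E →L[ℂ] E) (uL x)
      = ∫ y in Iio x, P.G z y (u y) ∂P.μ := by
    intro x hx
    have h1 : Tendsto (fun c => ∫ y in Ioo c x, P.G z y (u y) ∂P.μ) (𝓝[>] s)
        (𝓝 (∫ y in Iio x, P.G z y (u y) ∂P.μ)) := by
      refine tendsto_setIntegral_of_eventually_mem_iff measurableSet_Iio (hG x hx)
        (fun _ => measurableSet_Ioo) (fun _ => Ioo_subset_Iio_self) measurableSet_Iio ?_
      filter_upwards [hae] with y hy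
      filter_upwards [Ioo_mem_nhdsGT hy.1] with c hc
      exact ⟨fun h' => h'.2, fun h' => ⟨hc.2, h'⟩⟩
    have h2 := (((P.J : E →L[ℂ] E).continuous.tendsto _).comp hright).sub
      (tendsto_const_nhds (x := (P.J : E →L[ℂ] E) (uL x)))
    refine tendsto_nhds_unique h2 (h1.congr' ?_)
    filter_upwards [Ioo_mem_nhdsGT hx.1] with c hc
    exact (h.sub_eq_setIntegral hc.1 hc.2 (hsub hx).2).symm
  obtain ⟨M', hM'⟩ := hv.bounded
  refine eqOn_of_volterra measurableStrictOrder_lt P.μ (P.integrable_kernel hunit) (T := Ioc s d)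
    (M := max M M') (u₀ := u₀) ?_ ?_ ?_ ?_ ?_ ?_ ?_ ⟨hd.1, le_rfl⟩
  · intro x hx
    filter_upwards [hae] with y hy hyx
    exact ⟨hy.1, (le_of_lt hyx).trans hx.2⟩
  · intro x hx
    refine le_of_tendsto (h.left x (hsub hx)).norm ?_
    filter_upwards [Ioo_mem_nhdsLT hx.1] with y hy
    exact (hM y ⟨hy.1, hy.2.le.trans hx.2⟩).trans (le_max_left _ _)
  · exact fun x _ => (hM' x).trans (le_max_right _ _)
  · intro x hx
    refine IntegrableOn.congr_fun_ae ((((P.J⁻¹ : (E →L[ℂ] E)ˣ) : E →L[ℂ] E).integrable_comp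
      (hG x hx)).neg) ?_
    filter_upwards [ae_restrict_of_ae hae] with y hy
    exact (hu y hy).symm
  · exact fun x _ => (hv.integrable hunit).integrableOn
  · intro x hx
    have h1 : ∫ y in {y | y < x}, P.kernel 1 z y (uL y) ∂P.μ
        = ∫ y in Iio x, -((P.J⁻¹ : (E →L[ℂ] E)ˣ) : E →L[ℂ] E) (P.G z y (u y)) ∂P.μ := by
      refine integral_congr_ae ?_
      filter_upwards [ae_restrict_of_ae hae] with y hy
      exact hu y hy
    rw [h1, integral_neg, ContinuousLinearMap.integral_comp_comm _ (hG x hx), ← heq x hx, map_sub,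
      P.J_inv_apply, P.J_inv_apply]
    abel
  · exact fun x _ => hv.equation x

/-- The right limits of a solution satisfy a Volterra equation. -/
theorem right_eq_volterraSolution (h : P.IsWeakSolution s t z u uL uR)
    (hμ : P.μ (Ioo s t)ᶜ = 0) (hunit : ∀ x, IsUnit (P.side (-1) z x)) {u₀ : E}
    (hu₀ : Tendsto u (𝓝[<] t) (𝓝 u₀)) {v : ℝ → E}
    (hv : P.IsVolterraSolution (fun x y => y < x) (-1) z u₀ v) : EqOn uR v (Ioo s t) := by
  have : CompleteSpace E := FiniteDimensional.complete ℂ E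
  intro c hc
  have hae : ∀ᵐ y ∂P.μ, y ∈ Ioo s t := by
    rw [ae_iff]; exact hμ
  obtain ⟨M, hM⟩ : ∃ M, ∀ x ∈ Ico c t, ‖u x‖ ≤ M := by
    have h1 : ∀ᶠ x in 𝓝[<] t, ‖u x‖ ≤ ‖u₀‖ + 1 :=
      hu₀.norm.eventually (Iic_mem_nhds (lt_add_one _))
    obtain ⟨e, he, hes⟩ := (mem_nhdsLT_iff_exists_Ioo_subset).1 h1
    obtain ⟨d, hd⟩ := exists_between (show e < t from he)
    obtain ⟨M, hM⟩ := h.bounded c d hc.1 hd.2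
    refine ⟨max (‖u₀‖ + 1) M, fun x hx => ?_⟩
    rcases lt_or_ge d x with hxd | hxd
    · exact (show ‖u x‖ ≤ ‖u₀‖ + 1 from hes ⟨hd.1.trans hxd, hx.2⟩).trans (le_max_left _ _)
    · exact (hM x ⟨hx.1, hxd⟩).trans (le_max_right _ _)
  have hsub : Ico c t ⊆ Ioo s t := fun y hy => ⟨hc.1.trans_le hy.1, hy.2⟩
  have hu : ∀ y ∈ Ioo s t, P.kernel (-1) z y (uR y)
      = ((P.J⁻¹ : (E →L[ℂ] E)ˣ) : E →L[ℂ] E) (P.G z y (u y)) := by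
    intro y hy
    rw [kernel_apply, P.inverse_side_apply (hunit y) (h.side_neg_one_apply hy), neg_smul, one_smul,
      neg_neg]
  have hG : ∀ x ∈ Ico c t, IntegrableOn (fun y => P.G z y (u y)) (Ioi x) P.μ := by
    intro x hx
    have h1 := h.integrableOn_G measurableSet_Ico hsub hM
    refine (h1.mono_set (Ioo_subset_Ico_self.trans (Ico_subset_Ico_left hx.1))
      : IntegrableOn _ (Ioo x t) P.μ).congr_set_ae ?_
    filter_upwards [hae] with y hy
    exact propext ⟨fun h' => ⟨h', hy.2⟩, fun h' => h'.1⟩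
  have hleft : Tendsto uL (𝓝[<] t) (𝓝 u₀) := by
    rw [Metric.tendsto_nhds] at hu₀ ⊢
    intro ε hε
    obtain ⟨e, he, hes⟩ := mem_nhdsLT_iff_exists_Ioo_subset.1 (hu₀ (ε / 2) (half_pos hε))
    filter_upwards [Ioo_mem_nhdsLT (max_lt he (hc.1.trans hc.2))] with x hx
    have hxe := (le_max_left _ _).trans_lt hx.1
    refine lt_of_le_of_lt ?_ (half_lt_self hε)
    refine le_of_tendsto ((h.left x ⟨(le_max_right _ _).trans_lt hx.1, hx.2⟩).dist
      tendsto_const_nhds) ?_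
    filter_upwards [Ioo_mem_nhdsLT hxe] with y hy
    exact (hes ⟨hy.1, hy.2.trans hx.2⟩ : dist (u y) u₀ < ε / 2).le
  have heq : ∀ x ∈ Ico c t, (P.J : E →L[ℂ] E) (uR x) - (P.J : E →L[ℂ] E) u₀
      = ∫ y in Ioi x, P.G z y (u y) ∂P.μ := by
    intro x hx
    have h1 : Tendsto (fun d => ∫ y in Ioo x d, P.G z y (u y) ∂P.μ) (𝓝[<] t)
        (𝓝 (∫ y in Ioi x, P.G z y (u y) ∂P.μ)) := by
      refine tendsto_setIntegral_of_eventually_mem_iff measurableSet_Ioi (hG x hx)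
        (fun _ => measurableSet_Ioo) (fun _ => Ioo_subset_Ioi_self) measurableSet_Ioi ?_
      filter_upwards [hae] with y hy
      filter_upwards [Ioo_mem_nhdsLT hy.2] with d hd
      exact ⟨fun h' => h'.1, fun h' => ⟨h', hd.1⟩⟩
    have h2 := (tendsto_const_nhds (x := (P.J : E →L[ℂ] E) (uR x))).sub
      (((P.J : E →L[ℂ] E).continuous.tendsto _).comp hleft)
    refine tendsto_nhds_unique h2 (h1.congr' ?_)
    filter_upwards [Ioo_mem_nhdsLT hx.2] with d hd
    exact (h.sub_eq_setIntegral (hsub hx).1 hd.1 hd.2).symm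
  obtain ⟨M', hM'⟩ := hv.bounded
  refine eqOn_of_volterra measurableStrictOrder_gt P.μ (P.integrable_kernel hunit) (T := Ico c t)
    (M := max M M') (u₀ := u₀) ?_ ?_ ?_ ?_ ?_ ?_ ?_ ⟨le_rfl, hc.2⟩
  · intro x hx
    filter_upwards [hae] with y hy hyx
    exact ⟨hx.1.trans (le_of_lt hyx), hy.2⟩
  · intro x hx
    refine le_of_tendsto (h.right x (hsub hx)).norm ?_
    filter_upwards [Ioo_mem_nhdsGT hx.2] with y hy
    exact (hM y ⟨hx.1.trans hy.1.le, hy.2⟩).trans (le_max_left _ _)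
  · exact fun x _ => (hM' x).trans (le_max_right _ _)
  · intro x hx
    refine IntegrableOn.congr_fun_ae (((P.J⁻¹ : (E →L[ℂ] E)ˣ) : E →L[ℂ] E).integrable_comp
      (hG x hx)) ?_
    filter_upwards [ae_restrict_of_ae hae] with y hy
    exact (hu y hy).symm
  · exact fun x _ => (hv.integrable hunit).integrableOn
  · intro x hx
    have h1 : ∫ y in {y | x < y}, P.kernel (-1) z y (uR y) ∂P.μ
        = ∫ y in Ioi x, ((P.J⁻¹ : (E →L[ℂ] E)ˣ) : E →L[ℂ] E) (P.G z y (u y)) ∂P.μ := by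
      refine integral_congr_ae ?_
      filter_upwards [ae_restrict_of_ae hae] with y hy
      exact hu y hy
    rw [h1, ContinuousLinearMap.integral_comp_comm _ (hG x hx), ← heq x hx, map_sub,
      P.J_inv_apply, P.J_inv_apply]
    abel
  · exact fun x _ => hv.equation x

end IsWeakSolution

/-! ### Solutions of the Volterra equations yield balanced primitives -/

/-- A function is a primitive solution if `J u` is the balanced primitive of `-(A - z B) u`. -/
structure IsPrimitiveSolution (z : ℂ) (u : ℝ → E) (c₀ : E) : Prop where
  integrable : Integrable (fun x => P.G z x (u x)) P.μ
  equation : ∀ x, (P.J : E →L[ℂ] E) (u x) = c₀ - (1 / 2 : ℝ) •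
    (∫ y in Iio x, P.G z y (u y) ∂P.μ + ∫ y in Iic x, P.G z y (u y) ∂P.μ)

namespace IsPrimitiveSolution

variable {P} {z : ℂ} {u : ℝ → E} {c₀ : E}

theorem eq_inv (h : P.IsPrimitiveSolution z u c₀) (x : ℝ) :
    u x = ((P.J⁻¹ : (E →L[ℂ] E)ˣ) : E →L[ℂ] E) (c₀ - (1 / 2 : ℝ) •
    (∫ y in Iio x, P.G z y (u y) ∂P.μ + ∫ y in Iic x, P.G z y (u y) ∂P.μ)) := by
  rw [← h.equation, P.J_inv_apply]

theorem tendsto_left (h : P.IsPrimitiveSolution z u c₀) (x : ℝ) :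
    Tendsto u (𝓝[<] x) (𝓝 (((P.J⁻¹ : (E →L[ℂ] E)ˣ) : E →L[ℂ] E)
      (c₀ - ∫ y in Iio x, P.G z y (u y) ∂P.μ))) := by
  have h1 := (((tendsto_setIntegral_Iio_left h.integrable x).add
    (tendsto_setIntegral_Iic_left h.integrable x)).const_smul (1 / 2 : ℝ)).const_sub c₀
  have h2 := (((P.J⁻¹ : (E →L[ℂ] E)ˣ) : E →L[ℂ] E).continuous.tendsto _).comp h1
  refine (h2.congr fun y => (h.eq_inv y).symm).trans (le_of_eq ?_)
  congr 3
  rw [← two_smul ℝ, smul_smul]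
  norm_num

theorem tendsto_right (h : P.IsPrimitiveSolution z u c₀) (x : ℝ) :
    Tendsto u (𝓝[>] x) (𝓝 (((P.J⁻¹ : (E →L[ℂ] E)ˣ) : E →L[ℂ] E)
      (c₀ - ∫ y in Iic x, P.G z y (u y) ∂P.μ))) := by
  have h1 := (((tendsto_setIntegral_Iio_right h.integrable x).add
    (tendsto_setIntegral_Iic_right h.integrable x)).const_smul (1 / 2 : ℝ)).const_sub c₀
  have h2 := (((P.J⁻¹ : (E →L[ℂ] E)ˣ) : E →L[ℂ] E).continuous.tendsto _).comp h1
  refine (h2.congr fun y => (h.eq_inv y).symm).trans (le_of_eq ?_)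
  congr 3
  rw [← two_smul ℝ, smul_smul]
  norm_num

theorem balanced (h : P.IsPrimitiveSolution z u c₀) (x : ℝ) :
    u x = (1 / 2 : ℂ) • (((P.J⁻¹ : (E →L[ℂ] E)ˣ) : E →L[ℂ] E)
        (c₀ - ∫ y in Iic x, P.G z y (u y) ∂P.μ)
      + ((P.J⁻¹ : (E →L[ℂ] E)ˣ) : E →L[ℂ] E) (c₀ - ∫ y in Iio x, P.G z y (u y) ∂P.μ)) := by
  conv_lhs => rw [h.eq_inv x]
  rw [← map_add, ← map_smul]
  congr 1
  rw [← Complex.coe_smul]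
  push_cast
  module

/-- The norm of J⁻¹ times the balanced primitive of ‖G u‖ controls the increments of u, which yields
bounded variation. -/
theorem exists_dist_le (h : P.IsPrimitiveSolution z u c₀) :
    ∃ N : ℝ → ℝ, ∀ x y, x ≤ y → dist (u y) (u x) ≤ N y - N x := by
  set g : ℝ → E := fun x => P.G z x (u x) with hg
  have hgi : Integrable g P.μ := h.integrable
  have hn := hgi.norm
  set C := ‖((P.J⁻¹ : (E →L[ℂ] E)ˣ) : E →L[ℂ] E)‖ with hC
  have key : ∀ S T : Set ℝ, MeasurableSet S → MeasurableSet T → S ⊆ T →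
      ‖∫ y in T, g y ∂P.μ - ∫ y in S, g y ∂P.μ‖
        ≤ ∫ y in T, ‖g y‖ ∂P.μ - ∫ y in S, ‖g y‖ ∂P.μ := by
    intro S T hS hT hST
    rw [← setIntegral_sdiff hS hgi.integrableOn hST, ← setIntegral_sdiff hS hn.integrableOn hST]
    exact norm_integral_le_integral_norm _
  refine ⟨fun x => C * (1 / 2 * (∫ y in Iio x, ‖g y‖ ∂P.μ + ∫ y in Iic x, ‖g y‖ ∂P.μ)),
    fun x y hxy => ?_⟩
  have k1 := key (Iio x) (Iio y) measurableSet_Iio measurableSet_Iio (Iio_subset_Iio hxy)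
  have k2 := key (Iic x) (Iic y) measurableSet_Iic measurableSet_Iic (Iic_subset_Iic.2 hxy)
  rw [dist_eq_norm, h.eq_inv y, h.eq_inv x, ← map_sub]
  refine (ContinuousLinearMap.le_opNorm _ _).trans ?_
  rw [← mul_sub]
  refine mul_le_mul_of_nonneg_left ?_ (norm_nonneg _)
  rw [sub_sub_sub_cancel_left, ← smul_sub, norm_smul, ← mul_sub, Real.norm_of_nonneg (by norm_num)]
  refine mul_le_mul_of_nonneg_left ?_ (by norm_num)
  rw [norm_sub_rev, add_sub_add_comm, add_sub_add_comm]
  exact (norm_add_le _ _).trans (add_le_add k1 k2)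

theorem test [CompleteSpace E] (h : P.IsPrimitiveSolution z u c₀) {φ : ℝ → ℝ}
    (hφ : ContDiff ℝ 1 φ) (hc : HasCompactSupport φ) :
    ∫ x, deriv φ x • (P.J : E →L[ℂ] E) (u x) = ∫ x, φ x • P.G z x (u x) ∂P.μ := by
  obtain ⟨i1, e1⟩ := integral_deriv_smul_setIntegral_Iio h.integrable hφ hc
  obtain ⟨i2, e2⟩ := integral_deriv_smul_setIntegral_Iic h.integrable hφ hc
  obtain ⟨i3, e3⟩ := integral_deriv_smul_const hφ hc c₀
  have h1 : ∀ x, deriv φ x • (P.J : E →L[ℂ] E) (u x) = deriv φ x • c₀ - (1 / 2 : ℝ) •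
      (deriv φ x • ∫ y in Iio x, P.G z y (u y) ∂P.μ
        + deriv φ x • ∫ y in Iic x, P.G z y (u y) ∂P.μ) := by
    intro x
    rw [h.equation x]
    module
  simp_rw [h1]
  have i4 : Integrable fun x => (1 / 2 : ℝ) • (deriv φ x • ∫ y in Iio x, P.G z y (u y) ∂P.μ
      + deriv φ x • ∫ y in Iic x, P.G z y (u y) ∂P.μ) := (i1.add i2).smul (1 / 2 : ℝ)
  rw [integral_sub i3 i4, integral_smul, integral_add i1 i2, e1, e2, e3]
  module

end IsPrimitiveSolution

section Existence

variable {P} {σ z : ℂ} {r : ℝ → ℝ → Prop} {u₀ : E} {v : ℝ → E}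

theorem IsVolterraSolution.G_eq (hσ : σ * σ = 1) (x : ℝ) :
    P.G z x (Ring.inverse (P.side σ z x) ((P.J : E →L[ℂ] E) (v x)))
      = -(σ • (P.J : E →L[ℂ] E) (P.kernel σ z x (v x))) := by
  rw [kernel_apply, map_neg, map_smul, P.J_apply_inv, smul_neg, smul_smul, hσ, one_smul, neg_neg]

theorem IsVolterraSolution.integrable_G [FiniteDimensional ℂ E] (hσ : σ * σ = 1)
    (hv : P.IsVolterraSolution r σ z u₀ v) (h : ∀ x, IsUnit (P.side σ z x)) :
    Integrable (fun x => P.G z x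
      (Ring.inverse (P.side σ z x) ((P.J : E →L[ℂ] E) (v x)))) P.μ := by
  simp_rw [G_eq hσ]
  exact (((P.J : E →L[ℂ] E).integrable_comp (hv.integrable h)).smul σ).neg

theorem IsVolterraSolution.J_apply [FiniteDimensional ℂ E] (hσ : σ * σ = 1)
    (hv : P.IsVolterraSolution r σ z u₀ v) (h : ∀ x, IsUnit (P.side σ z x)) (x : ℝ) :
    (P.J : E →L[ℂ] E) (v x) = (P.J : E →L[ℂ] E) u₀ - σ • ∫ y in {y | r y x}, P.G z y
      (Ring.inverse (P.side σ z y) ((P.J : E →L[ℂ] E) (v y))) ∂P.μ := by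
  have : CompleteSpace E := FiniteDimensional.complete ℂ E
  conv_lhs => rw [hv.equation x]
  rw [map_add, ← ContinuousLinearMap.integral_comp_comm _ (hv.integrable h).integrableOn]
  simp_rw [G_eq (P := P) (z := z) (v := v) hσ]
  rw [integral_neg, integral_smul, smul_neg, smul_smul, hσ, one_smul, sub_neg_eq_add]

/-- For u = (side)⁻¹ J v this is the equation side · u = J v, solved for the term J u. -/
theorem IsVolterraSolution.J_apply_inverse (h : ∀ x, IsUnit (P.side σ z x)) (x : ℝ) :
    (P.J : E →L[ℂ] E) (Ring.inverse (P.side σ z x) ((P.J : E →L[ℂ] E) (v x)))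
      = (P.J : E →L[ℂ] E) (v x) - (σ / 2) • P.μ.real {x} • P.G z x
        (Ring.inverse (P.side σ z x) ((P.J : E →L[ℂ] E) (v x))) := by
  have h1 := P.side_apply_inverse (h x) ((P.J : E →L[ℂ] E) (v x))
  have h2 : ∀ e, P.side σ z x e
      = (P.J : E →L[ℂ] E) e + (σ / 2) • P.μ.real {x} • P.G z x e := by
    intro e
    rw [side, add_apply, smul_apply, mul_smul, ← Complex.coe_smul]
  exact eq_sub_of_add_eq ((h2 _).symm.trans h1)

/-- The Volterra equation gives J v as J u₀ minus the integral over `Iio x`. Passing from v to u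
subtracts half the atom at x, which turns this integral into the mean of those over `Iio x` and `Iic
x`. -/
theorem IsVolterraSolution.isPrimitiveSolution_left [FiniteDimensional ℂ E]
    (hv : P.IsVolterraSolution (fun x y => x < y) 1 z u₀ v) (h : ∀ x, IsUnit (P.side 1 z x)) :
    P.IsPrimitiveSolution z (fun x => Ring.inverse (P.side 1 z x) ((P.J : E →L[ℂ] E) (v x)))
      ((P.J : E →L[ℂ] E) u₀) := by
  have : CompleteSpace E := FiniteDimensional.complete ℂ E
  have hi := hv.integrable_G (mul_one 1) h
  refine ⟨hi, fun x => ?_⟩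
  rw [J_apply_inverse h, setIntegral_Iic_eq_add hi]
  generalize P.G z x (Ring.inverse (P.side 1 z x) ((P.J : E →L[ℂ] E) (v x))) = w
  rw [hv.J_apply (mul_one 1) h, one_smul]
  change _ - (∫ y in Iio x, _ ∂P.μ) - _ = _
  simp only [← Complex.coe_smul]
  push_cast
  module

/-- The integral over `Ioi x` is the total integral minus that over `Iic x`; the total integral goes
into the constant, which is J times the value at the left end. -/
theorem IsVolterraSolution.isPrimitiveSolution_right [FiniteDimensional ℂ E]
    (hv : P.IsVolterraSolution (fun x y => y < x) (-1) z u₀ v)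
    (h : ∀ x, IsUnit (P.side (-1) z x)) :
    P.IsPrimitiveSolution z (fun x => Ring.inverse (P.side (-1) z x) ((P.J : E →L[ℂ] E) (v x)))
      ((P.J : E →L[ℂ] E) u₀ + ∫ x, P.G z x
        (Ring.inverse (P.side (-1) z x) ((P.J : E →L[ℂ] E) (v x))) ∂P.μ) := by
  have : CompleteSpace E := FiniteDimensional.complete ℂ E
  have hi := hv.integrable_G (by norm_num) h
  refine ⟨hi, fun x => ?_⟩
  have h1 := integral_add_compl (s := Iic x) measurableSet_Iic hi
  rw [compl_Iic] at h1
  rw [J_apply_inverse h, ← h1, setIntegral_Iic_eq_add hi]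
  generalize P.G z x (Ring.inverse (P.side (-1) z x) ((P.J : E →L[ℂ] E) (v x))) = w
  rw [hv.J_apply (by norm_num) h]
  change _ - (-1 : ℂ) • (∫ y in Ioi x, _ ∂P.μ) - _ = _
  simp only [← Complex.coe_smul]
  push_cast
  module

end Existence

end MeasureSystem

/-! ### Analyticity, meromorphy and endpoint limits -/

theorem analyticOnNhd_and_meromorphic_of_norm_mul_pow_le {E : Type*} [NormedAddCommGroup E]
    [NormedSpace ℂ E] [CompleteSpace E] {f : ℂ → E} {T : Set ℂ} (hTo : IsOpen T)
    (hT : ∀ z₀, ∀ᶠ z in 𝓝[≠] z₀, z ∈ T) (hd : ∀ z ∈ T, DifferentiableAt ℂ f z)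
    (hg : ∀ z₀, ∃ (N : ℕ) (D : ℝ), ∀ᶠ z in 𝓝[≠] z₀, ‖f z‖ * ‖z - z₀‖ ^ N ≤ D) :
    AnalyticOnNhd ℂ f T ∧ Meromorphic f := by
  refine ⟨DifferentiableOn.analyticOnNhd (fun z hz => (hd z hz).differentiableWithinAt) hTo,
    fun z₀ => ?_⟩
  obtain ⟨N, D, h⟩ := hg z₀
  exact meromorphicAt_of_norm_mul_pow_le ((hT z₀).mono hd) h

namespace MeasureSystem

variable {E : Type*} [NormedAddCommGroup E] [NormedSpace ℂ E] [FiniteDimensional ℂ E]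
  {P : MeasureSystem E}

section Analytic

variable {r : ℝ → ℝ → Prop} {σ : ℂ} {T : Set ℂ} {u₀ : E} {v : ℝ → ℂ → E} {f : ℂ → E} {x : ℝ}

theorem analyticOnNhd_and_meromorphic_volterraSolution (hr : MeasurableStrictOrder r)
    (hTo : IsOpen T) (hT : ∀ z₀, ∀ᶠ z in 𝓝[≠] z₀, z ∈ T)
    (hunit : ∀ z ∈ T, ∀ x, IsUnit (P.side σ z x)) (hpol : ∀ x, P.HasPolarInverse σ x)
    (hv : ∀ z ∈ T, P.IsVolterraSolution r σ z u₀ fun x => v x z)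
    (hf : ∀ z ∈ T, f z = v x z) : AnalyticOnNhd ℂ f T ∧ Meromorphic f := by
  have : CompleteSpace E := FiniteDimensional.complete ℂ E
  refine analyticOnNhd_and_meromorphic_of_norm_mul_pow_le hTo hT (fun z hz => ?_) fun z₀ => ?_
  · refine (P.differentiableAt_volterraSolution hr hTo hunit hv x hz).congr_of_eventuallyEq ?_
    filter_upwards [hTo.mem_nhds hz] with z' hz' using hf z' hz'
  · obtain ⟨N, D, h⟩ := P.exists_norm_volterraSolution_le hr hpol hv (hT z₀)
    refine ⟨N, D, ?_⟩
    filter_upwards [h, hT z₀] with z hz hzT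
    rw [hf z hzT]
    exact hz x

/-- Here f is the value of the solution itself, while v is its one-sided limit; the growth exponents
of the inverse and of v add up. -/
theorem analyticOnNhd_and_meromorphic_inverse_side (hr : MeasurableStrictOrder r)
    (hTo : IsOpen T) (hT : ∀ z₀, ∀ᶠ z in 𝓝[≠] z₀, z ∈ T)
    (hunit : ∀ z ∈ T, ∀ x, IsUnit (P.side σ z x)) (hpol : ∀ x, P.HasPolarInverse σ x)
    (hv : ∀ z ∈ T, P.IsVolterraSolution r σ z u₀ fun x => v x z)
    (hf : ∀ z ∈ T, f z = Ring.inverse (P.side σ z x) ((P.J : E →L[ℂ] E) (v x z))) :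
    AnalyticOnNhd ℂ f T ∧ Meromorphic f := by
  have : CompleteSpace E := FiniteDimensional.complete ℂ E
  refine analyticOnNhd_and_meromorphic_of_norm_mul_pow_le hTo hT (fun z hz => ?_) fun z₀ => ?_
  · have h1 := P.differentiableAt_volterraSolution hr hTo hunit hv x hz
    have h2 := P.differentiableAt_inverse_side (hunit z hz x)
    refine (h2.clm_apply ((P.J : E →L[ℂ] E).differentiableAt.comp z h1)).congr_of_eventuallyEq ?_
    filter_upwards [hTo.mem_nhds hz] with z' hz' using hf z' hz'
  · obtain ⟨N, D, h⟩ := P.exists_norm_volterraSolution_le hr hpol hv (hT z₀)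
    obtain ⟨-, N', D', h'⟩ := hpol x z₀
    refine ⟨N' + N, |D'| * (‖(P.J : E →L[ℂ] E)‖ * |D|), ?_⟩
    filter_upwards [h, hT z₀, h'] with z hz hzT hz'
    have hb := (hz x).trans (le_abs_self D)
    have hb' := hz'.trans (le_abs_self D')
    rw [hf z hzT]
    calc _ ≤ ‖Ring.inverse (P.side σ z x)‖ * (‖(P.J : E →L[ℂ] E)‖ * ‖v x z‖)
          * ‖z - z₀‖ ^ (N' + N) := by
          gcongr
          refine (ContinuousLinearMap.le_opNorm _ _).trans ?_
          gcongr
          exact ContinuousLinearMap.le_opNorm _ _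
      _ = (‖Ring.inverse (P.side σ z x)‖ * ‖z - z₀‖ ^ N')
          * (‖(P.J : E →L[ℂ] E)‖ * (‖v x z‖ * ‖z - z₀‖ ^ N)) := by rw [pow_add]; ring
      _ ≤ _ := by gcongr

end Analytic

theorem isOpen_forall_isUnit_side (σ : ℂ) : IsOpen {z | ∀ x, IsUnit (P.side σ z x)} := by
  have : CompleteSpace E := FiniteDimensional.complete ℂ E
  refine isOpen_iff_mem_nhds.2 fun z hz => ?_
  obtain ⟨U, hUo, hzU, -, C, hC⟩ := P.exists_isOpen_norm_inverse_side_le hz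
  filter_upwards [hUo.mem_nhds hzU] with z' hz' x using (hC z' hz' x).1

section Limits

variable {s t : ℝ} {z : ℂ} {u₀ : E} {v : ℝ → E}

/-- No mass of μ lies in `Iic s`, so the right limit at s of the primitive is its constant J u₀. -/
theorem tendsto_left_endpoint_of_left (hμ : P.μ (Ioo s t)ᶜ = 0)
    (hv : P.IsVolterraSolution (fun x y => x < y) 1 z u₀ v) (h : ∀ x, IsUnit (P.side 1 z x)) :
    Tendsto (fun x => Ring.inverse (P.side 1 z x) ((P.J : E →L[ℂ] E) (v x))) (𝓝[>] s)
      (𝓝 u₀) := by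
  have h1 := (hv.isPrimitiveSolution_left h).tendsto_right s
  rwa [setIntegral_measure_zero (s := Iic s) _
    (measure_mono_null (fun y (hy : y ≤ s) (hy' : y ∈ Ioo s t) => hy'.1.not_ge hy) hμ),
    sub_zero, P.J_inv_apply] at h1

/-- The Volterra solution lives on all of ℝ, and its equation at t is the formula for the left limit
there. The endpoint limit thus inherits its dependence on z from v. -/
theorem tendsto_right_endpoint_of_left
    (hv : P.IsVolterraSolution (fun x y => x < y) 1 z u₀ v) (h : ∀ x, IsUnit (P.side 1 z x)) :
    Tendsto (fun x => Ring.inverse (P.side 1 z x) ((P.J : E →L[ℂ] E) (v x))) (𝓝[<] t)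
      (𝓝 (v t)) := by
  have h1 := (hv.isPrimitiveSolution_left h).tendsto_left t
  have h2 := hv.J_apply (mul_one 1) h t
  rw [one_smul] at h2
  change _ = _ - ∫ y in Iio t, _ ∂P.μ at h2
  rwa [← h2, P.J_inv_apply] at h1

theorem tendsto_right_endpoint_of_right (hμ : P.μ (Ioo s t)ᶜ = 0)
    (hv : P.IsVolterraSolution (fun x y => y < x) (-1) z u₀ v)
    (h : ∀ x, IsUnit (P.side (-1) z x)) :
    Tendsto (fun x => Ring.inverse (P.side (-1) z x) ((P.J : E →L[ℂ] E) (v x))) (𝓝[<] t)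
      (𝓝 u₀) := by
  have h0 := hv.isPrimitiveSolution_right h
  have h1 := h0.tendsto_left t
  have h2 := integral_add_compl (s := Iio t) measurableSet_Iio h0.integrable
  rw [setIntegral_measure_zero (s := (Iio t)ᶜ) _
    (measure_mono_null (fun y hy (hy' : y ∈ Ioo s t) => hy hy'.2) hμ), add_zero] at h2
  rwa [h2, add_sub_cancel_right, P.J_inv_apply] at h1

theorem tendsto_left_endpoint_of_right
    (hv : P.IsVolterraSolution (fun x y => y < x) (-1) z u₀ v)
    (h : ∀ x, IsUnit (P.side (-1) z x)) :
    Tendsto (fun x => Ring.inverse (P.side (-1) z x) ((P.J : E →L[ℂ] E) (v x))) (𝓝[>] s)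
      (𝓝 (v s)) := by
  have h0 := hv.isPrimitiveSolution_right h
  have h1 := h0.tendsto_right s
  have h2 := hv.J_apply (by norm_num) h s
  have h3 := integral_add_compl (s := Iic s) measurableSet_Iic h0.integrable
  rw [compl_Iic] at h3
  rw [neg_one_smul, sub_neg_eq_add] at h2
  change _ = _ + ∫ y in Ioi s, _ ∂P.μ at h2
  rwa [← h3, ← add_sub_assoc', add_sub_cancel_left, ← h2, P.J_inv_apply] at h1

end Limits

end MeasureSystem

/-! ### Matrices as operators and inverses of entire matrix functions -/

section MatrixCLM

variable {n : ℕ}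

/-- Matrices as continuous operators on `ℂⁿ`. -/
noncomputable def matrixCLM :
    Matrix (Fin n) (Fin n) ℂ ≃ₐ[ℂ] ((Fin n → ℂ) →L[ℂ] (Fin n → ℂ)) :=
  Matrix.toLinAlgEquiv'.trans (Module.End.toContinuousLinearMap _)

theorem matrixCLM_apply (M : Matrix (Fin n) (Fin n) ℂ) (e : Fin n → ℂ) (i : Fin n) :
    matrixCLM M e i = ∑ j, M i j * e j := rfl

theorem isUnit_matrixCLM_iff (M : Matrix (Fin n) (Fin n) ℂ) :
    IsUnit (matrixCLM M) ↔ M.det ≠ 0 := by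
  rw [isUnit_map_iff, Matrix.isUnit_iff_isUnit_det, isUnit_iff_ne_zero]

theorem inverse_matrixCLM {M : Matrix (Fin n) (Fin n) ℂ} (hM : M.det ≠ 0) :
    Ring.inverse (matrixCLM M) = M.det⁻¹ • matrixCLM M.adjugate := by
  have h := (isUnit_matrixCLM_iff M).2 hM
  rw [← mul_one (Ring.inverse _), Ring.inverse_mul_eq_iff_eq_mul _ _ _ h, ← map_smul, ← map_mul,
    Matrix.mul_smul, Matrix.mul_adjugate, smul_smul, inv_mul_cancel₀ hM, one_smul, map_one]

theorem differentiable_det {M : ℂ → Matrix (Fin n) (Fin n) ℂ}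
    (hM : ∀ i j, Differentiable ℂ fun z => M z i j) : Differentiable ℂ fun z => (M z).det := by
  simp_rw [Matrix.det_apply]
  fun_prop

/-- The inverse of an entire matrix function with nontrivial determinant has only poles. -/
theorem exists_norm_inverse_matrixCLM_le {M : ℂ → Matrix (Fin n) (Fin n) ℂ}
    (hM : ∀ i j, Differentiable ℂ fun z => M z i j) {z₁ : ℂ} (h₁ : (M z₁).det ≠ 0) (z₀ : ℂ) :
    (∀ᶠ z in 𝓝[≠] z₀, (M z).det ≠ 0) ∧
      ∃ (N : ℕ) (D : ℝ), ∀ᶠ z in 𝓝[≠] z₀, ‖Ring.inverse (matrixCLM (M z))‖ * ‖z - z₀‖ ^ N ≤ D := by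
  have hdet := differentiable_det hM
  have han : AnalyticOnNhd ℂ (fun z => (M z).det) univ := fun z _ => hdet.analyticAt z
  -- Identity theorem: the determinant is entire and nonzero at z₁, so it cannot vanish identically
  -- near any point.
  have hne : ¬ ∀ᶠ z in 𝓝 z₀, (M z).det = 0 := fun h =>
    h₁ (han.eqOn_zero_of_preconnected_of_eventuallyEq_zero isPreconnected_univ (mem_univ z₀) h
      (mem_univ z₁))
  have hev : ∀ᶠ z in 𝓝[≠] z₀, (M z).det ≠ 0 :=
    (hdet.analyticAt z₀).eventually_eq_zero_or_eventually_ne_zero.resolve_left hne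
  refine ⟨hev, ?_⟩
  -- Write det = (z - z₀)^N g with g(z₀) ≠ 0. By Cramer's rule the inverse is the continuous
  -- adjugate divided by this, so N bounds the order of the pole.
  obtain ⟨N, g, hg, hg0, hgd⟩ :=
    (hdet.analyticAt z₀).exists_eventuallyEq_pow_smul_nonzero_iff.2 hne
  have hcM : Continuous M := continuous_matrix fun i j => (hM i j).continuous
  have hadj : Continuous fun z => matrixCLM (M z).adjugate :=
    (LinearMap.continuous_of_finiteDimensional (matrixCLM (n := n)).toLinearMap).comp
      hcM.matrix_adjugate
  have hlim : ContinuousAt (fun z => ‖(g z)⁻¹‖ * ‖matrixCLM (M z).adjugate‖) z₀ :=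
    (hg.continuousAt.inv₀ hg0).norm.mul hadj.continuousAt.norm
  refine ⟨N, ‖(g z₀)⁻¹‖ * ‖matrixCLM (M z₀).adjugate‖ + 1, ?_⟩
  filter_upwards [hev, hgd.filter_mono nhdsWithin_le_nhds, self_mem_nhdsWithin,
    (hlim.eventually (Iic_mem_nhds (lt_add_one _))).filter_mono nhdsWithin_le_nhds]
    with z hz hgz hzne hz'
  refine le_trans (le_of_eq ?_) (mem_Iic.1 hz')
  have h2 : ‖z - z₀‖ ^ N ≠ 0 := pow_ne_zero _ (norm_ne_zero_iff.2 (sub_ne_zero.2 hzne))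
  rw [inverse_matrixCLM hz, hgz, norm_smul, norm_inv, norm_smul, norm_pow, norm_inv]
  field_simp

theorem integrable_sum_sum_smul {X ι κ F : Type*} [Fintype ι] [Fintype κ] [NormedAddCommGroup F]
    [NormedSpace ℂ F] {m : MeasurableSpace X} {μ : Measure X} {q : ι → κ → X → ℂ}
    (hq : ∀ i j, Integrable (q i j) μ) (L : ι → κ → F) :
    Integrable (fun x => ∑ i, ∑ j, q i j x • L i j) μ :=
  integrable_finsetSum _ fun i _ => integrable_finsetSum _ fun j _ => (hq i j).smul_const _

theorem integrable_matrixCLM {X : Type*} {m : MeasurableSpace X} {μ : Measure X}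
    {q : Fin n → Fin n → X → ℂ} (hq : ∀ i j, Integrable (q i j) μ) :
    Integrable (fun x => matrixCLM (Matrix.of fun i j => q i j x)) μ := by
  have h : ∀ x, matrixCLM (Matrix.of fun i j => q i j x)
      = ∑ i, ∑ j, q i j x • matrixCLM (Matrix.single i j (1 : ℂ)) := by
    intro x
    conv_lhs => rw [Matrix.matrix_eq_sum_single (Matrix.of fun i j => q i j x)]
    rw [map_sum]
    refine Finset.sum_congr rfl fun i _ => ?_
    rw [map_sum]
    refine Finset.sum_congr rfl fun j _ => ?_
    rw [← map_smul, Matrix.smul_single, smul_eq_mul, mul_one, Matrix.of_apply]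
  refine Integrable.congr ?_ (Eventually.of_forall fun x => (h x).symm)
  exact integrable_sum_sum_smul hq _

end MatrixCLM

/-! ### Densities of the Stieltjes measures, and test products -/

/-- On `(s, t)`, the function `ρ` is a density of the measure `df` with respect to `μ`. -/
structure IsDensity (μ : Measure ℝ) (f : ℝ → ℂ) (s t : ℝ) (ρ : ℝ → ℂ) : Prop where
  integrable : Integrable ρ μ
  jump : ∀ x ∈ Ioo s t,
    (μ.real {x} : ℂ) * ρ x = Function.rightLim f x - Function.leftLim f x
  integral_eq : ∀ (h : ℝ → ℂ) (C : ℝ), (∀ ν : Measure ℝ, AEStronglyMeasurable h ν) →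
    (∀ x, ‖h x‖ ≤ C) → Function.support h ⊆ Ioo s t →
    (stieltjes f s t).integral h (ContinuousLinearMap.mul ℝ ℂ) = ∫ x, h x * ρ x ∂μ

/-- Restricting to (s,t) discards possible point masses of the clamped function at s and t;
functions supported in (s,t) do not see them. -/
theorem isDensity_restrict {m : Measure ℝ} [IsFiniteMeasure m] {f ρ : ℝ → ℂ} {s t : ℝ}
    (hst : s ≤ t) (hf : LocallyBoundedVariationOn f (Icc s t)) (hρ : Integrable ρ m)
    (hd : m.withDensityᵥ ρ = stieltjes f s t) : IsDensity (m.restrict (Ioo s t)) f s t ρ := by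
  refine ⟨hρ.restrict, fun x hx => ?_, fun h C hm hC hs => ?_⟩
  · rw [← stieltjes_singleton hst hf hx, ← hd, withDensityᵥ_apply hρ (measurableSet_singleton x),
      integral_singleton, Complex.real_smul, measureReal_restrict_apply (measurableSet_singleton x),
      inter_eq_left.2 (singleton_subset_iff.2 hx)]
  · have : IsFiniteMeasure (m.withDensity fun x => ‖ρ x‖ₑ) := ⟨by
      rw [withDensity_apply _ MeasurableSet.univ, setLIntegral_univ]; exact hρ.2⟩
    rw [← hd, integral_withDensityᵥ_mul hρ
      (Integrable.of_bound (hm _) C (Eventually.of_forall hC))]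
    refine (setIntegral_eq_integral_of_forall_compl_eq_zero fun x hx => ?_).symm
    rw [Function.notMem_support.1 fun h' => hx (hs h'), zero_mul]

theorem exists_isDensity {n : ℕ} {Q W : ℝ → Matrix (Fin n) (Fin n) ℂ} {s t : ℝ} (hst : s ≤ t)
    (hQ : ∀ i j, LocallyBoundedVariationOn (fun x => Q x i j) (Icc s t))
    (hW : ∀ i j, LocallyBoundedVariationOn (fun x => W x i j) (Icc s t)) :
    ∃ (μ : Measure ℝ) (q w : Fin n → Fin n → ℝ → ℂ), IsFiniteMeasure μ ∧ μ (Ioo s t)ᶜ = 0 ∧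
      (∀ i j, IsDensity μ (fun x => Q x i j) s t (q i j)) ∧
      ∀ i j, IsDensity μ (fun x => W x i j) s t (w i j) := by
  obtain ⟨m, f, hm, hf⟩ := exists_common_density
    (Sum.elim (fun p : Fin n × Fin n => stieltjes (fun x => Q x p.1 p.2) s t)
      fun p : Fin n × Fin n => stieltjes (fun x => W x p.1 p.2) s t)
  refine ⟨m.restrict (Ioo s t), fun i j => f (Sum.inl (i, j)), fun i j => f (Sum.inr (i, j)),
    inferInstance, ?_, fun i j => ?_, fun i j => ?_⟩
  · rw [Measure.restrict_apply measurableSet_Ioo.compl, compl_inter_self, measure_empty]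
  · exact isDensity_restrict hst (hQ i j) (hf (Sum.inl (i, j))).1 (hf (Sum.inl (i, j))).2
  · exact isDensity_restrict hst (hW i j) (hf (Sum.inr (i, j))).1 (hf (Sum.inr (i, j))).2

theorem exists_subset_Icc_of_isCompact {K : Set ℝ} (hK : IsCompact K) {s t : ℝ} (hst : s < t)
    (hKs : K ⊆ Ioo s t) : ∃ c d, s < c ∧ c ≤ d ∧ d < t ∧ K ⊆ Icc c d := by
  rcases K.eq_empty_or_nonempty with rfl | hne
  · obtain ⟨c, hc⟩ := exists_between hst
    exact ⟨c, c, hc.1, le_rfl, hc.2, empty_subset _⟩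
  · obtain ⟨c, hc⟩ := hK.exists_isLeast hne
    obtain ⟨d, hd⟩ := hK.exists_isGreatest hne
    exact ⟨c, d, (hKs hc.1).1, hc.2 hd.1, (hKs hd.1).2, fun x hx => ⟨hc.2 hx, hd.2 hx⟩⟩

/-- Nothing is known about u outside (s,t), but the product with φ vanishes there. -/
theorem aestronglyMeasurable_test_mul {φ : ℝ → ℝ} {u : ℝ → ℂ} {s t : ℝ} (hφ : Continuous φ)
    (hs : tsupport φ ⊆ Ioo s t) (hu : LocallyBoundedVariationOn u (Ioo s t)) (ν : Measure ℝ) :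
    AEStronglyMeasurable (fun x => (φ x : ℂ) * u x) ν := by
  have h : (Ioo s t).indicator (fun x => (φ x : ℂ) * u x) = fun x => (φ x : ℂ) * u x := by
    rw [indicator_eq_self]
    intro x hx
    refine hs (subset_tsupport φ fun h0 => hx ?_)
    simp [h0]
  rw [← h, aestronglyMeasurable_indicator_iff measurableSet_Ioo]
  exact (Complex.continuous_ofReal.comp hφ).aestronglyMeasurable.mul
    (aestronglyMeasurable_of_locallyBoundedVariationOn measurableSet_Ioo hu ν)

theorem exists_norm_test_mul_le {φ : ℝ → ℝ} {u : ℝ → ℂ} {s t : ℝ} (hst : s < t)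
    (hφ : Continuous φ) (hc : HasCompactSupport φ) (hs : tsupport φ ⊆ Ioo s t)
    (hu : LocallyBoundedVariationOn u (Ioo s t)) : ∃ C, ∀ x, ‖(φ x : ℂ) * u x‖ ≤ C := by
  obtain ⟨c, d, hsc, hcd, hdt, hK⟩ := exists_subset_Icc_of_isCompact hc hst hs
  obtain ⟨M, hM⟩ := exists_norm_le_of_locallyBoundedVariationOn hu (c := c) (d := d)
    ⟨hsc, hcd.trans_lt hdt⟩ ⟨hsc.trans_le hcd, hdt⟩
    fun x hx => ⟨hsc.trans_le hx.1, hx.2.trans_lt hdt⟩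
  obtain ⟨C, hC⟩ := hφ.bounded_above_of_compact_support hc
  refine ⟨C * |M|, fun x => ?_⟩
  have hC0 := (norm_nonneg _).trans (hC x)
  by_cases hx : x ∈ tsupport φ
  · rw [norm_mul, Complex.norm_real]
    exact mul_le_mul (hC x) ((hM x (hK hx)).trans (le_abs_self M)) (norm_nonneg _) hC0
  · rw [image_eq_zero_of_notMem_tsupport hx, Complex.ofReal_zero, zero_mul, norm_zero]
    positivity

theorem integrable_test_mul {φ : ℝ → ℝ} {u : ℝ → ℂ} {s t : ℝ} (hst : s < t)
    (hφ : Continuous φ) (hc : HasCompactSupport φ) (hs : tsupport φ ⊆ Ioo s t)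
    (hu : LocallyBoundedVariationOn u (Ioo s t)) : Integrable fun x => (φ x : ℂ) * u x := by
  obtain ⟨C, hC⟩ := exists_norm_test_mul_le hst hφ hc hs hu
  rw [← integrableOn_iff_integrable_of_support_subset (s := tsupport φ)]
  · exact Measure.integrableOn_of_bounded hc.measure_lt_top.ne
      (aestronglyMeasurable_test_mul hφ hs hu volume) (Eventually.of_forall hC)
  · refine fun x hx => subset_tsupport φ fun h0 => hx ?_
    simp [h0]

/-! ### Translation between the matrix problem and the operator system -/

namespace MeasureSystem

variable {n : ℕ}

/-- The coefficients of the system `P` are densities of the measures `dQ` and `dW`. -/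
structure Represents (P : MeasureSystem (Fin n → ℂ)) (J : Matrix (Fin n) (Fin n) ℂ)
    (Q W : ℝ → Matrix (Fin n) (Fin n) ℂ) (s t : ℝ) (q w : Fin n → Fin n → ℝ → ℂ) : Prop where
  null : P.μ (Ioo s t)ᶜ = 0
  J_eq : (P.J : (Fin n → ℂ) →L[ℂ] (Fin n → ℂ)) = matrixCLM J
  A_eq : ∀ x, P.A x = matrixCLM (Matrix.of fun i j => q i j x)
  B_eq : ∀ x, P.B x = matrixCLM (Matrix.of fun i j => w i j x)
  density_left : ∀ i j, IsDensity P.μ (fun x => Q x i j) s t (q i j)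
  density_right : ∀ i j, IsDensity P.μ (fun x => W x i j) s t (w i j)

theorem exists_represents {J : Matrix (Fin n) (Fin n) ℂ} (hJ : IsUnit J)
    {Q W : ℝ → Matrix (Fin n) (Fin n) ℂ} {s t : ℝ} (hst : s ≤ t)
    (hQ : ∀ i j, LocallyBoundedVariationOn (fun x => Q x i j) (Icc s t))
    (hW : ∀ i j, LocallyBoundedVariationOn (fun x => W x i j) (Icc s t)) :
    ∃ (P : MeasureSystem (Fin n → ℂ)) (q w : Fin n → Fin n → ℝ → ℂ),
      P.Represents J Q W s t q w := by
  obtain ⟨μ, q, w, hμ, hnull, hq, hw⟩ := exists_isDensity hst hQ hW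
  obtain ⟨U, rfl⟩ := hJ
  exact ⟨⟨μ, hμ, Units.map (matrixCLM (n := n)).toMonoidHom U, _, _,
    integrable_matrixCLM fun i j => (hq i j).integrable,
    integrable_matrixCLM fun i j => (hw i j).integrable⟩, q, w,
    ⟨hnull, rfl, fun _ => rfl, fun _ => rfl, hq, hw⟩⟩

namespace Represents

variable {P : MeasureSystem (Fin n → ℂ)} {J : Matrix (Fin n) (Fin n) ℂ}
  {Q W : ℝ → Matrix (Fin n) (Fin n) ℂ} {s t : ℝ} {q w : Fin n → Fin n → ℝ → ℂ} {x : ℝ}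

/-- The mass μ{x} times the density at x is the jump, so the abstract operators are those given by
B₊ and B₋. -/
theorem side_eq (h : P.Represents J Q W s t q w) (hx : x ∈ Ioo s t) (σ z : ℂ) :
    P.side σ z x = matrixCLM (J + (σ / 2) • (jump Q x - z • jump W x)) := by
  rw [side, G, h.J_eq, h.A_eq, h.B_eq, ← map_smul, ← map_sub, ← map_smul, ← map_add]
  congr 2
  ext i j
  simp only [Matrix.smul_apply, Matrix.sub_apply, Matrix.of_apply, jump, smul_eq_mul,
    ← (h.density_left i j).jump x hx, ← (h.density_right i j).jump x hx]
  ring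

theorem side_one (h : P.Represents J Q W s t q w) (hx : x ∈ Ioo s t) (z : ℂ) :
    P.side 1 z x = matrixCLM (Bplus J Q W x z) := h.side_eq hx 1 z

theorem side_neg_one (h : P.Represents J Q W s t q w) (hx : x ∈ Ioo s t) (z : ℂ) :
    P.side (-1) z x = matrixCLM (Bminus J Q W x z) := by
  rw [h.side_eq hx, Bminus, neg_div, neg_smul, ← sub_eq_add_neg]

theorem side_of_notMem (h : P.Represents J Q W s t q w) (hx : x ∉ Ioo s t) (σ z : ℂ) :
    P.side σ z x = P.J := by
  have : P.μ {x} = 0 := measure_mono_null (singleton_subset_iff.2 hx) h.null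
  simp [side, measureReal_def, this]

/-- Outside (s,t) there are no atoms and the operator is J, so quantifying over all real x adds no
condition. -/
theorem notMem_LambdaIoo_iff (h : P.Represents J Q W s t q w) {z : ℂ} :
    z ∉ LambdaIoo J Q W s t
      ↔ (∀ x, IsUnit (P.side 1 z x)) ∧ ∀ x, IsUnit (P.side (-1) z x) := by
  simp only [LambdaIoo, LambdaAt, mem_iUnion, mem_ofPred_eq, not_exists, mul_eq_zero, not_or]
  constructor
  · intro hz
    refine ⟨fun x => ?_, fun x => ?_⟩ <;> by_cases hx : x ∈ Ioo s t
    · rw [h.side_one hx, isUnit_matrixCLM_iff]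
      exact (hz x hx).1
    · rw [h.side_of_notMem hx]
      exact P.J.isUnit
    · rw [h.side_neg_one hx, isUnit_matrixCLM_iff]
      exact (hz x hx).2
    · rw [h.side_of_notMem hx]
      exact P.J.isUnit
  · intro hz x hx
    have h1 := hz.1 x
    have h2 := hz.2 x
    rw [h.side_one hx, isUnit_matrixCLM_iff] at h1
    rw [h.side_neg_one hx, isUnit_matrixCLM_iff] at h2
    exact ⟨h1, h2⟩

theorem compl_LambdaIoo (h : P.Represents J Q W s t q w) :
    (LambdaIoo J Q W s t)ᶜ
      = {z | ∀ x, IsUnit (P.side 1 z x)} ∩ {z | ∀ x, IsUnit (P.side (-1) z x)} := by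
  ext z
  exact h.notMem_LambdaIoo_iff

theorem isOpen_compl_LambdaIoo (h : P.Represents J Q W s t q w) :
    IsOpen (LambdaIoo J Q W s t)ᶜ := by
  rw [h.compl_LambdaIoo]
  exact (isOpen_forall_isUnit_side _).inter (isOpen_forall_isUnit_side _)

/-- The point z = 0, where the determinant is nonzero by hypothesis, keeps it from vanishing
identically in z. -/
theorem hasPolarInverse (h : P.Represents J Q W s t q w) {σ : ℂ}
    (h0 : ∀ x ∈ Ioo s t, (J + (σ / 2) • (jump Q x - (0 : ℂ) • jump W x)).det ≠ 0) (x : ℝ) :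
    P.HasPolarInverse σ x := by
  intro z₀
  by_cases hx : x ∈ Ioo s t
  · simp_rw [h.side_eq hx, isUnit_matrixCLM_iff]
    refine exists_norm_inverse_matrixCLM_le
      (M := fun z => J + (σ / 2) • (jump Q x - z • jump W x)) (fun i j => ?_) (h0 x hx) z₀
    simp only [Matrix.add_apply, Matrix.smul_apply, Matrix.sub_apply, smul_eq_mul]
    fun_prop
  · simp_rw [h.side_of_notMem hx]
    exact ⟨Eventually.of_forall fun _ => P.J.isUnit, 0,
      ‖Ring.inverse (P.J : (Fin n → ℂ) →L[ℂ] (Fin n → ℂ))‖,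
      Eventually.of_forall fun z => by rw [pow_zero, mul_one]⟩

/-- Every z₀ has a punctured neighbourhood free of Λ, so Λ is closed and discrete. -/
theorem eventually_notMem_LambdaIoo (h : P.Represents J Q W s t q w)
    (h1 : ∀ x, P.HasPolarInverse 1 x) (h2 : ∀ x, P.HasPolarInverse (-1) x) (z₀ : ℂ) :
    ∀ᶠ z in 𝓝[≠] z₀, z ∈ (LambdaIoo J Q W s t)ᶜ := by
  filter_upwards [(P.eventually_norm_inverse_side_le h1 z₀).1,
    (P.eventually_norm_inverse_side_le h2 z₀).1] with z hz hz'
  exact h.notMem_LambdaIoo_iff.2 ⟨hz, hz'⟩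

/-- The weak formulations in terms of densities and of Stieltjes measures agree. -/
theorem test_iff (h : P.Represents J Q W s t q w) (hst : s < t) {z : ℂ} {u : ℝ → Fin n → ℂ}
    (hu : ∀ i, LocallyBoundedVariationOn (fun x => u x i) (Ioo s t)) {φ : ℝ → ℝ}
    (hφ : ContDiff ℝ 1 φ) (hc : HasCompactSupport φ) (hs : tsupport φ ⊆ Ioo s t) :
    ∫ x, deriv φ x • (P.J : (Fin n → ℂ) →L[ℂ] (Fin n → ℂ)) (u x)
        = ∫ x, φ x • P.G z x (u x) ∂P.μ ↔
      ∀ i, ∑ j, J i j * distDeriv (fun x => u x j) φ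
          + ∑ j, mulPairing (fun x => Q x i j) (fun x => u x j) s t φ
        = z * ∑ j, mulPairing (fun x => W x i j) (fun x => u x j) s t φ := by
  have hd := hφ.continuous_deriv le_rfl
  have hds : tsupport (deriv φ) ⊆ Ioo s t := tsupport_deriv_subset.trans hs
  have i1 : ∀ j, Integrable fun x => ((deriv φ x : ℝ) : ℂ) * u x j := fun j =>
    integrable_test_mul hst hd hc.deriv hds (hu j)
  have hsupp : ∀ j, Function.support (fun x => (φ x : ℂ) * u x j) ⊆ Ioo s t := by
    refine fun j x hx => hs (subset_tsupport φ fun h0 => hx ?_)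
    simp [h0]
  have hm : ∀ j ν, AEStronglyMeasurable (fun x => (φ x : ℂ) * u x j) ν := fun j ν =>
    aestronglyMeasurable_test_mul hφ.continuous hs (hu j) ν
  have hb : ∀ j, ∃ C, ∀ x, ‖(φ x : ℂ) * u x j‖ ≤ C := fun j =>
    exists_norm_test_mul_le hst hφ.continuous hc hs (hu j)
  have hden : ∀ {f ρ}, IsDensity P.μ f s t ρ → ∀ j,
      Integrable (fun x => (φ x : ℂ) * u x j * ρ x) P.μ ∧
        mulPairing f (fun x => u x j) s t φ = ∫ x, (φ x : ℂ) * u x j * ρ x ∂P.μ := by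
    intro f ρ hρ j
    obtain ⟨C, hC⟩ := hb j
    exact ⟨hρ.integrable.bdd_mul (hm j _) (Eventually.of_forall hC),
      hρ.integral_eq _ C (hm j) hC (hsupp j)⟩
  have e1 : ∀ i x, (deriv φ x • (P.J : (Fin n → ℂ) →L[ℂ] (Fin n → ℂ)) (u x)) i
      = ∑ j, J i j * (((deriv φ x : ℝ) : ℂ) * u x j) := by
    intro i x
    rw [h.J_eq, Pi.smul_apply, matrixCLM_apply, Complex.real_smul, Finset.mul_sum]
    exact Finset.sum_congr rfl fun j _ => by ring
  have e2 : ∀ i x, (φ x • P.G z x (u x)) i = ∑ j, (φ x : ℂ) * u x j * q i j x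
      - z * ∑ j, (φ x : ℂ) * u x j * w i j x := by
    intro i x
    rw [G, h.A_eq, h.B_eq, Pi.smul_apply, sub_apply, smul_apply, Pi.sub_apply, Pi.smul_apply,
      matrixCLM_apply, matrixCLM_apply, Complex.real_smul, smul_eq_mul, mul_sub, mul_left_comm,
      Finset.mul_sum, Finset.mul_sum]
    congr 1
    · exact Finset.sum_congr rfl fun j _ => by rw [Matrix.of_apply]; ring
    · exact congrArg _ (Finset.sum_congr rfl fun j _ => by rw [Matrix.of_apply]; ring)
  have j1 : ∀ i, Integrable fun x =>
      (deriv φ x • (P.J : (Fin n → ℂ) →L[ℂ] (Fin n → ℂ)) (u x)) i := by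
    intro i
    simp_rw [e1]
    exact integrable_finsetSum _ fun j _ => (i1 j).const_mul _
  have k1 : ∀ i, Integrable (fun x => ∑ j, (φ x : ℂ) * u x j * q i j x) P.μ := fun i =>
    integrable_finsetSum _ fun j _ => (hden (h.density_left i j) j).1
  have k2 : ∀ i, Integrable (fun x => ∑ j, (φ x : ℂ) * u x j * w i j x) P.μ := fun i =>
    integrable_finsetSum _ fun j _ => (hden (h.density_right i j) j).1
  have j2 : ∀ i, Integrable (fun x => (φ x • P.G z x (u x)) i) P.μ := by
    intro i
    simp_rw [e2]
    exact (k1 i).sub ((k2 i).const_mul z)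
  rw [funext_iff]
  refine forall_congr' fun i => ?_
  rw [eval_integral j1, eval_integral j2]
  simp_rw [e1, e2]
  rw [integral_finsetSum _ fun j _ => (i1 j).const_mul _, integral_sub (k1 i) ((k2 i).const_mul z),
    integral_const_mul, integral_finsetSum _ fun j _ => (hden (h.density_left i j) j).1,
    integral_finsetSum _ fun j _ => (hden (h.density_right i j) j).1]
  simp_rw [integral_const_mul, fun j => (hden (h.density_left i j) j).2,
    fun j => (hden (h.density_right i j) j).2, distDeriv, mul_neg, Finset.sum_neg_distrib]
  -- The sign comes from the minus in `distDeriv`: the weak form moves J u' to the other side.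
  constructor <;> intro h' <;> linear_combination -h'

end Represents

end MeasureSystem

/-! ### Balanced solutions and solutions of the system -/

namespace MeasureSystem.Represents

variable {n : ℕ} {P : MeasureSystem (Fin n → ℂ)} {J : Matrix (Fin n) (Fin n) ℂ}
  {Q W : ℝ → Matrix (Fin n) (Fin n) ℂ} {s t : ℝ} {q w : Fin n → Fin n → ℝ → ℂ} {z : ℂ}

theorem isWeakSolution (h : P.Represents J Q W s t q w) (hst : s < t) {u : ℝ → Fin n → ℂ}
    (hu : IsBalancedSolution J Q W s t z u) :
    P.IsWeakSolution s t z u (fun x i => Function.leftLim (fun y => u y i) x)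
      fun x i => Function.rightLim (fun y => u y i) x := by
  refine ⟨fun ν => ?_, fun c d hc hd => ?_, fun x hx => ?_, fun x hx => ?_, fun x hx => ?_,
    fun φ hφ hφc hφs => ?_⟩
  · exact (aemeasurable_pi_lambda _ fun i =>
      (aestronglyMeasurable_of_locallyBoundedVariationOn measurableSet_Ioo
        (hu.locallyBV i) ν).aemeasurable).aestronglyMeasurable
  · rcases lt_or_ge d c with hdc | hcd
    · exact ⟨0, fun x hx => absurd (hx.1.trans hx.2) hdc.not_ge⟩
    · choose M hM using fun i => exists_norm_le_of_locallyBoundedVariationOn (hu.locallyBV i)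
        (c := c) (d := d) ⟨hc, hcd.trans_lt hd⟩ ⟨hc.trans_le hcd, hd⟩
        fun x hx => ⟨hc.trans_le hx.1, hx.2.trans_lt hd⟩
      refine ⟨∑ i, |M i|, fun x hx => ?_⟩
      refine (pi_norm_le_iff_of_nonneg (Finset.sum_nonneg fun i _ => abs_nonneg _)).2 fun i => ?_
      exact ((hM i x hx).trans (le_abs_self _)).trans
        (Finset.single_le_sum (f := fun i => |M i|) (fun i _ => abs_nonneg _) (Finset.mem_univ i))
  · exact tendsto_pi_nhds.2 fun i => (exists_tendsto_of_locallyBoundedVariationOn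
      (hu.locallyBV i) hx).1
  · exact tendsto_pi_nhds.2 fun i => (exists_tendsto_of_locallyBoundedVariationOn
      (hu.locallyBV i) hx).2
  · ext i
    rw [hu.balanced x hx i, Pi.smul_apply, Pi.add_apply, smul_eq_mul]
    ring
  · exact (h.test_iff hst hu.locallyBV (hφ.of_le (mod_cast le_top)) hφc hφs).2
      (hu.equation ⟨φ, hφ, hφc, hφs⟩)

theorem isBalancedSolution (h : P.Represents J Q W s t q w) (hst : s < t) {u : ℝ → Fin n → ℂ}
    {c₀ : Fin n → ℂ} (hu : P.IsPrimitiveSolution z u c₀) :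
    IsBalancedSolution J Q W s t z u := by
  have hbv : ∀ i, LocallyBoundedVariationOn (fun x => u x i) (Ioo s t) := by
    obtain ⟨N, hN⟩ := hu.exists_dist_le
    exact fun i => locallyBoundedVariationOn_of_dist_le
      (fun x y hxy => (dist_le_pi_dist (u y) (u x) i).trans (hN x y hxy)) _
  refine ⟨hbv, fun x _ i => ?_, fun φ => ?_⟩
  · rw [rightLim_eq_of_tendsto (tendsto_pi_nhds.1 (hu.tendsto_right x) i),
      leftLim_eq_of_tendsto (tendsto_pi_nhds.1 (hu.tendsto_left x) i)]
    conv_lhs => rw [hu.balanced x]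
    rw [Pi.smul_apply, Pi.add_apply, smul_eq_mul]
    ring
  · have hφ : ContDiff ℝ 1 φ := φ.contDiff.of_le (mod_cast le_top)
    exact (h.test_iff hst hbv hφ φ.hasCompactSupport φ.tsupport_subset).1
      (hu.test hφ φ.hasCompactSupport)

variable {u₀ : Fin n → ℂ} {v : ℝ → Fin n → ℂ} {u : ℝ → Fin n → ℂ}

theorem eqOn_of_left (h : P.Represents J Q W s t q w) (hst : s < t)
    (hu : IsBalancedSolution J Q W s t z u) (hu₀ : Tendsto u (𝓝[>] s) (𝓝 u₀))
    (hunit : ∀ x, IsUnit (P.side 1 z x))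
    (hv : P.IsVolterraSolution (fun x y => x < y) 1 z u₀ v) :
    EqOn u (fun x => Ring.inverse (P.side 1 z x)
      ((P.J : (Fin n → ℂ) →L[ℂ] (Fin n → ℂ)) (v x))) (Ioo s t) := by
  have hw := h.isWeakSolution hst hu
  intro x hx
  refine (P.inverse_side_apply (hunit x) ?_).symm
  exact (hw.side_one_apply hx).trans
    (congrArg _ (hw.left_eq_volterraSolution h.null hunit hu₀ hv hx))

theorem eqOn_of_right (h : P.Represents J Q W s t q w) (hst : s < t)
    (hu : IsBalancedSolution J Q W s t z u) (hu₀ : Tendsto u (𝓝[<] t) (𝓝 u₀))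
    (hunit : ∀ x, IsUnit (P.side (-1) z x))
    (hv : P.IsVolterraSolution (fun x y => y < x) (-1) z u₀ v) :
    EqOn u (fun x => Ring.inverse (P.side (-1) z x)
      ((P.J : (Fin n → ℂ) →L[ℂ] (Fin n → ℂ)) (v x))) (Ioo s t) := by
  have hw := h.isWeakSolution hst hu
  intro x hx
  refine (P.inverse_side_apply (hunit x) ?_).symm
  exact (hw.side_neg_one_apply hx).trans
    (congrArg _ (hw.right_eq_volterraSolution h.null hunit hu₀ hv hx))

end MeasureSystem.Represents

open MeasureSystem

/-- The analytic claims concern any family that solves the problem for z outside Λ and is arbitrary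
on Λ. Uniqueness fixes it off Λ, and values on the discrete set Λ do not affect meromorphy. -/
theorem theoremT {n : ℕ} (a b : EReal)
    (J : Matrix (Fin n) (Fin n) ℂ) (hJ : IsUnit J) (hJskew : Jᴴ = -J)
    (Q W : ℝ → Matrix (Fin n) (Fin n) ℂ)
    (hQ : ∀ i j, LocallyBoundedVariationOn (fun x => Q x i j) (realIoo a b))
    (hW : ∀ i j, LocallyBoundedVariationOn (fun x => W x i j) (realIoo a b))
    (hq : HermitianDeriv a b Q) (hw : NonnegDeriv a b W)
    (s t : ℝ) (hst : s < t) (hsub : Icc s t ⊆ realIoo a b)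
    (hXi : Ioo s t ∩ XiSet a b J Q W 0 = ∅) (u₀ : Fin n → ℂ) :
    -- initial condition at `s`
    ((∀ z ∉ LambdaIoo J Q W s t, ∃ u : ℝ → Fin n → ℂ,
        (IsBalancedSolution J Q W s t z u ∧ Tendsto u (𝓝[>] s) (𝓝 u₀)) ∧
        ∀ v : ℝ → Fin n → ℂ, IsBalancedSolution J Q W s t z v →
          Tendsto v (𝓝[>] s) (𝓝 u₀) → EqOn v u (Ioo s t)) ∧
      (∀ u : ℝ → ℂ → Fin n → ℂ,
        (∀ z ∉ LambdaIoo J Q W s t, IsBalancedSolution J Q W s t z (fun x => u x z) ∧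
          Tendsto (fun x => u x z) (𝓝[>] s) (𝓝 u₀)) →
        (∀ x ∈ Ioo s t, AnalyticOnNhd ℂ (u x) (LambdaIoo J Q W s t)ᶜ ∧ Meromorphic (u x)) ∧
        (∀ z ∉ LambdaIoo J Q W s t, ∃ l, Tendsto (fun x => u x z) (𝓝[<] t) (𝓝 l)) ∧
        ∀ ut : ℂ → Fin n → ℂ,
          (∀ z ∉ LambdaIoo J Q W s t, Tendsto (fun x => u x z) (𝓝[<] t) (𝓝 (ut z))) →
          AnalyticOnNhd ℂ ut (LambdaIoo J Q W s t)ᶜ ∧ Meromorphic ut)) ∧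
    -- initial condition at `t`
    ((∀ z ∉ LambdaIoo J Q W s t, ∃ u : ℝ → Fin n → ℂ,
        (IsBalancedSolution J Q W s t z u ∧ Tendsto u (𝓝[<] t) (𝓝 u₀)) ∧
        ∀ v : ℝ → Fin n → ℂ, IsBalancedSolution J Q W s t z v →
          Tendsto v (𝓝[<] t) (𝓝 u₀) → EqOn v u (Ioo s t)) ∧
      (∀ u : ℝ → ℂ → Fin n → ℂ,
        (∀ z ∉ LambdaIoo J Q W s t, IsBalancedSolution J Q W s t z (fun x => u x z) ∧
          Tendsto (fun x => u x z) (𝓝[<] t) (𝓝 u₀)) →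
        (∀ x ∈ Ioo s t, AnalyticOnNhd ℂ (u x) (LambdaIoo J Q W s t)ᶜ ∧ Meromorphic (u x)) ∧
        (∀ z ∉ LambdaIoo J Q W s t, ∃ l, Tendsto (fun x => u x z) (𝓝[>] s) (𝓝 l)) ∧
        ∀ us : ℂ → Fin n → ℂ,
          (∀ z ∉ LambdaIoo J Q W s t, Tendsto (fun x => u x z) (𝓝[>] s) (𝓝 (us z))) →
          AnalyticOnNhd ℂ us (LambdaIoo J Q W s t)ᶜ ∧ Meromorphic us)) := by
  obtain ⟨P, q, w, h⟩ := exists_represents hJ hst.le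
    (fun i j c d hc hd => (hQ i j c d (hsub hc) (hsub hd)).mono (inter_subset_inter_left _ hsub))
    fun i j c d hc hd => (hW i j c d (hsub hc) (hsub hd)).mono (inter_subset_inter_left _ hsub)
  have hdet : ∀ x ∈ Ioo s t, (Bplus J Q W x 0).det * (Bminus J Q W x 0).det ≠ 0 :=
    fun x hx h0 => (hXi ▸ ⟨hx, hsub ⟨hx.1.le, hx.2.le⟩, h0⟩ : x ∈ (∅ : Set ℝ))
  have hpol : ∀ x, P.HasPolarInverse 1 x :=
    h.hasPolarInverse fun x hx => left_ne_zero_of_mul (hdet x hx)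
  have hpol' : ∀ x, P.HasPolarInverse (-1) x := by
    refine h.hasPolarInverse fun x hx => ?_
    rw [neg_div, neg_smul, ← sub_eq_add_neg]
    exact right_ne_zero_of_mul (hdet x hx)
  have hTo := h.isOpen_compl_LambdaIoo
  have hT := h.eventually_notMem_LambdaIoo hpol hpol'
  have hunit : ∀ z ∈ (LambdaIoo J Q W s t)ᶜ, ∀ x, IsUnit (P.side 1 z x) :=
    fun z hz => (h.notMem_LambdaIoo_iff.1 hz).1
  have hunit' : ∀ z ∈ (LambdaIoo J Q W s t)ᶜ, ∀ x, IsUnit (P.side (-1) z x) :=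
    fun z hz => (h.notMem_LambdaIoo_iff.1 hz).2
  obtain ⟨v, hv⟩ : ∃ v : ℝ → ℂ → Fin n → ℂ, ∀ z ∈ (LambdaIoo J Q W s t)ᶜ,
      P.IsVolterraSolution (fun x y => x < y) 1 z u₀ fun x => v x z := by
    -- For each z a local family is chosen and evaluated only at its own z. No coherence between the
    -- choices is needed, since uniqueness restores holomorphy.
    choose! U _ hzU _ v hv _ using fun z hz =>
      P.exists_isVolterraSolution measurableStrictOrder_lt (hunit z hz) u₀
    exact ⟨fun x z => v z x z, fun z hz => hv z hz z (hzU z hz)⟩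
  obtain ⟨v', hv'⟩ : ∃ v : ℝ → ℂ → Fin n → ℂ, ∀ z ∈ (LambdaIoo J Q W s t)ᶜ,
      P.IsVolterraSolution (fun x y => y < x) (-1) z u₀ fun x => v x z := by
    choose! U _ hzU _ v hv _ using fun z hz =>
      P.exists_isVolterraSolution measurableStrictOrder_gt (hunit' z hz) u₀
    exact ⟨fun x z => v z x z, fun z hz => hv z hz z (hzU z hz)⟩
  have hIoo_left : Ioo s t ∈ 𝓝[>] s := Ioo_mem_nhdsGT hst
  have hIoo_right : Ioo s t ∈ 𝓝[<] t := Ioo_mem_nhdsLT hst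
  refine ⟨⟨fun z hz => ?_, fun u hu => ?_⟩, fun z hz => ?_, fun u hu => ?_⟩
  · exact ⟨_, ⟨h.isBalancedSolution hst ((hv z hz).isPrimitiveSolution_left (hunit z hz)),
      tendsto_left_endpoint_of_left h.null (hv z hz) (hunit z hz)⟩,
      fun y hy hy₀ => h.eqOn_of_left hst hy hy₀ (hunit z hz) (hv z hz)⟩
  · have heq := fun z hz => h.eqOn_of_left hst (hu z hz).1 (hu z hz).2 (hunit z hz) (hv z hz)
    have hlim : ∀ z ∉ LambdaIoo J Q W s t, Tendsto (fun x => u x z) (𝓝[<] t) (𝓝 (v t z)) :=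
      fun z hz => (tendsto_right_endpoint_of_left (hv z hz) (hunit z hz)).congr'
        ((heq z hz).symm.eventuallyEq_of_mem hIoo_right)
    exact ⟨fun x hx => analyticOnNhd_and_meromorphic_inverse_side measurableStrictOrder_lt hTo hT
      hunit hpol hv fun z hz => heq z hz hx, fun z hz => ⟨_, hlim z hz⟩,
      fun ut hut => analyticOnNhd_and_meromorphic_volterraSolution measurableStrictOrder_lt hTo hT
        hunit hpol hv fun z hz => tendsto_nhds_unique (hut z hz) (hlim z hz)⟩
  · exact ⟨_, ⟨h.isBalancedSolution hst ((hv' z hz).isPrimitiveSolution_right (hunit' z hz)),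
      tendsto_right_endpoint_of_right h.null (hv' z hz) (hunit' z hz)⟩,
      fun y hy hy₀ => h.eqOn_of_right hst hy hy₀ (hunit' z hz) (hv' z hz)⟩
  · have heq := fun z hz => h.eqOn_of_right hst (hu z hz).1 (hu z hz).2 (hunit' z hz) (hv' z hz)
    have hlim : ∀ z ∉ LambdaIoo J Q W s t, Tendsto (fun x => u x z) (𝓝[>] s) (𝓝 (v' s z)) :=
      fun z hz => (tendsto_left_endpoint_of_right (hv' z hz) (hunit' z hz)).congr'
        ((heq z hz).symm.eventuallyEq_of_mem hIoo_left)
    exact ⟨fun x hx => analyticOnNhd_and_meromorphic_inverse_side measurableStrictOrder_gt hTo hT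
      hunit' hpol' hv' fun z hz => heq z hz hx, fun z hz => ⟨_, hlim z hz⟩,
      fun us hus => analyticOnNhd_and_meromorphic_volterraSolution measurableStrictOrder_gt hTo hT
        hunit' hpol' hv' fun z hz => tendsto_nhds_unique (hus z hz) (hlim z hz)⟩
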